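/- Let $m\ge 1$. Let $Cl_m$ be the Clifford algebra generated by $e_1,\dots,e_m$ with $e_j^2=-1$ and $e_ie_j=-e_je_i$ for $i\neq j$. Let $\mathcal S(\mathbb R^m)$ be the space of complex-valued Schwartz functions, and give $\mathcal S(\mathbb R^m)\otimes_{\mathbb R} Cl_m\cong\mathcal S(\mathbb R^m)^{2^m}$ its usual topology. On this space let $\underline x=\sum_j e_jx_j$ be the vector variable and $\partial_{\underline x}=\sum_j e_j\partial_{x_j}$ the Dirac operator (Clifford elements act by left multiplication). Put $$b^{+}=\tfrac{\sqrt2}{2}(\underline x-\partial_{\underline x}),\quad b^{-}=-\tfrac{\sqrt2}{2}(\underline x+\partial_{\underline x}),\quad h=\tfrac12\{b^-,b^+\}=\tfrac12(|x|^2-\Delta),\quad e=\tfrac14\{b^+,b^+\},\quad f=-\tfrac14\{b^-,b^-\},$$ and let $C=\tfrac14+\tfrac12b^-b^+-\tfrac12b^+b^-+h^2+2ef+2fe$ be the Casimir element of $\mathfrak{osp}(1|2)$. For $k\ge0$ let $\mathcal M_k$ be the complex vector space of spherical monogenics of degree $k$ (homogeneous polynomials of degree $k$ with values in $\mathbb C\otimes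 Cl_m$ that are annihilated by $\partial_{\underline x}$), and let $(M_k^{(\ell)})_\ell$ be any basis of it. With $L_p^\alpha$ the generalized Laguerre polynomials, put for $p,k\ge0$ $$\psi_{2p,k,\ell}=2^pp!\,L_p^{\frac m2+k-1}(|x|^2)\,M_k^{(\ell)}e^{-|x|^2/2},\qquad \psi_{2p+1,k,\ell}=2^pp!\sqrt2\,L_p^{\frac m2+k}(|x|^2)\,\underline x\,M_k^{(\ell)}e^{-|x|^2/2}.$$ Let $E_n(x)=\prod_{l=0}^{n-1}\frac{x^2-l^2}{n^2-l^2}$ and $D_n(x)=\prod_{l=0}^{n-1}\frac{x^2-(l+\frac12)^2}{(n+\frac12)^2-(l+\frac12)^2}$ (so $E_0=D_0=1$), and $$\mathcal E_{0101}=E_1,\quad \mathcal E_{0010}=E_2+2E_3,\quad \mathcal E_{0001}=\sum_{n\ge1}\Big(E_{2^n+1}+\sum_{i=1}^{n-1}2E_{2^n+1+2^i}\Big),$$ $$\mathcal D_{0110}=D_1+2D_2,\quad \mathcal D_{0011}=\sum_{n\ge1}\Big(D_{2^n}+\sum_{i=1}^{n-1}2D_{2^n+2^i}\Big),\quad \mathcal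 D_{0010}=2D_3+\sum_{n\ge0}\Big(D_{2^n+1}+\sum_{i=1}^{n-1}2D_{2^n+1+2^i}\Big).$$ For $a,b,c,d\in\{0,1,2,3\}$ put $F=a+b\,\mathcal E_{0101}+c\,\mathcal E_{0010}+d\,\mathcal E_{0001}$ if $m$ is odd and $F=a+b\,\mathcal D_{0110}+c\,\mathcal D_{0011}+d\,\mathcal D_{0010}$ if $m$ is even. These are even functions of $x$, and $F(\sqrt C)$ denotes the operator obtained by substituting $C$ for $x^2$; on each $\psi_{j,k,\ell}$ only finitely many terms of the series are nonzero. For an operator $A$ that is diagonal on the $\psi_{j,k,\ell}$, the operator exponential $e^A$ is the continuous linear operator on $\mathcal S(\mathbb R^m)\otimes Cl_m$ given on each $\psi_{j,k,\ell}$ by $\sum_n A^n\psi_{j,k,\ell}/n!$. **Theorem.** The operators $e^{i\frac\pi2F(\sqrt C)}$ (for each choice of $a,b,c,d$) and $e^{i\frac\pi2(h-\frac m2)}$ exist and are unique. Let $T$ be a $\mathbb C$-linear operator on $\mathcal S(\mathbb R^m)\otimes Cl_m$ that satisfies * (I) the Clifford–Helmholtz relations $T\circ\partial_{\underline x}=-i\,\underline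 x\circ T$ and $T\circ\underline x=-i\,\partial_{\underline x}\circ T$; * (II) $T\psi_{j,k,\ell}=\mu_{j,k}\psi_{j,k,\ell}$ for all $j,k,\ell$, with $\mu_{j,k}\in\mathbb C$; * (III) $T^4=\mathrm{id}$; * (IV) the eigenvalues are 4-periodic in $k$: $\mu_{j,k+4}=\mu_{j,k}$. Then $T=e^{i\frac\pi2F(\sqrt C)}\,e^{i\frac\pi2(h-\frac m2)}$ for some $F$ as above (that is, for some $a,b,c,d\in\{0,1,2,3\}$). Conversely, every operator $T$ of this form satisfies (I)–(IV). -/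

import Mathlib

open scoped SchwartzMap TensorProduct

noncomputable section

namespace CliffordFourier

/-! ### The Clifford algebra and the space of Clifford-valued Schwartz functions -/

/-- The quadratic form `v ↦ - ∑ vᵢ²` on `ℝᵐ`. -/
def negSumSq (m : ℕ) : QuadraticForm ℝ (Fin m → ℝ) :=
  QuadraticMap.weightedSumSquares ℝ (fun _ : Fin m => (-1 : ℝ))

/-- The real Clifford algebra `Cl_m`: generators `eᵢ` with `eᵢ² = -1`, `eᵢ eⱼ = - eⱼ eᵢ`. -/
abbrev Cl (m : ℕ) : Type := CliffordAlgebra (negSumSq m)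

/-- The generator `eⱼ` of `Cl_m`. -/
def gen {m : ℕ} (j : Fin m) : Cl m := CliffordAlgebra.ι (negSumSq m) (Pi.single j 1)

/-- `ℝᵐ` with its Euclidean norm. -/
abbrev Euc (m : ℕ) : Type := EuclideanSpace ℝ (Fin m)

/-- `S(ℝᵐ) ⊗ Cl_m`, with complex-valued Schwartz functions in the first factor. -/
abbrev CSchwartz (m : ℕ) : Type := 𝓢(Euc m, ℂ) ⊗[ℝ] Cl m

/-- The coordinate of a Clifford-valued Schwartz function along a linear functional on `Cl_m`. -/
def component {m : ℕ} (φ : Module.Dual ℝ (Cl m)) : CSchwartz m →ₗ[ℝ] 𝓢(Euc m, ℂ) :=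
  (TensorProduct.rid ℝ 𝓢(Euc m, ℂ)).toLinearMap ∘ₗ LinearMap.lTensor 𝓢(Euc m, ℂ) φ

/-- The Schwartz topology on `S(ℝᵐ) ⊗ Cl_m ≅ S(ℝᵐ)^(2^m)`: coordinatewise convergence
in `S(ℝᵐ)`. -/
instance instTopologicalSpaceCSchwartz (m : ℕ) : TopologicalSpace (CSchwartz m) :=
  ⨅ φ : Module.Dual ℝ (Cl m), TopologicalSpace.induced (component φ) inferInstance

/-! ### The operators -/

/-- Multiplication by the coordinate `xⱼ` on `S(ℝᵐ)`. -/
def mulCoord {m : ℕ} (j : Fin m) : 𝓢(Euc m, ℂ) →ₗ[ℂ] 𝓢(Euc m, ℂ) :=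
  (SchwartzMap.smulLeftCLM ℂ (fun x : Euc m => ((x j : ℝ) : ℂ))).toLinearMap

/-- The partial derivative `∂_{xⱼ}` on `S(ℝᵐ)`. -/
def partialDeriv {m : ℕ} (j : Fin m) : 𝓢(Euc m, ℂ) →ₗ[ℂ] 𝓢(Euc m, ℂ) :=
  (LineDeriv.lineDerivOpCLM ℂ 𝓢(Euc m, ℂ) (EuclideanSpace.single j (1 : ℝ))).toLinearMap

/-- The operator `A ⊗ (left multiplication by c)`. -/
def tensorOp {m : ℕ} (A : 𝓢(Euc m, ℂ) →ₗ[ℂ] 𝓢(Euc m, ℂ)) (c : Cl m) :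
    Module.End ℂ (CSchwartz m) :=
  TensorProduct.AlgebraTensorModule.map A (LinearMap.mulLeft ℝ c)

/-- Multiplication by the vector variable `x = ∑ eⱼ xⱼ`. -/
def vecVar (m : ℕ) : Module.End ℂ (CSchwartz m) := ∑ j : Fin m, tensorOp (mulCoord j) (gen j)

/-- The Dirac operator `∑ eⱼ ∂_{xⱼ}`. -/
def dirac (m : ℕ) : Module.End ℂ (CSchwartz m) := ∑ j : Fin m, tensorOp (partialDeriv j) (gen j)

/-- `b⁺ = (√2/2) (x - ∂)`. -/
def bPlus (m : ℕ) : Module.End ℂ (CSchwartz m) :=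
  ((√2 / 2 : ℝ) : ℂ) • (vecVar m - dirac m)

/-- `b⁻ = -(√2/2) (x + ∂)`. -/
def bMinus (m : ℕ) : Module.End ℂ (CSchwartz m) :=
  (-(√2 / 2 : ℝ) : ℂ) • (vecVar m + dirac m)

/-- `h = ½ {b⁻, b⁺}`, which is `½ (|x|² - Δ)`. -/
def hOp (m : ℕ) : Module.End ℂ (CSchwartz m) :=
  (1 / 2 : ℂ) • (bMinus m * bPlus m + bPlus m * bMinus m)

/-- `e = ¼ {b⁺, b⁺}`. -/
def eOp (m : ℕ) : Module.End ℂ (CSchwartz m) :=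
  (1 / 4 : ℂ) • (bPlus m * bPlus m + bPlus m * bPlus m)

/-- `f = -¼ {b⁻, b⁻}`. -/
def fOp (m : ℕ) : Module.End ℂ (CSchwartz m) :=
  (-1 / 4 : ℂ) • (bMinus m * bMinus m + bMinus m * bMinus m)

/-- The Casimir element `C = ¼ + ½ b⁻b⁺ - ½ b⁺b⁻ + h² + 2ef + 2fe` of `osp(1|2)`. -/
def casimir (m : ℕ) : Module.End ℂ (CSchwartz m) :=
  (1 / 4 : ℂ) • (1 : Module.End ℂ (CSchwartz m)) + (1 / 2 : ℂ) • (bMinus m * bPlus m)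
    - (1 / 2 : ℂ) • (bPlus m * bMinus m) + hOp m * hOp m
    + (2 : ℂ) • (eOp m * fOp m) + (2 : ℂ) • (fOp m * eOp m)

/-! ### The Clifford–Hermite basis -/

/-- Clifford-valued polynomials on `ℝᵐ`. -/
abbrev CPoly (m : ℕ) : Type := MvPolynomial (Fin m) ℂ ⊗[ℝ] Cl m

/-- The Dirac operator on Clifford-valued polynomials. -/
def polyDirac (m : ℕ) : CPoly m →ₗ[ℂ] CPoly m :=
  ∑ j : Fin m, TensorProduct.AlgebraTensorModule.map
    (MvPolynomial.pderiv (R := ℂ) j).toLinearMap (LinearMap.mulLeft ℝ (gen j))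

/-- Multiplication by the vector variable on Clifford-valued polynomials. -/
def polyVecVar (m : ℕ) : CPoly m →ₗ[ℂ] CPoly m :=
  ∑ j : Fin m, TensorProduct.AlgebraTensorModule.map
    (LinearMap.mulLeft ℂ (MvPolynomial.X j : MvPolynomial (Fin m) ℂ)) (LinearMap.mulLeft ℝ (gen j))

/-- Multiplication of a Clifford-valued polynomial by a scalar polynomial. -/
def polyMul {m : ℕ} (q : MvPolynomial (Fin m) ℂ) : CPoly m →ₗ[ℂ] CPoly m :=
  TensorProduct.AlgebraTensorModule.map (LinearMap.mulLeft ℂ q) LinearMap.id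

/-- `ℳ_k`: the spherical monogenics of degree `k`, that is, the Clifford-valued polynomials that
are homogeneous of degree `k` and annihilated by the Dirac operator. -/
def monogenics (m k : ℕ) : Submodule ℂ (CPoly m) :=
  LinearMap.range (TensorProduct.AlgebraTensorModule.map
      (MvPolynomial.homogeneousSubmodule (Fin m) ℂ k).subtype
      (LinearMap.id : Cl m →ₗ[ℝ] Cl m))
    ⊓ LinearMap.ker (polyDirac m)

/-- The generalized Laguerre polynomial `L_j^α`. -/
def laguerre (j : ℕ) (α : ℝ) : Polynomial ℝ :=
  ∑ n ∈ Finset.range (j + 1),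
    Polynomial.C (Real.Gamma (j + α + 1) / (Nat.factorial n * Nat.factorial (j - n) * Real.Gamma (n + α + 1)))
      * (-Polynomial.X) ^ n

/-- The polynomial `L_j^α(|x|²)` on `ℝᵐ`. -/
def laguerreSq (m j : ℕ) (α : ℝ) : MvPolynomial (Fin m) ℂ :=
  Polynomial.aeval (∑ i : Fin m, MvPolynomial.X i ^ 2 : MvPolynomial (Fin m) ℂ) (laguerre j α)

/-- The Gaussian `e^{-|x|²/2}` as a function. -/
def gaussFun (m : ℕ) (x : Euc m) : ℂ := ((Real.exp (-(‖x‖ ^ 2 / 2)) : ℝ) : ℂ)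

theorem negHalfSq_hasTemperateGrowth (m : ℕ) :
    (fun x : Euc m => -(‖x‖ ^ 2 / 2)).HasTemperateGrowth := by
  have h : (fun x : Euc m => (-(1 / 2 : ℝ)) * ‖x‖ ^ 2).HasTemperateGrowth :=
    (Function.HasTemperateGrowth.const _).mul (Function.hasTemperateGrowth_norm_sq (Euc m))
  refine (congrArg Function.HasTemperateGrowth ?_).mp h
  funext x
  ring

theorem gaussFun_contDiff (m : ℕ) : ContDiff ℝ ((⊤ : ℕ∞) : WithTop ℕ∞) (gaussFun m) :=
  Complex.ofRealCLM.contDiff.comp (Real.contDiff_exp.comp (negHalfSq_hasTemperateGrowth m).1)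

theorem gaussian_pow_bounded (N : ℕ) :
    ∃ C : ℝ, ∀ r : ℝ, 0 ≤ r → (1 + r) ^ N * Real.exp (-(r ^ 2 / 2)) ≤ C := by
  refine ⟨Nat.factorial N * Real.exp 2, fun r hr => ?_⟩
  have h1 : (1 + r) ^ N / Nat.factorial N ≤ Real.exp (1 + r) :=
    Real.pow_div_factorial_le_exp _ (by positivity) N
  have hN : (0 : ℝ) < Nat.factorial N := by positivity
  have h2 : (1 + r) ^ N ≤ Nat.factorial N * Real.exp (1 + r) := by
    rw [div_le_iff₀ hN] at h1
    linarith
  calc (1 + r) ^ N * Real.exp (-(r ^ 2 / 2))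
      ≤ Nat.factorial N * Real.exp (1 + r) * Real.exp (-(r ^ 2 / 2)) := by gcongr
    _ = Nat.factorial N * Real.exp (1 + r + -(r ^ 2 / 2)) := by rw [Real.exp_add (1 + r)]; ring
    _ ≤ Nat.factorial N * Real.exp 2 := by
        gcongr
        nlinarith [sq_nonneg (r - 1)]

theorem gaussFun_decay (m k n : ℕ) :
    ∃ C : ℝ, ∀ x : Euc m, ‖x‖ ^ k * ‖iteratedFDeriv ℝ n (gaussFun m) x‖ ≤ C := by
  have hf := negHalfSq_hasTemperateGrowth m
  obtain ⟨K, A, hA, hb⟩ := hf.norm_iteratedFDeriv_le_uniform n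
  obtain ⟨G, hG⟩ := gaussian_pow_bounded (k + K * n)
  refine ⟨Nat.factorial n * (1 + A) ^ n * G, fun x => ?_⟩
  have hx : (0 : ℝ) ≤ ‖x‖ := norm_nonneg x
  have hD1 : (1 : ℝ) ≤ (1 + A) * (1 + ‖x‖) ^ K :=
    one_le_mul_of_one_le_of_one_le (by linarith) (one_le_pow₀ (by linarith))
  have e1 : ‖iteratedFDeriv ℝ n (gaussFun m) x‖
      = ‖iteratedFDeriv ℝ n (Real.exp ∘ fun x : Euc m => -(‖x‖ ^ 2 / 2)) x‖ :=
    Complex.ofRealLI.norm_iteratedFDeriv_comp_left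
      (Real.contDiff_exp.comp hf.1).contDiffAt (by exact_mod_cast le_top)
  have e2 := norm_iteratedFDeriv_comp_le (𝕜 := ℝ) (g := Real.exp)
    (f := fun x : Euc m => -(‖x‖ ^ 2 / 2)) (n := n) (N := ((⊤ : ℕ∞) : WithTop ℕ∞))
    Real.contDiff_exp hf.1 (by exact_mod_cast le_top) x
    (C := Real.exp (-(‖x‖ ^ 2 / 2))) (D := (1 + A) * (1 + ‖x‖) ^ K)
    (fun i _ => by
      rw [norm_iteratedFDeriv_eq_norm_iteratedDeriv, iteratedDeriv_eq_iterate, Real.iter_deriv_exp,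
        Real.norm_eq_abs, abs_of_pos (Real.exp_pos _)])
    (fun i hi1 hi => by
      calc ‖iteratedFDeriv ℝ i (fun x : Euc m => -(‖x‖ ^ 2 / 2)) x‖
          ≤ A * (1 + ‖x‖) ^ K := hb i hi x
        _ ≤ (1 + A) * (1 + ‖x‖) ^ K := by gcongr; linarith
        _ ≤ ((1 + A) * (1 + ‖x‖) ^ K) ^ i := le_self_pow₀ hD1 (by omega))
  rw [e1]
  calc ‖x‖ ^ k * ‖iteratedFDeriv ℝ n (Real.exp ∘ fun x : Euc m => -(‖x‖ ^ 2 / 2)) x‖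
      ≤ (1 + ‖x‖) ^ k * (Nat.factorial n * Real.exp (-(‖x‖ ^ 2 / 2))
          * ((1 + A) * (1 + ‖x‖) ^ K) ^ n) := by
        gcongr
        linarith
    _ = Nat.factorial n * (1 + A) ^ n
          * ((1 + ‖x‖) ^ (k + K * n) * Real.exp (-(‖x‖ ^ 2 / 2))) := by
        rw [mul_pow, ← pow_mul, pow_add]
        ring
    _ ≤ Nat.factorial n * (1 + A) ^ n * G := by
        gcongr
        exact hG _ hx

/-- The Gaussian `e^{-|x|²/2}` as a Schwartz function. -/
def gauss (m : ℕ) : 𝓢(Euc m, ℂ) where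
  toFun := gaussFun m
  smooth' := gaussFun_contDiff m
  decay' := gaussFun_decay m

/-- A polynomial as a function on `ℝᵐ`. -/
def polyFun {m : ℕ} (p : MvPolynomial (Fin m) ℂ) (x : Euc m) : ℂ :=
  MvPolynomial.eval (fun i => ((x i : ℝ) : ℂ)) p

theorem coord_hasTemperateGrowth {m : ℕ} (i : Fin m) :
    (fun x : Euc m => ((x i : ℝ) : ℂ)).HasTemperateGrowth :=
  (Complex.ofRealCLM.comp (EuclideanSpace.proj i : Euc m →L[ℝ] ℝ)).hasTemperateGrowth

theorem polyFun_hasTemperateGrowth {m : ℕ} (p : MvPolynomial (Fin m) ℂ) :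
    (polyFun p).HasTemperateGrowth := by
  induction p using MvPolynomial.induction_on with
  | C a =>
    have h : polyFun (m := m) (MvPolynomial.C a) = fun _ => a := by
      funext x
      simp [polyFun]
    rw [h]
    exact Function.HasTemperateGrowth.const a
  | add p q hp hq =>
    have h : polyFun (p + q) = polyFun p + polyFun q := by
      funext x
      simp [polyFun]
    rw [h]
    exact hp.add hq
  | mul_X p i hp =>
    have h : polyFun (p * MvPolynomial.X i) = polyFun p * fun x => ((x i : ℝ) : ℂ) := by
      funext x
      simp [polyFun]
    rw [h]
    exact hp.mul (coord_hasTemperateGrowth i)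

/-- The linear map `p ↦ p e^{-|x|²/2}` from polynomials to Schwartz functions. -/
def gaussMul (m : ℕ) : MvPolynomial (Fin m) ℂ →ₗ[ℂ] 𝓢(Euc m, ℂ) where
  toFun p := SchwartzMap.smulLeftCLM ℂ (polyFun p) (gauss m)
  map_add' p q := by
    ext x
    simp [SchwartzMap.smulLeftCLM_apply_apply (polyFun_hasTemperateGrowth _), polyFun, add_mul]
  map_smul' c p := by
    ext x
    simp [SchwartzMap.smulLeftCLM_apply_apply (polyFun_hasTemperateGrowth _), polyFun, mul_assoc]

/-- The linear map `P ↦ P e^{-|x|²/2}` on Clifford-valued polynomials. -/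
def gaussMulCl (m : ℕ) : CPoly m →ₗ[ℂ] CSchwartz m :=
  TensorProduct.AlgebraTensorModule.map (gaussMul m) LinearMap.id

/-- The Clifford–Hermite function `ψ_{j,k}` built from a spherical monogenic `M` of degree `k`:
`ψ_{2p,k} = 2^p p! L_p^{m/2+k-1}(|x|²) M e^{-|x|²/2}` and
`ψ_{2p+1,k} = 2^p p! √2 L_p^{m/2+k}(|x|²) x M e^{-|x|²/2}`. -/
def psi (m j k : ℕ) (M : CPoly m) : CSchwartz m :=
  if Even j then
    ((2 ^ (j / 2) * Nat.factorial (j / 2) : ℝ) : ℂ) •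
      gaussMulCl m (polyMul (laguerreSq m (j / 2) ((m : ℝ) / 2 + k - 1)) M)
  else
    ((2 ^ (j / 2) * Nat.factorial (j / 2) * √2 : ℝ) : ℂ) •
      gaussMulCl m (polyMul (laguerreSq m (j / 2) ((m : ℝ) / 2 + k)) (polyVecVar m M))

/-! ### The integer-valued functions of type `ℰ` and `𝒟`

All polynomials `E_n(x)`, `D_n(x)` are even in `x`. They are given here as polynomials in `x²`,
so that `aeval A` performs the substitution of the operator `A` for `x²`. -/

/-- `E_n(x) = ∏_{l<n} (x² - l²)/(n² - l²)` as a polynomial in `x²`. -/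
def Epoly (n : ℕ) : Polynomial ℂ :=
  ∏ l ∈ Finset.range n,
    Polynomial.C (((n : ℂ) ^ 2 - (l : ℂ) ^ 2)⁻¹) * (Polynomial.X - Polynomial.C ((l : ℂ) ^ 2))

/-- `D_n(x) = ∏_{l<n} (x² - (l+½)²)/((n+½)² - (l+½)²)` as a polynomial in `x²`. -/
def Dpoly (n : ℕ) : Polynomial ℂ :=
  ∏ l ∈ Finset.range n,
    Polynomial.C ((((n : ℂ) + 1 / 2) ^ 2 - ((l : ℂ) + 1 / 2) ^ 2)⁻¹)
      * (Polynomial.X - Polynomial.C (((l : ℂ) + 1 / 2) ^ 2))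

/-- The operator series `∑ₙ pₙ(A)`, evaluated at a vector. (It is applied only to eigenvectors
of `A` on which all but finitely many terms vanish.) -/
def opSeries {m : ℕ} (A : Module.End ℂ (CSchwartz m)) (p : ℕ → Polynomial ℂ)
    (v : CSchwartz m) : CSchwartz m :=
  ∑' n : ℕ, Polynomial.aeval A (p n) v

/-- `F(√A)` for `F = a + b ℰ₀₁₀₁ + c ℰ₀₀₁₀ + d ℰ₀₀₀₁`, where `ℰ₀₁₀₁ = E₁`,
`ℰ₀₀₁₀ = E₂ + 2 E₃`, `ℰ₀₀₀₁ = ∑_{n ≥ 1} (E_{2^n+1} + ∑_{1 ≤ i ≤ n-1} 2 E_{2^n+1+2^i})`. -/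
def typeE {m : ℕ} (A : Module.End ℂ (CSchwartz m)) (a b c d : ℕ) (v : CSchwartz m) :
    CSchwartz m :=
  (a : ℂ) • v
    + (b : ℂ) • Polynomial.aeval A (Epoly 1) v
    + (c : ℂ) • Polynomial.aeval A (Epoly 2 + 2 * Epoly 3) v
    + (d : ℂ) • opSeries A (fun n => Epoly (2 ^ (n + 1) + 1)
        + ∑ i ∈ Finset.Ico 1 (n + 1), 2 * Epoly (2 ^ (n + 1) + 1 + 2 ^ i)) v

/-- `F(√A)` for `F = a + b 𝒟₀₁₁₀ + c 𝒟₀₀₁₁ + d 𝒟₀₀₁₀`, where `𝒟₀₁₁₀ = D₁ + 2 D₂`,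
`𝒟₀₀₁₁ = ∑_{n ≥ 1} (D_{2^n} + ∑_{1 ≤ i ≤ n-1} 2 D_{2^n+2^i})`,
`𝒟₀₀₁₀ = 2 D₃ + ∑_{n ≥ 0} (D_{2^n+1} + ∑_{1 ≤ i ≤ n-1} 2 D_{2^n+1+2^i})`. -/
def typeD {m : ℕ} (A : Module.End ℂ (CSchwartz m)) (a b c d : ℕ) (v : CSchwartz m) :
    CSchwartz m :=
  (a : ℂ) • v
    + (b : ℂ) • Polynomial.aeval A (Dpoly 1 + 2 * Dpoly 2) v
    + (c : ℂ) • opSeries A (fun n => Dpoly (2 ^ (n + 1))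
        + ∑ i ∈ Finset.Ico 1 (n + 1), 2 * Dpoly (2 ^ (n + 1) + 2 ^ i)) v
    + (d : ℂ) • (Polynomial.aeval A (2 * Dpoly 3) v
        + opSeries A (fun n => Dpoly (2 ^ n + 1)
            + ∑ i ∈ Finset.Ico 1 n, 2 * Dpoly (2 ^ n + 1 + 2 ^ i)) v)

/-- `F(√C)` for the Casimir `C`, of type `ℰ` for `m` odd and of type `𝒟` for `m` even. -/
def FCasimir (m a b c d : ℕ) (v : CSchwartz m) : CSchwartz m :=
  if Even m then typeD (casimir m) a b c d v else typeE (casimir m) a b c d v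

/-! ### Operator exponentials -/

/-- `P = exp(A)`, for an operator `A` that is diagonal on the topological eigenbasis `B` of
`S(ℝᵐ) ⊗ Cl_m` (and is possibly defined on the span of `B` only): on `B` it is the sum of the
exponential series `∑ₙ Aⁿ v / n!`, and it is extended to the whole space by linearity and
continuity. -/
structure IsOpExp {m : ℕ} (B : Set (CSchwartz m)) (A : CSchwartz m → CSchwartz m)
    (P : CSchwartz m →ₗ[ℂ] CSchwartz m) : Prop where
  continuous : Continuous P
  hasSum : ∀ v ∈ B, HasSum (fun n : ℕ => (Nat.factorial n : ℂ)⁻¹ • A^[n] v) (P v)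

/-- The set of the functions `ψ_{j,k,ℓ}` that belong to the bases `(M_k^{(ℓ)})_ℓ` of `ℳ_k`. -/
def hermiteBasis {m : ℕ} {ι : ℕ → Type*} (M : ∀ k, Module.Basis (ι k) ℂ (monogenics m k)) :
    Set (CSchwartz m) :=
  {v | ∃ (j k : ℕ) (l : ι k), v = psi m j k (M k l)}

/-- `P = exp(i (π/2) F(√C))`. -/
def IsExpCasimir {m : ℕ} {ι : ℕ → Type*} (M : ∀ k, Module.Basis (ι k) ℂ (monogenics m k))
    (a b c d : ℕ) (P : CSchwartz m →ₗ[ℂ] CSchwartz m) : Prop :=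
  IsOpExp (hermiteBasis M) (fun v => (Complex.I * (Real.pi / 2)) • FCasimir m a b c d v) P

/-- `Q = exp(i (π/2) (h - m/2))`. -/
def IsExpOscillator {m : ℕ} {ι : ℕ → Type*} (M : ∀ k, Module.Basis (ι k) ℂ (monogenics m k))
    (Q : CSchwartz m →ₗ[ℂ] CSchwartz m) : Prop :=
  IsOpExp (hermiteBasis M)
    (fun v => (Complex.I * (Real.pi / 2)) • (hOp m v - ((m : ℂ) / 2) • v)) Q

/-! ### The properties -/

/-- The Clifford–Helmholtz relations `T ∂ = -i x T` and `T x = -i ∂ T`. -/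
def CliffordHelmholtz {m : ℕ} (T : CSchwartz m →ₗ[ℂ] CSchwartz m) : Prop :=
  T ∘ₗ dirac m = (-Complex.I) • (vecVar m ∘ₗ T) ∧
  T ∘ₗ vecVar m = (-Complex.I) • (dirac m ∘ₗ T)

/-- `T ψ_{j,k,ℓ} = μ_{j,k} ψ_{j,k,ℓ}` with eigenvalues that are 4-periodic in `k`. -/
def DiagonalPeriodic {m : ℕ} {ι : ℕ → Type*}
    (M : ∀ k, Module.Basis (ι k) ℂ (monogenics m k)) (T : CSchwartz m →ₗ[ℂ] CSchwartz m) : Prop :=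
  ∃ μ : ℕ → ℕ → ℂ,
    (∀ (j k : ℕ) (l : ι k), T (psi m j k (M k l)) = μ j k • psi m j k (M k l)) ∧
    ∀ j k : ℕ, μ j (k + 4) = μ j k

end CliffordFourier

end

noncomputable section

namespace CliffordFourier

open MeasureTheory SchwartzMap
open scoped FourierTransform LineDeriv ENNReal

/-! ### Coordinates and partial derivatives on scalar Schwartz functions -/

section Scalar

variable {m : ℕ}

/-! Algebra. The function `psi m j k M` is `b⁺` applied `j` times to `M e^{-|x|²/2}`, and this
Gaussian monogenic is killed by `b⁻` and has `h`-weight `m/2 + k`. So for fixed `k` the functions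
form lowest weight modules of `osp(1|2)`: `h` acts by `m/2 + k + j` and the Casimir element by `(k +
(m-1)/2)²` (`psi_eq`, `casimir_bPlus_pow`). The Clifford–Helmholtz relations say exactly that `T b⁺
= i b⁺ T` and `T b⁻ = -i b⁻ T`. Hence `T` commutes with `h`, and its eigenvalue at `(j, k)` is `i^j`
times the one at `(0, k)`, which is a fourth root of unity depending only on `k` mod 4. The
oscillator exponential contributes `i^(j+k)`, so it remains to see that `F` mod 4 can be any
function of `k` mod 4.

Arithmetic. At the relevant integers or half-integers, `E_n` and `D_n` are sums of binomial
coefficients. With `K = t/(1-t)²` their generating functions are `Kⁿ(1+t)/(1-t)` (for `n ≥ 1`) and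
`Kⁿ/(1-t)`. Modulo 4 one has `(1-t)⁴ = (1+t²)²`, so `K² = v - v²` for `v = t²/(1+t²)`. The dyadic
series are essentially the square of `∑ K^(2^n)`, which telescopes modulo 2; squaring lifts this to
modulo 4, and the series sums to the rational function `v` (`X_pow_dvd_dyadicSum_sub`). The basic
functions thus reduce to 4-periodic patterns of zeros and ones, and solving a triangular system over
`ℤ/4` produces every function on `ℤ/4` (`exists_casimirValue`).

Analysis. The exponentials exist because every bounded multiplier of the Hermite expansion is
continuous on the Schwartz space. Schwartz seminorms of `h`-eigenfunctions grow polynomially in the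
eigenvalue (`polyBounded_seminorm`), while the symmetry of `h` makes the Hermite components of a
Schwartz function decay faster than any power. Uniqueness holds because the expansion converges to
the function (`hasSum_hermiteProj`), by the Fischer decomposition and the totality of polynomials
times the Gaussian.

No continuity of `T` is assumed. The difference `U` of `T` and the product of the exponentials
commutes with `h` and kills all Hermite functions. Up to finitely many components, any `F` lies in
the range of `h - m/2 - n`; so `U F` lies in that range as well, its components of weight `m/2 + n`
vanish, and this holds for every `n` (`eq_zero_of_commute_hOp`). -/

theorem mulCoord_apply (j : Fin m) (f : 𝓢(Euc m, ℂ)) (x : Euc m) :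
    mulCoord j f x = ((x j : ℝ) : ℂ) * f x := by
  simp [mulCoord, smulLeftCLM_apply_apply (coord_hasTemperateGrowth j)]

theorem partialDeriv_eq (j : Fin m) (f : 𝓢(Euc m, ℂ)) :
    partialDeriv j f = ∂_{EuclideanSpace.single j (1 : ℝ)} f := rfl

theorem partialDeriv_apply (j : Fin m) (f : 𝓢(Euc m, ℂ)) (x : Euc m) :
    partialDeriv j f x = fderiv ℝ f x (EuclideanSpace.single j (1 : ℝ)) := by
  rw [partialDeriv_eq, lineDerivOp_apply_eq_fderiv]

theorem continuous_mulCoord (j : Fin m) : Continuous (mulCoord j) :=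
  (smulLeftCLM ℂ (fun x : Euc m => ((x j : ℝ) : ℂ))).continuous

theorem continuous_partialDeriv (j : Fin m) : Continuous (partialDeriv j) :=
  (LineDeriv.lineDerivOpCLM ℂ 𝓢(Euc m, ℂ) (EuclideanSpace.single j (1 : ℝ))).continuous

theorem mulCoord_comm (i j : Fin m) (f : 𝓢(Euc m, ℂ)) :
    mulCoord i (mulCoord j f) = mulCoord j (mulCoord i f) := by
  ext x
  simp only [mulCoord_apply]
  ring

theorem partialDeriv_comm (i j : Fin m) (f : 𝓢(Euc m, ℂ)) :
    partialDeriv i (partialDeriv j f) = partialDeriv j (partialDeriv i f) := by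
  ext x
  have key : ∀ i j : Fin m, partialDeriv i (partialDeriv j f) x
      = fderiv ℝ (fderiv ℝ f) x (EuclideanSpace.single i 1) (EuclideanSpace.single j 1) := by
    intro i j
    rw [partialDeriv_apply]
    have h1 : (⇑(partialDeriv j f) : Euc m → ℂ)
        = fun y => fderiv ℝ f y (EuclideanSpace.single j (1 : ℝ)) :=
      funext (partialDeriv_apply j f)
    rw [h1, fderiv_clm_apply]
    · simp
    · exact ((f.smooth 2).fderiv_right (m := 1) (by norm_num)).differentiable (by norm_num) x
    · fun_prop
  rw [key, key]
  have hs : IsSymmSndFDerivAt ℝ f x :=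
    (f.smooth 2).contDiffAt.isSymmSndFDerivAt (by simp)
  exact hs.eq _ _

theorem partialDeriv_mulCoord (i j : Fin m) (f : 𝓢(Euc m, ℂ)) :
    partialDeriv i (mulCoord j f) = mulCoord j (partialDeriv i f) + (if i = j then f else 0) := by
  ext x
  rw [partialDeriv_apply]
  have h1 : (⇑(mulCoord j f) : Euc m → ℂ) = fun y => ((y j : ℝ) : ℂ) * f y :=
    funext (mulCoord_apply j f)
  have h2 : HasFDerivAt (fun y : Euc m => ((y j : ℝ) : ℂ))
      (Complex.ofRealCLM.comp (EuclideanSpace.proj j : Euc m →L[ℝ] ℝ)) x :=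
    (Complex.ofRealCLM.comp (EuclideanSpace.proj j : Euc m →L[ℝ] ℝ)).hasFDerivAt
  have h3 := h2.mul (f.hasFDerivAt x)
  rw [h1, show (fun y : Euc m => ((y j : ℝ) : ℂ) * f y) = (fun y : Euc m => ((y j : ℝ) : ℂ)) * ⇑f from rfl, h3.fderiv]
  by_cases h : i = j
  · subst h
    simp [mulCoord_apply, partialDeriv_apply, mul_comm]
  · simp [mulCoord_apply, partialDeriv_apply, h, Ne.symm h]

/-- The embedding of Schwartz functions into the Hilbert space `L²`. -/
def toL2 (m : ℕ) : 𝓢(Euc m, ℂ) →L[ℂ] Lp ℂ 2 (volume : Measure (Euc m)) :=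
  toLpCLM ℂ ℂ 2 volume

theorem toL2_injective (m : ℕ) : Function.Injective (toL2 m) :=
  injective_toLp 2 volume

theorem inner_toL2 (f g : 𝓢(Euc m, ℂ)) :
    inner ℂ (toL2 m f) (toL2 m g) = ∫ x, starRingEnd ℂ (f x) * g x := by
  have := inner_toL2_toL2_eq f g volume
  simp only [RCLike.inner_apply] at this
  simp_rw [mul_comm (starRingEnd ℂ _)]
  exact this

theorem inner_mulCoord (j : Fin m) (f g : 𝓢(Euc m, ℂ)) :
    inner ℂ (toL2 m (mulCoord j f)) (toL2 m g) = inner ℂ (toL2 m f) (toL2 m (mulCoord j g)) := by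
  simp only [inner_toL2, mulCoord_apply, map_mul, Complex.conj_ofReal]
  congr 1
  ext x
  ring

theorem inner_partialDeriv (j : Fin m) (f g : 𝓢(Euc m, ℂ)) :
    inner ℂ (toL2 m (partialDeriv j f)) (toL2 m g)
      = - inner ℂ (toL2 m f) (toL2 m (partialDeriv j g)) := by
  have := integral_bilinear_lineDerivOp_right_eq_neg_left (μ := volume) f g
    ((ContinuousLinearMap.mul ℝ ℂ).comp Complex.conjCLE.toContinuousLinearMap)
    (EuclideanSpace.single j (1 : ℝ))
  simp only [inner_toL2, partialDeriv_eq]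
  simp only [ContinuousLinearMap.coe_comp, Function.comp_apply,
    ContinuousLinearMap.mul_apply'] at this
  rw [neg_eq_iff_eq_neg.symm] at this
  simpa using this.symm

/-- Twice the Hamiltonian of the harmonic oscillator, `|x|² - Δ`. -/
def hermiteOp (m : ℕ) : Module.End ℂ 𝓢(Euc m, ℂ) :=
  ∑ j : Fin m, (mulCoord j * mulCoord j - partialDeriv j * partialDeriv j)

theorem hermiteOp_apply (f : 𝓢(Euc m, ℂ)) : hermiteOp m f =
    ∑ j : Fin m, (mulCoord j (mulCoord j f) - partialDeriv j (partialDeriv j f)) := by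
  simp [hermiteOp]

/-- Each `x_j` is symmetric and each `∂_j` skew, so the energy of `f` is a sum of squares. For an
eigenfunction this bounds `x_j f` and `∂_j f` in `L²` by the eigenvalue. -/
theorem inner_hermiteOp_self (f : 𝓢(Euc m, ℂ)) :
    inner ℂ (toL2 m f) (toL2 m (hermiteOp m f))
      = ((∑ j, (‖toL2 m (mulCoord j f)‖ ^ 2 + ‖toL2 m (partialDeriv j f)‖ ^ 2) : ℝ) : ℂ) := by
  rw [hermiteOp_apply, map_sum, inner_sum, Complex.ofReal_sum]
  refine Finset.sum_congr rfl fun j _ => ?_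
  rw [map_sub, inner_sub_right, ← inner_mulCoord, sub_eq_add_neg, ← inner_partialDeriv,
    inner_self_eq_norm_sq_to_K, inner_self_eq_norm_sq_to_K]
  simp

theorem sum_norm_sq_of_hermiteOp_eq {f : 𝓢(Euc m, ℂ)} {c : ℝ}
    (hf : hermiteOp m f = (c : ℂ) • f) :
    ∑ j, (‖toL2 m (mulCoord j f)‖ ^ 2 + ‖toL2 m (partialDeriv j f)‖ ^ 2)
      = c * ‖toL2 m f‖ ^ 2 := by
  have h := inner_hermiteOp_self f
  rw [hf, map_smul, inner_smul_right, inner_self_eq_norm_sq_to_K] at h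
  have h' : (((∑ j, (‖toL2 m (mulCoord j f)‖ ^ 2 + ‖toL2 m (partialDeriv j f)‖ ^ 2) : ℝ)) : ℂ)
      = ((c * ‖toL2 m f‖ ^ 2 : ℝ) : ℂ) := by
    rw [← h]
    push_cast
    rfl
  exact Complex.ofReal_injective h'

theorem hermiteOp_mulCoord (j : Fin m) (f : 𝓢(Euc m, ℂ)) :
    hermiteOp m (mulCoord j f) = mulCoord j (hermiteOp m f) - (2 : ℂ) • partialDeriv j f := by
  simp only [hermiteOp_apply, map_sum, map_sub]
  rw [sub_eq_add_neg, ← sub_eq_iff_eq_add', ← Finset.sum_sub_distrib]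
  rw [Finset.sum_eq_single j]
  · rw [partialDeriv_mulCoord, map_add, partialDeriv_mulCoord]
    simp only [if_true]
    module
  · intro i _ hi
    rw [partialDeriv_mulCoord, map_add, partialDeriv_mulCoord, mulCoord_comm i j,
      mulCoord_comm i j]
    simp [hi]
  · simp

theorem hermiteOp_partialDeriv (j : Fin m) (f : 𝓢(Euc m, ℂ)) :
    hermiteOp m (partialDeriv j f)
    = partialDeriv j (hermiteOp m f) - (2 : ℂ) • mulCoord j f := by
  simp only [hermiteOp_apply, map_sum, map_sub]
  rw [sub_eq_add_neg, ← sub_eq_iff_eq_add', ← Finset.sum_sub_distrib]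
  rw [Finset.sum_eq_single j]
  · rw [partialDeriv_mulCoord, partialDeriv_mulCoord, map_add]
    simp only [if_true]
    module
  · intro i _ hi
    rw [partialDeriv_mulCoord, partialDeriv_mulCoord, map_add, partialDeriv_comm i j,
      partialDeriv_comm i j]
    simp [hi.symm]
  · simp

/-- `x_j + s ∂_j` lowers the eigenvalue by `2s`. The sign `s` is kept as a unit of `ℤ` so that
raising and lowering are treated at once. -/
theorem hermiteOp_ladder (s : ℤˣ) (j : Fin m) (f : 𝓢(Euc m, ℂ)) :
    hermiteOp m (mulCoord j f + ((s : ℤ) : ℂ) • partialDeriv j f)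
      = mulCoord j (hermiteOp m f) + ((s : ℤ) : ℂ) • partialDeriv j (hermiteOp m f)
        - (2 * (s : ℤ) : ℂ) • (mulCoord j f + ((s : ℤ) : ℂ) • partialDeriv j f) := by
  rw [map_add, map_smul, hermiteOp_mulCoord, hermiteOp_partialDeriv]
  rcases Int.units_eq_one_or s with rfl | rfl <;> simp <;> module

/-! ### Seminorms of eigenfunctions of the harmonic oscillator -/

/-- A seminorm that grows at most polynomially in the eigenvalue on `L²`-normalized
eigenfunctions of the harmonic oscillator. -/
def PolyBounded (p : Seminorm ℂ 𝓢(Euc m, ℂ)) : Prop :=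
  ∃ (C : ℝ) (L : ℕ), 0 ≤ C ∧ ∀ (c : ℝ) (f : 𝓢(Euc m, ℂ)), hermiteOp m f = (c : ℂ) • f →
    p f ≤ C * (1 + |c|) ^ L * ‖toL2 m f‖

namespace PolyBounded

theorem mono {p q : Seminorm ℂ 𝓢(Euc m, ℂ)} (hq : PolyBounded q) (K : ℝ) (hK : 0 ≤ K)
    (h : ∀ f, p f ≤ K * q f) : PolyBounded p := by
  obtain ⟨C, L, hC, H⟩ := hq
  refine ⟨K * C, L, by positivity, fun c f hf => (h f).trans ?_⟩
  calc K * q f ≤ K * (C * (1 + |c|) ^ L * ‖toL2 m f‖) := by gcongr; exact H c f hf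
    _ = _ := by ring

theorem add {p q : Seminorm ℂ 𝓢(Euc m, ℂ)} (hp : PolyBounded p) (hq : PolyBounded q) :
    PolyBounded (p + q) := by
  obtain ⟨C, L, hC, H⟩ := hp
  obtain ⟨C', L', hC', H'⟩ := hq
  refine ⟨C + C', L + L', by positivity, fun c f hf => ?_⟩
  have h1 : (1 : ℝ) ≤ 1 + |c| := by linarith [abs_nonneg c]
  calc (p + q) f = p f + q f := rfl
    _ ≤ C * (1 + |c|) ^ L * ‖toL2 m f‖ + C' * (1 + |c|) ^ L' * ‖toL2 m f‖ :=
        add_le_add (H c f hf) (H' c f hf)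
    _ ≤ C * (1 + |c|) ^ (L + L') * ‖toL2 m f‖ + C' * (1 + |c|) ^ (L + L') * ‖toL2 m f‖ := by
        gcongr <;> first | exact h1 | omega
    _ = _ := by ring

theorem sum {ι : Type*} (s : Finset ι) {p : ι → Seminorm ℂ 𝓢(Euc m, ℂ)}
    (hp : ∀ i ∈ s, PolyBounded (p i)) : PolyBounded (∑ i ∈ s, p i) := by
  classical
  induction s using Finset.induction_on with
  | empty => exact ⟨0, 0, le_rfl, fun c f _ => by simp⟩
  | insert a s ha ih =>
    rw [Finset.sum_insert ha]
    exact (hp a (by simp)).add (ih fun i hi => hp i (by simp [hi]))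

/-- A ladder operator sends an eigenfunction to an eigenfunction with eigenvalue shifted by 2, and
by the energy identity it multiplies the `L²` norm by at most `2(1 + |c|)`. One more power of `1 +
|c|` therefore suffices. -/
theorem comp_ladder {p : Seminorm ℂ 𝓢(Euc m, ℂ)} (hp : PolyBounded p) (s : ℤˣ) (j : Fin m) :
    PolyBounded (p.comp (mulCoord j + ((s : ℤ) : ℂ) • partialDeriv j)) := by
  obtain ⟨C, L, hC, H⟩ := hp
  refine ⟨C * 3 ^ L * 2, L + 1, by positivity, fun c f hf => ?_⟩
  have hs : |((s : ℤ) : ℝ)| = 1 := by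
    rcases Int.units_eq_one_or s with rfl | rfl <;> simp
  have hs' : ‖(((s : ℤ) : ℂ))‖ = 1 := by
    rcases Int.units_eq_one_or s with rfl | rfl <;> simp
  set g := mulCoord j f + ((s : ℤ) : ℂ) • partialDeriv j f with hg
  have hHg : hermiteOp m g = ((c - 2 * (s : ℤ) : ℝ) : ℂ) • g := by
    rw [hg, hermiteOp_ladder, hf]
    push_cast
    simp only [map_smul]
    module
  have hsum := sum_norm_sq_of_hermiteOp_eq hf
  have hle : ‖toL2 m (mulCoord j f)‖ ^ 2 + ‖toL2 m (partialDeriv j f)‖ ^ 2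
      ≤ c * ‖toL2 m f‖ ^ 2 := by
    rw [← hsum]
    exact Finset.single_le_sum
      (f := fun j => ‖toL2 m (mulCoord j f)‖ ^ 2 + ‖toL2 m (partialDeriv j f)‖ ^ 2)
      (fun i _ => by positivity) (Finset.mem_univ j)
  have hle2 : c * ‖toL2 m f‖ ^ 2 ≤ ((1 + |c|) * ‖toL2 m f‖) ^ 2 := by
    rw [mul_pow]
    gcongr
    nlinarith [le_abs_self c, abs_nonneg c]
  have hX : ‖toL2 m (mulCoord j f)‖ ≤ (1 + |c|) * ‖toL2 m f‖ :=
    abs_le_of_sq_le_sq' (by nlinarith [sq_nonneg ‖toL2 m (partialDeriv j f)‖]) (by positivity) |>.2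
  have hD : ‖toL2 m (partialDeriv j f)‖ ≤ (1 + |c|) * ‖toL2 m f‖ :=
    abs_le_of_sq_le_sq' (by nlinarith [sq_nonneg ‖toL2 m (mulCoord j f)‖]) (by positivity) |>.2
  have hgn : ‖toL2 m g‖ ≤ 2 * (1 + |c|) * ‖toL2 m f‖ := by
    rw [hg, map_add, map_smul]
    refine (norm_add_le _ _).trans ?_
    rw [norm_smul, hs']
    linarith
  have hc : 1 + |c - 2 * (s : ℤ)| ≤ 3 * (1 + |c|) := by
    have := abs_sub c (2 * ((s : ℤ) : ℝ))
    rw [abs_mul, hs] at this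
    norm_num at this
    linarith [abs_nonneg c]
  calc p.comp (mulCoord j + ((s : ℤ) : ℂ) • partialDeriv j) f = p g := rfl
    _ ≤ C * (1 + |c - 2 * (s : ℤ)|) ^ L * ‖toL2 m g‖ := H _ _ hHg
    _ ≤ C * (3 * (1 + |c|)) ^ L * (2 * (1 + |c|) * ‖toL2 m f‖) := by gcongr
    _ = _ := by rw [mul_pow]; ring

/-- `x_j f` is not an eigenfunction, but it is half the sum of the two ladder images of `f`. The
derivative is half their difference. -/
theorem comp_mulCoord {p : Seminorm ℂ 𝓢(Euc m, ℂ)} (hp : PolyBounded p) (j : Fin m) :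
    PolyBounded (p.comp (mulCoord j)) := by
  refine ((hp.comp_ladder 1 j).add (hp.comp_ladder (-1) j)).mono 1 zero_le_one fun f => ?_
  have h : (2 : ℂ) • mulCoord j f = (mulCoord j f + partialDeriv j f)
      + (mulCoord j f - partialDeriv j f) := by module
  have h2 := map_add_le_add p (mulCoord j f + partialDeriv j f) (mulCoord j f - partialDeriv j f)
  rw [← h, map_smul_eq_mul] at h2
  have h3 := apply_nonneg p (mulCoord j f)
  simp only [Complex.norm_ofNat] at h2
  simp only [Seminorm.comp_apply, add_apply, LinearMap.add_apply, LinearMap.sub_apply,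
    Units.val_one, Int.cast_one, one_smul, Units.val_neg, Int.cast_neg, neg_smul, one_mul,
    ← sub_eq_add_neg]
  linarith

theorem comp_partialDeriv {p : Seminorm ℂ 𝓢(Euc m, ℂ)} (hp : PolyBounded p) (j : Fin m) :
    PolyBounded (p.comp (partialDeriv j)) := by
  refine ((hp.comp_ladder 1 j).add (hp.comp_ladder (-1) j)).mono 1 zero_le_one fun f => ?_
  have h : (2 : ℂ) • partialDeriv j f = (mulCoord j f + partialDeriv j f)
      - (mulCoord j f - partialDeriv j f) := by module
  have h2 := map_sub_le_add p (mulCoord j f + partialDeriv j f) (mulCoord j f - partialDeriv j f)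
  rw [← h, map_smul_eq_mul] at h2
  have h3 := apply_nonneg p (partialDeriv j f)
  simp only [Complex.norm_ofNat] at h2
  simp only [Seminorm.comp_apply, add_apply, LinearMap.add_apply, LinearMap.sub_apply,
    Units.val_one, Int.cast_one, one_smul, Units.val_neg, Int.cast_neg, neg_smul, one_mul,
    ← sub_eq_add_neg]
  linarith

end PolyBounded

end Scalar

/-! ### A Sobolev estimate and polynomial growth of all Schwartz seminorms -/

section Sobolev

variable {m : ℕ}

/-- Multiplication by `1 + |x|²`. -/
def mulOneAddNormSq (m : ℕ) : Module.End ℂ 𝓢(Euc m, ℂ) :=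
  1 + ∑ j : Fin m, mulCoord j * mulCoord j

/-- The operator `1 - Δ / (4π²)`. -/
def oneSubLaplacian (m : ℕ) : Module.End ℂ 𝓢(Euc m, ℂ) :=
  1 - ((2 * Real.pi : ℂ) ^ 2)⁻¹ • ∑ j : Fin m, partialDeriv j * partialDeriv j

theorem mulOneAddNormSq_apply (f : 𝓢(Euc m, ℂ)) (x : Euc m) :
    mulOneAddNormSq m f x = ((1 + ‖x‖ ^ 2 : ℝ) : ℂ) * f x := by
  have h : mulOneAddNormSq m f = f + ∑ j, mulCoord j (mulCoord j f) := by
    simp [mulOneAddNormSq]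
  have h2 : ∀ s : Finset (Fin m), (∑ j ∈ s, mulCoord j (mulCoord j f)) x
      = ∑ j ∈ s, (((x j) ^ 2 : ℝ) : ℂ) * f x := by
    intro s
    induction s using Finset.induction_on with
    | empty => simp
    | insert a s ha ih =>
      rw [Finset.sum_insert ha, Finset.sum_insert ha, add_apply, ih, mulCoord_apply,
        mulCoord_apply]
      push_cast
      ring
  rw [h, add_apply, h2, EuclideanSpace.norm_sq_eq, ← Finset.sum_mul]
  simp only [Real.norm_eq_abs, sq_abs]
  push_cast
  ring

theorem mulOneAddNormSq_pow_apply (n : ℕ) (f : 𝓢(Euc m, ℂ)) (x : Euc m) :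
    (mulOneAddNormSq m ^ n) f x = (((1 + ‖x‖ ^ 2) ^ n : ℝ) : ℂ) * f x := by
  induction n with
  | zero => simp
  | succ n ih =>
    rw [pow_succ', Module.End.mul_apply, mulOneAddNormSq_apply, ih]
    push_cast
    ring

theorem fourier_partialDeriv (j : Fin m) (f : 𝓢(Euc m, ℂ)) :
    𝓕 (partialDeriv j f) = (2 * Real.pi * Complex.I) • mulCoord j (𝓕 f) := by
  rw [partialDeriv_eq, fourier_lineDerivOp_eq]
  congr 1
  ext x
  have : (fun x : Euc m => inner ℝ x (EuclideanSpace.single j (1 : ℝ))).HasTemperateGrowth :=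
    ((innerSL ℝ).flip (EuclideanSpace.single j (1 : ℝ))).hasTemperateGrowth
  rw [smulLeftCLM_apply_apply this, mulCoord_apply]
  simp [EuclideanSpace.inner_single_right]

/-- The factor `1/(4π²)` in `oneSubLaplacian` matches the convention `e^{-2πi⟨x,ξ⟩}`, so that the
symbol is exactly `1 + |ξ|²`. -/
theorem fourier_oneSubLaplacian (f : 𝓢(Euc m, ℂ)) :
    𝓕 (oneSubLaplacian m f) = mulOneAddNormSq m (𝓕 f) := by
  have h : (2 * Real.pi : ℂ) ≠ 0 := by simp [Real.pi_ne_zero]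
  have hF : ∀ g : 𝓢(Euc m, ℂ), 𝓕 g = FourierTransform.fourierₗ ℂ 𝓢(Euc m, ℂ) g := fun g => rfl
  simp only [oneSubLaplacian, mulOneAddNormSq, LinearMap.sub_apply, LinearMap.add_apply,
    Module.End.one_apply, LinearMap.smul_apply, LinearMap.sum_apply, Module.End.mul_apply]
  rw [hF, map_sub, map_smul, map_sum]
  simp only [← hF, fourier_partialDeriv, map_smul, smul_smul]
  rw [sub_eq_add_neg, Finset.smul_sum, ← Finset.sum_neg_distrib]
  congr 1
  refine Finset.sum_congr rfl fun j _ => ?_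
  rw [smul_smul, ← neg_smul]
  have : -(((2 * Real.pi : ℂ) ^ 2)⁻¹ * (2 * Real.pi * Complex.I * (2 * Real.pi * Complex.I))) = 1 := by
    field_simp
    rw [Complex.I_sq]
    ring
  rw [this, one_smul]

theorem fourier_oneSubLaplacian_pow (n : ℕ) (f : 𝓢(Euc m, ℂ)) :
    𝓕 ((oneSubLaplacian m ^ n) f) = (mulOneAddNormSq m ^ n) (𝓕 f) := by
  induction n with
  | zero => rfl
  | succ n ih =>
    rw [pow_succ', Module.End.mul_apply, fourier_oneSubLaplacian, ih, pow_succ',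
      Module.End.mul_apply]

theorem toL2_apply (f : 𝓢(Euc m, ℂ)) : toL2 m f = f.toLp 2 := rfl

theorem memLp_weight (m : ℕ) :
    MemLp (fun x : Euc m => ((1 + ‖x‖ ^ 2) ^ (m + 1))⁻¹ : Euc m → ℝ) 2 := by
  have hc : Continuous (fun x : Euc m => ((1 + ‖x‖ ^ 2) ^ (m + 1))⁻¹ : Euc m → ℝ) :=
    Continuous.inv₀ (by fun_prop) fun x => by positivity
  refine (memLp_two_iff_integrable_sq hc.aestronglyMeasurable).2 ?_
  -- The square of the weight is `(1 + |x|²)^(-r/2)` with `r = 4(m + 1)`, which exceeds the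
  -- dimension.
  have h := integrable_rpow_neg_one_add_norm_sq (E := Euc m) (μ := volume)
    (r := 2 * (2 * (m + 1) : ℕ)) (by
      rw [finrank_euclideanSpace_fin]
      push_cast
      have : (0 : ℝ) ≤ m := by positivity
      linarith)
  refine h.congr (Filter.Eventually.of_forall fun x => ?_)
  have hx : (0 : ℝ) ≤ 1 + ‖x‖ ^ 2 := by positivity
  simp only
  rw [show (-(2 * ((2 * (m + 1) : ℕ) : ℝ)) / 2) = -((2 * (m + 1) : ℕ) : ℝ) by ring,
    Real.rpow_neg hx, Real.rpow_natCast, inv_pow, ← pow_mul, mul_comm]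

theorem norm_toL2_eq (f : 𝓢(Euc m, ℂ)) : ‖toL2 m f‖ = (eLpNorm f 2 volume).toReal := by
  rw [toL2_apply, norm_toLp]

theorem norm_toLp_one_le_of_eq_smul {w : Euc m → ℝ} (hw : MemLp w 2) {f g : 𝓢(Euc m, ℂ)}
    (hf : (⇑f : Euc m → ℂ) = w • ⇑g) :
    ‖f.toLp 1‖ ≤ (eLpNorm w 2 volume).toReal * ‖toL2 m g‖ := by
  have h1 : eLpNorm f 1 volume ≤ eLpNorm w 2 volume * eLpNorm g 2 volume := by
    rw [hf]
    exact eLpNorm_smul_le_mul_eLpNorm g.continuous.aestronglyMeasurable hw.1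
  have h2 : eLpNorm w 2 volume ≠ ⊤ := hw.eLpNorm_ne_top
  have h3 : eLpNorm g 2 volume ≠ ⊤ := (g.memLp 2 volume).eLpNorm_ne_top
  rw [norm_toLp, norm_toL2_eq, ← ENNReal.toReal_mul]
  exact ENNReal.toReal_mono (ENNReal.mul_ne_top h2 h3) h1

/-- Cauchy–Schwarz after writing `f` as the square-integrable weight times `(1 + |x|²)^(m+1) f`. -/
theorem norm_toLp_one_le (m : ℕ) : ∃ C : ℝ, 0 ≤ C ∧ ∀ f : 𝓢(Euc m, ℂ),
    ‖f.toLp 1‖ ≤ C * ‖toL2 m ((mulOneAddNormSq m ^ (m + 1)) f)‖ := by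
  refine ⟨_, ENNReal.toReal_nonneg, fun f => norm_toLp_one_le_of_eq_smul (memLp_weight m) ?_⟩
  ext x
  have h : ((1 + ‖x‖ ^ 2) ^ (m + 1) : ℝ) ≠ 0 := by positivity
  rw [Pi.smul_apply', mulOneAddNormSq_pow_apply, Complex.real_smul, ← mul_assoc,
    ← Complex.ofReal_mul, inv_mul_cancel₀ h, Complex.ofReal_one, one_mul]

/-- A Sobolev inequality: by Fourier inversion the sup norm is at most the `L¹` norm of the Fourier
transform, which is bounded by a weighted `L²` norm, and Plancherel turns the weight into powers of
`1 - Δ/(4π²)`. -/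
theorem norm_apply_le (m : ℕ) : ∃ C : ℝ, 0 ≤ C ∧ ∀ (f : 𝓢(Euc m, ℂ)) (x : Euc m),
    ‖f x‖ ≤ C * ‖toL2 m ((oneSubLaplacian m ^ (m + 1)) f)‖ := by
  obtain ⟨C, hC, H⟩ := norm_toLp_one_le m
  refine ⟨C, hC, fun f x => ?_⟩
  -- The inverse transform is rewritten as a forward transform at `-x`, so that the bound for
  -- forward transforms applies.
  have h1 : f x = (𝓕 (𝓕 f) : 𝓢(Euc m, ℂ)) (-x) := by
    have h0 : (𝓕⁻ (𝓕 f) : 𝓢(Euc m, ℂ)) = f := FourierTransform.fourierInv_fourier_eq f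
    conv_lhs => rw [← h0, fourierInv_apply_eq]
    rfl
  have h2 := H (𝓕 f)
  rw [← fourier_oneSubLaplacian_pow, toL2_apply, norm_fourier_toL2_eq] at h2
  rw [h1]
  exact (norm_fourier_apply_le_toLp_one _ _).trans h2

theorem polyBounded_norm : PolyBounded ((normSeminorm ℂ _).comp (toL2 m).toLinearMap) :=
  ⟨1, 0, zero_le_one, fun c f _ => by simp⟩

theorem PolyBounded.comp_oneSubLaplacian {p : Seminorm ℂ 𝓢(Euc m, ℂ)} (hp : PolyBounded p) :
    PolyBounded (p.comp (oneSubLaplacian m)) := by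
  set K : ℂ := ((2 * Real.pi : ℂ) ^ 2)⁻¹
  have h2 : PolyBounded (∑ j : Fin m, (p.comp (partialDeriv j)).comp (partialDeriv j)) :=
    PolyBounded.sum _ fun j _ => (hp.comp_partialDeriv j).comp_partialDeriv j
  refine (hp.add (h2.mono (p := ‖K‖₊ • ∑ j : Fin m, (p.comp (partialDeriv j)).comp (partialDeriv j))
    ‖K‖ (norm_nonneg _) fun f => le_rfl)).mono 1 zero_le_one fun f => ?_
  rw [one_mul]
  have e : oneSubLaplacian m f = f - K • ∑ j : Fin m, partialDeriv j (partialDeriv j f) := by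
    simp [oneSubLaplacian, K]
  rw [Seminorm.comp_apply, e]
  refine (map_sub_le_add p _ _).trans ?_
  rw [map_smul_eq_mul]
  have h3 : p (∑ j : Fin m, partialDeriv j (partialDeriv j f))
      ≤ (∑ j : Fin m, (p.comp (partialDeriv j)).comp (partialDeriv j)) f := by
    rw [sum_apply]
    exact Finset.le_sum_of_subadditive p (map_zero p).le (map_add_le_add p) _ _
  have h4 := mul_le_mul_of_nonneg_left h3 (norm_nonneg K)
  have h5 : (p + ‖K‖₊ • ∑ j : Fin m, (p.comp (partialDeriv j)).comp (partialDeriv j)) f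
    = p f + ‖K‖ * (∑ j : Fin m, (p.comp (partialDeriv j)).comp (partialDeriv j)) f := rfl
  rw [h5]
  linarith

theorem PolyBounded.comp_oneSubLaplacian_pow {p : Seminorm ℂ 𝓢(Euc m, ℂ)} (hp : PolyBounded p)
    (n : ℕ) : PolyBounded (p.comp (oneSubLaplacian m ^ n)) := by
  induction n with
  | zero => exact hp
  | succ n ih => exact ih.comp_oneSubLaplacian

theorem polyBounded_seminorm_zero_zero : PolyBounded (SchwartzMap.seminorm ℂ 0 0 :
    Seminorm ℂ 𝓢(Euc m, ℂ)) := by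
  obtain ⟨C, hC, H⟩ := norm_apply_le m
  refine ((polyBounded_norm (m := m)).comp_oneSubLaplacian_pow (m + 1)).mono C hC fun f => ?_
  refine SchwartzMap.seminorm_le_bound ℂ 0 0 f (by positivity) fun x => ?_
  simpa using H f x

theorem norm_le_sum_abs (x : Euc m) : ‖x‖ ≤ ∑ i, |x i| := by
  rw [EuclideanSpace.norm_eq]
  refine Real.sqrt_le_iff.mpr ⟨by positivity, ?_⟩
  simp only [Real.norm_eq_abs]
  exact Finset.sum_sq_le_sq_sum_of_nonneg fun i _ => abs_nonneg _

theorem seminorm_succ_zero_le (k : ℕ) (f : 𝓢(Euc m, ℂ)) :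
    SchwartzMap.seminorm ℂ (k + 1) 0 f ≤ ∑ i : Fin m, SchwartzMap.seminorm ℂ k 0 (mulCoord i f) := by
  refine SchwartzMap.seminorm_le_bound ℂ (k + 1) 0 f (by positivity) fun x => ?_
  rw [norm_iteratedFDeriv_zero]
  calc ‖x‖ ^ (k + 1) * ‖f x‖ = ‖x‖ ^ k * ‖x‖ * ‖f x‖ := by ring
    _ ≤ ‖x‖ ^ k * (∑ i, |x i|) * ‖f x‖ := by gcongr; exact norm_le_sum_abs x
    _ = ∑ i, ‖x‖ ^ k * ‖mulCoord i f x‖ := by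
      rw [Finset.mul_sum, Finset.sum_mul]
      refine Finset.sum_congr rfl fun i _ => ?_
      rw [mulCoord_apply, norm_mul, Complex.norm_real, Real.norm_eq_abs]
      ring
    _ ≤ _ := Finset.sum_le_sum fun i _ => by
      simpa using SchwartzMap.le_seminorm ℂ k 0 (mulCoord i f) x

/-- The derivative is `∑ᵢ ∂ᵢf · dxᵢ`, and each map `c ↦ c · dxᵢ` has norm at most 1. -/
theorem norm_iteratedFDeriv_succ_le (n : ℕ) (f : 𝓢(Euc m, ℂ)) (x : Euc m) :
    ‖iteratedFDeriv ℝ (n + 1) f x‖ ≤ ∑ i : Fin m, ‖iteratedFDeriv ℝ n (partialDeriv i f) x‖ := by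
  rw [← norm_iteratedFDeriv_fderiv]
  set ρ : Fin m → (Euc m →L[ℝ] ℝ) := fun i => EuclideanSpace.proj i
  have h1 : fderiv ℝ f = ∑ i, (ContinuousLinearMap.smulRightL ℝ (Euc m) ℂ (ρ i))
      ∘ (partialDeriv i f) := by
    ext y v
    have hv : v = ∑ i, v i • EuclideanSpace.single i (1 : ℝ) := by
      ext j
      simp [Finset.sum_apply, Pi.single_apply]
    rw [Finset.sum_apply, sum_apply]
    conv_lhs => rw [hv, map_sum]
    refine Finset.sum_congr rfl fun i _ => ?_
    simp [ρ, partialDeriv_apply]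
  have hc : ∀ i, ContDiff ℝ n (partialDeriv i f) := fun i => (partialDeriv i f).smooth n
  rw [h1, iteratedFDeriv_sum_apply (fun i _ => ((ContinuousLinearMap.contDiff _).comp (hc i)).contDiffAt)]
  refine (norm_sum_le _ _).trans (Finset.sum_le_sum fun i _ => ?_)
  have := (ContinuousLinearMap.smulRightL ℝ (Euc m) ℂ (ρ i)).norm_iteratedFDeriv_comp_left
    (hc i).contDiffAt le_rfl (x := x)
  refine this.trans ?_
  refine mul_le_of_le_one_left (norm_nonneg _) ?_
  refine ContinuousLinearMap.opNorm_le_bound _ zero_le_one fun c => ?_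
  rw [one_mul]
  refine ContinuousLinearMap.opNorm_le_bound _ (norm_nonneg _) fun v => ?_
  rw [ContinuousLinearMap.smulRightL_apply_apply, ContinuousLinearMap.smulRight_apply, norm_smul,
    mul_comm]
  exact mul_le_mul_of_nonneg_left (PiLp.norm_apply_le v i) (norm_nonneg c)

theorem seminorm_succ_le (k n : ℕ) (f : 𝓢(Euc m, ℂ)) :
    SchwartzMap.seminorm ℂ k (n + 1) f
      ≤ ∑ i : Fin m, SchwartzMap.seminorm ℂ k n (partialDeriv i f) := by
  refine SchwartzMap.seminorm_le_bound ℂ k (n + 1) f (by positivity) fun x => ?_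
  calc _ ≤ ‖x‖ ^ k * ∑ i : Fin m, ‖iteratedFDeriv ℝ n (partialDeriv i f) x‖ := by
        gcongr
        exact norm_iteratedFDeriv_succ_le n f x
    _ ≤ _ := by
      rw [Finset.mul_sum]
      exact Finset.sum_le_sum fun i _ => SchwartzMap.le_seminorm ℂ k n _ x

/-- Each derivative in a seminorm is moved onto the function first, then each weight `‖x‖` as some
`x_i`, until only the sup norm is left. `PolyBounded` is stable under both moves. -/
theorem polyBounded_seminorm (k n : ℕ) : PolyBounded (SchwartzMap.seminorm ℂ k n :
    Seminorm ℂ 𝓢(Euc m, ℂ)) := by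
  induction n with
  | zero =>
    induction k with
    | zero => exact polyBounded_seminorm_zero_zero
    | succ k ih =>
      refine (PolyBounded.sum Finset.univ fun i _ => ih.comp_mulCoord i).mono 1 zero_le_one
        fun f => ?_
      rw [one_mul, sum_apply]
      exact seminorm_succ_zero_le k f
  | succ n ih =>
    refine (PolyBounded.sum Finset.univ fun i _ => ih.comp_partialDeriv i).mono 1 zero_le_one
      fun f => ?_
    rw [one_mul, sum_apply]
    exact seminorm_succ_le k n f

end Sobolev

/-! ### Absolutely convergent series of Schwartz functions -/

section Summation

variable {m : ℕ} {ι : Type*}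

/-- The pointwise sum of a family of Schwartz functions whose seminorms are summable. -/
def schwartzTsum (f : ι → 𝓢(Euc m, ℂ))
    (hf : ∀ k n, Summable fun i => SchwartzMap.seminorm ℂ k n (f i)) : 𝓢(Euc m, ℂ) where
  toFun x := ∑' i, f i x
  smooth' := contDiff_tsum (v := fun n i => SchwartzMap.seminorm ℂ 0 n (f i))
    (fun i => (f i).smooth ⊤) (fun n _ => hf 0 n)
    (fun n i x _ => norm_iteratedFDeriv_le_seminorm ℂ (f i) n x)
  decay' k n := by
    refine ⟨∑' i, SchwartzMap.seminorm ℂ k n (f i), fun x => ?_⟩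
    have h := iteratedFDeriv_tsum (𝕜 := ℝ) (N := ⊤)
      (v := fun n i => SchwartzMap.seminorm ℂ 0 n (f i))
      (fun i => (f i).smooth ⊤) (fun n _ => hf 0 n)
      (fun n i x _ => norm_iteratedFDeriv_le_seminorm ℂ (f i) n x) (k := n)
      (by exact_mod_cast le_top)
    rw [h]
    have hs : Summable fun i => ‖x‖ ^ k * ‖iteratedFDeriv ℝ n (f i) x‖ :=
      (hf k n).of_nonneg_of_le (fun i => by positivity)
        fun i => SchwartzMap.le_seminorm ℂ k n (f i) x
    have hs' : Summable fun i => ‖iteratedFDeriv ℝ n (f i) x‖ :=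
      (hf 0 n).of_nonneg_of_le (fun i => by positivity)
        fun i => norm_iteratedFDeriv_le_seminorm ℂ (f i) n x
    calc _ ≤ ‖x‖ ^ k * ∑' i, ‖iteratedFDeriv ℝ n (f i) x‖ := by
          gcongr
          exact norm_tsum_le_tsum_norm hs'
      _ = ∑' i, ‖x‖ ^ k * ‖iteratedFDeriv ℝ n (f i) x‖ := tsum_mul_left.symm
      _ ≤ _ := hs.tsum_le_tsum (fun i => SchwartzMap.le_seminorm ℂ k n (f i) x) (hf k n)

theorem schwartzTsum_apply (f : ι → 𝓢(Euc m, ℂ))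
    (hf : ∀ k n, Summable fun i => SchwartzMap.seminorm ℂ k n (f i)) (x : Euc m) :
    schwartzTsum f hf x = ∑' i, f i x := rfl

theorem seminorm_schwartzTsum_le (f : ι → 𝓢(Euc m, ℂ))
    (hf : ∀ k n, Summable fun i => SchwartzMap.seminorm ℂ k n (f i)) (k n : ℕ) :
    SchwartzMap.seminorm ℂ k n (schwartzTsum f hf) ≤ ∑' i, SchwartzMap.seminorm ℂ k n (f i) := by
  refine SchwartzMap.seminorm_le_bound ℂ k n _ (tsum_nonneg fun i => by positivity) fun x => ?_
  have h := iteratedFDeriv_tsum (𝕜 := ℝ) (N := ⊤)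
    (v := fun n i => SchwartzMap.seminorm ℂ 0 n (f i))
    (fun i => (f i).smooth ⊤) (fun n _ => hf 0 n)
    (fun n i x _ => norm_iteratedFDeriv_le_seminorm ℂ (f i) n x) (k := n)
    (by exact_mod_cast le_top)
  have h0 : (⇑(schwartzTsum f hf) : Euc m → ℂ) = fun x => ∑' i, f i x := rfl
  rw [h0, h]
  have hs : Summable fun i => ‖x‖ ^ k * ‖iteratedFDeriv ℝ n (f i) x‖ :=
    (hf k n).of_nonneg_of_le (fun i => by positivity)
      fun i => SchwartzMap.le_seminorm ℂ k n (f i) x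
  have hs' : Summable fun i => ‖iteratedFDeriv ℝ n (f i) x‖ :=
    (hf 0 n).of_nonneg_of_le (fun i => by positivity)
      fun i => norm_iteratedFDeriv_le_seminorm ℂ (f i) n x
  calc _ ≤ ‖x‖ ^ k * ∑' i, ‖iteratedFDeriv ℝ n (f i) x‖ := by
        gcongr
        exact norm_tsum_le_tsum_norm hs'
    _ = ∑' i, ‖x‖ ^ k * ‖iteratedFDeriv ℝ n (f i) x‖ := tsum_mul_left.symm
    _ ≤ _ := hs.tsum_le_tsum (fun i => SchwartzMap.le_seminorm ℂ k n (f i) x) (hf k n)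

/-- A remainder of the series is again a sum of the same kind, over the complement of a finite set,
so each of its seminorms is bounded by the tail of a convergent numerical series. -/
theorem hasSum_schwartzTsum (f : ι → 𝓢(Euc m, ℂ))
    (hf : ∀ k n, Summable fun i => SchwartzMap.seminorm ℂ k n (f i)) :
    HasSum f (schwartzTsum f hf) := by
  rw [HasSum, (schwartz_withSeminorms ℂ (Euc m) ℂ).tendsto_nhds]
  rintro ⟨k, n⟩ ε hε
  have h1 := tendsto_tsum_compl_atTop_zero fun i => SchwartzMap.seminorm ℂ k n (f i)
  filter_upwards [h1.eventually_lt_const hε] with s hs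
  refine lt_of_le_of_lt ?_ hs
  have hf' : ∀ k n, Summable fun i : {i // i ∉ s} => SchwartzMap.seminorm ℂ k n (f i) :=
    fun k n => (hf k n).subtype _
  have h2 : schwartzTsum f hf - ∑ i ∈ s, f i = schwartzTsum (fun i : {i // i ∉ s} => f i) hf' := by
    ext x
    have hx : Summable fun i => f i x := by
      refine Summable.of_norm ((hf 0 0).of_nonneg_of_le (fun i => norm_nonneg _) fun i => ?_)
      exact norm_le_seminorm ℂ (f i) x
    have h3 : (∑ i ∈ s, f i) x = ∑ i ∈ s, f i x := by simp
    rw [sub_apply, h3, schwartzTsum_apply, schwartzTsum_apply, ← hx.sum_add_tsum_subtype_compl s]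
    simp
  rw [schwartzSeminormFamily_apply, map_sub_rev, h2]
  exact seminorm_schwartzTsum_le _ hf' k n

end Summation

/-! ### Polynomials times the Gaussian are total -/

section Totality

variable {m : ℕ}

theorem gauss_apply (x : Euc m) : gauss m x = gaussFun m x := rfl

theorem gaussMul_apply (p : MvPolynomial (Fin m) ℂ) (x : Euc m) :
    gaussMul m p x = polyFun p x * gaussFun m x := by
  simp [gaussMul, smulLeftCLM_apply_apply (polyFun_hasTemperateGrowth _), gauss_apply]

theorem gaussFun_hasTemperateGrowth (m : ℕ) : (gaussFun m).HasTemperateGrowth :=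
  (gauss m).hasTemperateGrowth

/-- Completing the square gives `c r - r²/2 ≤ c²/2`, so the Gaussian absorbs the exponential. -/
theorem integrable_mul_gaussFun_mul_exp (f : 𝓢(Euc m, ℂ)) (c : ℝ) :
    Integrable fun x : Euc m => ‖gaussFun m x * f x‖ * Real.exp (c * ‖x‖) := by
  refine (f.integrable.norm.mul_const (Real.exp (c ^ 2 / 2))).mono' ?_
    (Filter.Eventually.of_forall fun x => ?_)
  · have h1 := (gauss m).continuous
    have h2 := f.continuous
    have h3 : Continuous (gaussFun m) := h1
    exact (by fun_prop : Continuous fun x : Euc m =>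
      ‖gaussFun m x * f x‖ * Real.exp (c * ‖x‖)).aestronglyMeasurable
  · rw [Real.norm_eq_abs, abs_of_nonneg (by positivity), norm_mul, gaussFun, Complex.norm_real,
      Real.norm_eq_abs, Real.abs_exp, mul_comm (Real.exp _), mul_assoc, ← Real.exp_add]
    gcongr
    nlinarith [sq_nonneg (‖x‖ - c)]

/-- Expand `e^{-2πi⟨x,ξ⟩}` in the Fourier integral of `e^{-|x|²/2} f`. Each term is a multiple of
the inner product of `f` with `⟨x,ξ⟩ⁿ e^{-|x|²/2}`, hence zero. The interchange is justified by
domination with `e^{2π|ξ||x|}`, so the Fourier transform vanishes identically. -/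
theorem eq_zero_of_inner_gaussMul {f : 𝓢(Euc m, ℂ)}
    (hf : ∀ p, inner ℂ (toL2 m (gaussMul m p)) (toL2 m f) = 0) : f = 0 := by
  set F : 𝓢(Euc m, ℂ) := smulLeftCLM ℂ (gaussFun m) f with hF
  have hFx : ∀ x, F x = gaussFun m x * f x := fun x => by
    rw [hF, smulLeftCLM_apply_apply (gaussFun_hasTemperateGrowth m), smul_eq_mul]
  have hzero : 𝓕 F = 0 := by
    ext ξ
    rw [fourier_coe, Real.fourier_eq', zero_apply]
    have key := hasSum_integral_of_dominated_convergence (μ := (volume : Measure (Euc m)))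
      (F := fun (n : ℕ) x => ((n.factorial : ℂ)⁻¹ *
        ((-2 * Real.pi * inner ℝ x ξ : ℝ) * Complex.I) ^ n) * F x)
      (f := fun x => Complex.exp ((-2 * Real.pi * inner ℝ x ξ : ℝ) * Complex.I) • F x)
      (fun n x => ((n.factorial : ℝ)⁻¹ * ((2 * Real.pi * ‖ξ‖) * ‖x‖) ^ n) * ‖F x‖)
      (fun n => ?_) (fun n => ?_) ?_ ?_ ?_
    · refine key.unique ?_
      have h0 : ∀ n : ℕ, ∫ x : Euc m, ((n.factorial : ℂ)⁻¹ *
          ((-2 * Real.pi * inner ℝ x ξ : ℝ) * Complex.I) ^ n) * F x = 0 := by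
        intro n
        have h1 := hf ((∑ i, MvPolynomial.C ((ξ i : ℝ) : ℂ) * MvPolynomial.X i) ^ n)
        rw [inner_toL2] at h1
        have h2 : ∀ x : Euc m, ((n.factorial : ℂ)⁻¹ *
            ((-2 * Real.pi * inner ℝ x ξ : ℝ) * Complex.I) ^ n) * F x
            = ((n.factorial : ℂ)⁻¹ * (-2 * Real.pi * Complex.I) ^ n) *
              (starRingEnd ℂ (gaussMul m
                ((∑ i, MvPolynomial.C ((ξ i : ℝ) : ℂ) * MvPolynomial.X i) ^ n) x) * f x) := by
          intro x
          have h3 : polyFun ((∑ i, MvPolynomial.C ((ξ i : ℝ) : ℂ) * MvPolynomial.X i) ^ n) x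
              = (((inner ℝ x ξ) ^ n : ℝ) : ℂ) := by
            simp [polyFun, PiLp.inner_apply]
          rw [gaussMul_apply, h3, hFx, gaussFun]
          simp only [map_mul, Complex.conj_ofReal]
          push_cast
          ring
        simp only [h2]
        rw [integral_const_mul, h1, mul_zero]
      simp only [h0]
      exact hasSum_zero
    · have := F.continuous
      exact (by fun_prop : Continuous fun x : Euc m => ((n.factorial : ℂ)⁻¹ *
        ((-2 * Real.pi * inner ℝ x ξ : ℝ) * Complex.I) ^ n) * F x).aestronglyMeasurable
    · refine Filter.Eventually.of_forall fun x => ?_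
      rw [norm_mul, norm_mul, norm_inv, Complex.norm_natCast, norm_pow, norm_mul, Complex.norm_I,
        mul_one, Complex.norm_real, norm_mul, norm_mul, norm_neg, Real.norm_ofNat,
        Real.norm_of_nonneg Real.pi_pos.le, mul_assoc (2 * Real.pi)]
      gcongr
      rw [mul_comm ‖ξ‖]
      exact norm_inner_le_norm x ξ
    · refine Filter.Eventually.of_forall fun x => ?_
      have := (Real.summable_pow_div_factorial ((2 * Real.pi * ‖ξ‖) * ‖x‖)).mul_right ‖F x‖
      simpa only [div_eq_inv_mul] using this
    · refine (integrable_mul_gaussFun_mul_exp f (2 * Real.pi * ‖ξ‖)).congr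
        (Filter.Eventually.of_forall fun x => ?_)
      simp only
      rw [tsum_mul_right, ← hFx, mul_comm, Real.exp_eq_exp_ℝ, NormedSpace.exp_eq_tsum_div]
      simp only [div_eq_inv_mul]
    · refine Filter.Eventually.of_forall fun x => ?_
      have := (NormedSpace.expSeries_div_hasSum_exp
        (((-2 * Real.pi * inner ℝ x ξ : ℝ) * Complex.I) : ℂ)).mul_right (F x)
      rw [← Complex.exp_eq_exp_ℂ] at this
      simp only [div_eq_inv_mul] at this
      exact this
  have hF0 : F = 0 := by
    have h0 : (𝓕⁻ (𝓕 F) : 𝓢(Euc m, ℂ)) = F := FourierTransform.fourierInv_fourier_eq F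
    rw [← h0, hzero]
    exact (FourierTransform.fourierInvₗ ℂ 𝓢(Euc m, ℂ)).map_zero
  ext x
  have hx := hFx x
  rw [hF0, zero_apply] at hx
  have hg : gaussFun m x ≠ 0 := by simp [gaussFun]
  simpa [hg] using hx.symm

end Totality

/-! ### A basis of the Clifford algebra adapted to its generators -/

section CliffordBasis

variable {m : ℕ}

theorem gen_mul_self (j : Fin m) : gen j * gen j = (-1 : Cl m) := by
  have h : negSumSq m (Pi.single j 1) = -1 := by
    simp [negSumSq, QuadraticMap.weightedSumSquares_apply, Pi.single_apply]
  rw [gen, CliffordAlgebra.ι_sq_scalar, h, map_neg, map_one]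

theorem gen_mul_gen_of_ne {i j : Fin m} (h : i ≠ j) :
    (gen i * gen j : Cl m) = -(gen j * gen i) := by
  have h0 : QuadraticMap.polar (negSumSq m) (Pi.single i 1) (Pi.single j 1) = 0 := by
    simp [QuadraticMap.polar, negSumSq, QuadraticMap.weightedSumSquares_apply, Pi.single_apply,
      mul_add, Finset.sum_add_distrib, h, h.symm]
  rw [eq_neg_iff_add_eq_zero, gen, gen, CliffordAlgebra.ι_mul_ι_add_swap, h0, map_zero]

instance : Module.Finite ℝ (Cl m) := by
  let b := (Pi.basisFun ℝ (Fin m)).ExteriorAlgebra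
  have : Module.Finite ℝ (ExteriorAlgebra ℝ (Fin m → ℝ)) := Module.Finite.of_basis b
  exact Module.Finite.equiv (CliffordAlgebra.equivExterior (negSumSq m)).symm

/-- Averaging, one generator at a time: `B(u,v) + B(e_a u, e_a v)` is `e_a`-invariant because `e_a²
= -1`. It keeps the invariance under earlier generators because `e_a e_j = -e_j e_a` and the two
signs cancel. -/
theorem exists_invariant_form (s : Finset (Fin m)) :
    ∃ B : LinearMap.BilinForm ℝ (Cl m), (∀ u v, B u v = B v u) ∧ (∀ u, u ≠ 0 → 0 < B u u) ∧
      ∀ j ∈ s, ∀ u v, B (gen j * u) (gen j * v) = B u v := by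
  induction s using Finset.induction_on with
  | empty =>
    let b := Module.finBasis ℝ (Cl m)
    refine ⟨∑ i, LinearMap.BilinForm.linMulLin (b.coord i) (b.coord i), fun u v => ?_,
      fun u hu => ?_, by simp⟩
    · simp [mul_comm]
    · simp only [LinearMap.BilinForm.sum_apply, LinearMap.BilinForm.linMulLin_apply]
      have hne : ∃ i, b.coord i u ≠ 0 := by
        by_contra! h
        exact hu (b.ext_elem fun i => by simpa using h i)
      obtain ⟨i, hi⟩ := hne
      exact Finset.sum_pos' (fun i _ => mul_self_nonneg _) ⟨i, Finset.mem_univ i, mul_self_pos.2 hi⟩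
  | insert a s ha ih =>
    obtain ⟨B, h1, h2, h3⟩ := ih
    refine ⟨B + B.comp (LinearMap.mulLeft ℝ (gen a)) (LinearMap.mulLeft ℝ (gen a)),
      fun u v => ?_, fun u hu => ?_, fun j hj u v => ?_⟩
    · simp [h1 u v, h1 (gen a * u)]
    · have hau : gen a * u ≠ 0 := fun h => hu <| by
        have : gen a * (gen a * u) = -u := by rw [← mul_assoc, gen_mul_self, neg_one_mul]
        rw [h, mul_zero] at this
        exact neg_eq_zero.1 this.symm
      simpa using add_pos (h2 u hu) (h2 _ hau)
    · have hneg : ∀ u v, B (-u) (-v) = B u v := by simp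
      rcases Finset.mem_insert.1 hj with rfl | hj'
      · simp only [LinearMap.add_apply, LinearMap.BilinForm.comp_apply, LinearMap.mulLeft_apply,
          ← mul_assoc, gen_mul_self, neg_one_mul, hneg]
        ring
      · have hne : a ≠ j := fun h => ha (h ▸ hj')
        simp only [LinearMap.add_apply, LinearMap.BilinForm.comp_apply, LinearMap.mulLeft_apply,
          h3 j hj', ← mul_assoc, gen_mul_gen_of_ne hne, neg_mul, hneg]
        simp only [mul_assoc, h3 j hj']

/-- There is a basis of the Clifford algebra in which left multiplication by every generator
is skew-symmetric. -/
theorem exists_basis_mulLeft_skew (m : ℕ) :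
    ∃ (d : ℕ) (b : Module.Basis (Fin d) ℝ (Cl m)), ∀ (j : Fin m) (a a' : Fin d),
      b.repr (gen j * b a) a' = - b.repr (gen j * b a') a := by
  obtain ⟨B, h1, h2, h3⟩ := exists_invariant_form (Finset.univ : Finset (Fin m))
  have : Invertible (2 : ℝ) := invertibleOfNonzero two_ne_zero
  obtain ⟨v, hv⟩ := LinearMap.BilinForm.exists_orthogonal_basis (B := B) ⟨h1⟩
  have hpos : ∀ i, 0 < B (v i) (v i) := fun i => h2 _ (v.ne_zero i)
  have hu : ∀ i, IsUnit ((√(B (v i) (v i)))⁻¹) := fun i =>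
    isUnit_iff_ne_zero.2 (inv_ne_zero (Real.sqrt_pos.2 (hpos i)).ne')
  set b := v.isUnitSMul hu with hb
  have hB : ∀ i j, B (b i) (b j) = if i = j then 1 else 0 := by
    intro i j
    rw [hb, Module.Basis.isUnitSMul_apply, Module.Basis.isUnitSMul_apply]
    simp only [map_smul, LinearMap.smul_apply, smul_eq_mul]
    split_ifs with h
    · subst h
      have := Real.mul_self_sqrt (hpos i).le
      have hne := (Real.sqrt_pos.2 (hpos i)).ne'
      field_simp
      nlinarith
    · rw [hv h, mul_zero, mul_zero]
  have hrepr : ∀ x i, b.repr x i = B x (b i) := by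
    intro x i
    conv_rhs => rw [← b.sum_repr x]
    simp only [map_sum, map_smul, LinearMap.sum_apply, LinearMap.smul_apply, hB]
    simp
  refine ⟨_, b, fun j a a' => ?_⟩
  -- In an orthonormal basis of the invariant form, isometry together with `e_j² = -1` is skewness:
  -- `B(e_j u, v) = B(e_j e_j u, e_j v) = -B(u, e_j v)`.
  rw [hrepr, hrepr, ← h3 j (Finset.mem_univ j) (gen j * b a), ← mul_assoc, gen_mul_self,
    neg_one_mul, map_neg, LinearMap.neg_apply, h1 (b a)]

/-- The dimension of the Clifford algebra `Cl_m`. -/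
def clDim (m : ℕ) : ℕ := (exists_basis_mulLeft_skew m).choose

/-- A basis of `Cl_m` in which left multiplication by every generator is skew-symmetric. -/
def clBasis (m : ℕ) : Module.Basis (Fin (clDim m)) ℝ (Cl m) :=
  (exists_basis_mulLeft_skew m).choose_spec.choose

theorem clBasis_repr_gen_mul (j : Fin m) (a a' : Fin (clDim m)) :
    (clBasis m).repr (gen j * clBasis m a) a' = - (clBasis m).repr (gen j * clBasis m a') a :=
  (exists_basis_mulLeft_skew m).choose_spec.choose_spec j a a'

end CliffordBasis

/-! ### Coordinates, topology and operators on the tensor product -/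

section Component

variable {m : ℕ}

@[simp]
theorem component_tmul (φ : Module.Dual ℝ (Cl m)) (f : 𝓢(Euc m, ℂ)) (c : Cl m) :
    component φ (f ⊗ₜ[ℝ] c) = φ c • f := by
  simp [component]

theorem component_smul (φ : Module.Dual ℝ (Cl m)) (c : ℂ) (F : CSchwartz m) :
    component φ (c • F) = c • component φ F := by
  induction F using TensorProduct.induction_on with
  | zero => simp
  | tmul f u => rw [TensorProduct.smul_tmul', component_tmul, component_tmul, smul_comm]
  | add F G hF hG => rw [smul_add, map_add, hF, hG, map_add, smul_add]

/-- The coordinate along a linear functional on `Cl_m` as a complex linear map. -/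
def componentℂ (φ : Module.Dual ℝ (Cl m)) : CSchwartz m →ₗ[ℂ] 𝓢(Euc m, ℂ) :=
  { component φ with map_smul' := component_smul φ }

theorem componentℂ_apply (φ : Module.Dual ℝ (Cl m)) (F : CSchwartz m) :
    componentℂ φ F = component φ F := rfl

theorem continuous_component (φ : Module.Dual ℝ (Cl m)) : Continuous (component φ) :=
  continuous_iInf_dom (i := φ) continuous_induced_dom

theorem continuous_of_component {Y : Type*} [TopologicalSpace Y] {P : Y → CSchwartz m}
    (h : ∀ φ, Continuous fun y => component φ (P y)) : Continuous P :=
  continuous_iInf_rng.2 fun φ => continuous_induced_rng.2 (h φ)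

instance : IsTopologicalAddGroup (CSchwartz m) :=
  topologicalAddGroup_iInf fun φ => topologicalAddGroup_induced (component φ)

instance : ContinuousSMul ℂ (CSchwartz m) :=
  continuousSMul_iInf fun φ => continuousSMul_induced (componentℂ φ)

/-- The coordinates with respect to `clBasis`. -/
def coordComp (m : ℕ) (a : Fin (clDim m)) : CSchwartz m →ₗ[ℂ] 𝓢(Euc m, ℂ) :=
  componentℂ ((clBasis m).coord a)

theorem coordComp_tmul (a : Fin (clDim m)) (f : 𝓢(Euc m, ℂ)) (c : Cl m) :
    coordComp m a (f ⊗ₜ[ℝ] c) = (clBasis m).repr c a • f :=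
  component_tmul _ _ _

theorem continuous_coordComp (a : Fin (clDim m)) : Continuous (coordComp m a) :=
  continuous_component _

theorem sum_coordComp_tmul (F : CSchwartz m) :
    ∑ a, coordComp m a F ⊗ₜ[ℝ] clBasis m a = F := by
  induction F using TensorProduct.induction_on with
  | zero => simp
  | tmul f u =>
    conv_rhs => rw [← (clBasis m).sum_repr u, TensorProduct.tmul_sum]
    refine Finset.sum_congr rfl fun a _ => ?_
    rw [coordComp_tmul, TensorProduct.smul_tmul]
  | add F G hF hG =>
    simp only [map_add, TensorProduct.add_tmul, Finset.sum_add_distrib, hF, hG]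

theorem ext_coordComp {F G : CSchwartz m} (h : ∀ a, coordComp m a F = coordComp m a G) : F = G := by
  rw [← sum_coordComp_tmul F, ← sum_coordComp_tmul G]
  simp only [h]

theorem component_eq_sum (φ : Module.Dual ℝ (Cl m)) (F : CSchwartz m) :
    component φ F = ∑ a, φ (clBasis m a) • coordComp m a F := by
  conv_lhs => rw [← sum_coordComp_tmul F, map_sum]
  simp only [component_tmul]

theorem continuous_of_coordComp {Y : Type*} [TopologicalSpace Y] {P : Y → CSchwartz m}
    (h : ∀ a, Continuous fun y => coordComp m a (P y)) : Continuous P :=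
  continuous_of_component fun φ => by
    simp only [component_eq_sum]
    exact continuous_finsetSum _ fun a _ => (continuous_const_smul _).comp (h a)

instance : T2Space (CSchwartz m) := by
  refine T2Space.of_injective_continuous (f := fun F a => coordComp m a F)
    (fun F G h => ext_coordComp fun a => congrFun h a) ?_
  exact continuous_pi fun a => continuous_coordComp a

/-- The map that reassembles an element from its coordinates is continuous, so convergence may be
tested on the finitely many coordinates. -/
theorem hasSum_of_coordComp {ι : Type*} {f : ι → CSchwartz m} {F : CSchwartz m}
    (h : ∀ a, HasSum (fun i => coordComp m a (f i)) (coordComp m a F)) : HasSum f F := by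
  have hc : Continuous fun g : Fin (clDim m) → 𝓢(Euc m, ℂ) =>
      ∑ a, (g a ⊗ₜ[ℝ] clBasis m a : CSchwartz m) := by
    refine continuous_of_coordComp fun a => ?_
    simp only [map_sum, coordComp_tmul]
    exact continuous_finsetSum _ fun a' _ => (continuous_const_smul _).comp (continuous_apply a')
  let Φ : (Fin (clDim m) → 𝓢(Euc m, ℂ)) →+ CSchwartz m :=
    { toFun := fun g => ∑ a, (g a ⊗ₜ[ℝ] clBasis m a : CSchwartz m)
      map_zero' := by simp
      map_add' := fun g g' => by simp [TensorProduct.add_tmul, Finset.sum_add_distrib] }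
  have h1 : HasSum (fun i a => coordComp m a (f i)) (fun a => coordComp m a F) :=
    Pi.hasSum.2 h
  have h2 := h1.map Φ hc
  have h3 : ∀ G, Φ (fun a => coordComp m a G) = G := fun G => sum_coordComp_tmul G
  simpa only [Function.comp_def, h3] using h2

theorem tensorOp_tmul (A : 𝓢(Euc m, ℂ) →ₗ[ℂ] 𝓢(Euc m, ℂ)) (c : Cl m) (f : 𝓢(Euc m, ℂ))
    (u : Cl m) : tensorOp A c (f ⊗ₜ[ℝ] u) = A f ⊗ₜ[ℝ] (c * u) := rfl

theorem component_tensorOp (φ : Module.Dual ℝ (Cl m)) (A : 𝓢(Euc m, ℂ) →ₗ[ℂ] 𝓢(Euc m, ℂ))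
    (c : Cl m) (F : CSchwartz m) :
    component φ (tensorOp A c F) = A (component (φ ∘ₗ LinearMap.mulLeft ℝ c) F) := by
  induction F using TensorProduct.induction_on with
  | zero => simp
  | tmul f u =>
    rw [tensorOp_tmul, component_tmul, component_tmul, ← Complex.coe_smul, ← Complex.coe_smul,
      map_smul]
    rfl
  | add F G hF hG => simp only [map_add, hF, hG]

theorem continuous_tensorOp {A : 𝓢(Euc m, ℂ) →ₗ[ℂ] 𝓢(Euc m, ℂ)} (hA : Continuous A) (c : Cl m) :
    Continuous (tensorOp A c) :=
  continuous_of_component fun φ => by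
    simp only [component_tensorOp]
    exact hA.comp (continuous_component _)

theorem continuous_vecVar (m : ℕ) : Continuous (vecVar m) := by
  have : ⇑(vecVar m) = fun F => ∑ j : Fin m, tensorOp (mulCoord j) (gen j) F := by
    ext F
    simp [vecVar]
  rw [this]
  exact continuous_finsetSum _ fun j _ => continuous_tensorOp (continuous_mulCoord j) _

theorem continuous_dirac (m : ℕ) : Continuous (dirac m) := by
  have : ⇑(dirac m) = fun F => ∑ j : Fin m, tensorOp (partialDeriv j) (gen j) F := by
    ext F
    simp [dirac]
  rw [this]
  exact continuous_finsetSum _ fun j _ => continuous_tensorOp (continuous_partialDeriv j) _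

theorem tensorOp_mul (A B : 𝓢(Euc m, ℂ) →ₗ[ℂ] 𝓢(Euc m, ℂ)) (c d : Cl m) :
    tensorOp A c * tensorOp B d = tensorOp (A * B) (c * d) := by
  ext f u
  simp [tensorOp_tmul, mul_assoc]

theorem tensorOp_add_left (A B : 𝓢(Euc m, ℂ) →ₗ[ℂ] 𝓢(Euc m, ℂ)) (c : Cl m) :
    tensorOp (A + B) c = tensorOp A c + tensorOp B c :=
  TensorProduct.AlgebraTensorModule.map_add_left _ _ _

theorem tensorOp_smul_left (k : ℂ) (A : 𝓢(Euc m, ℂ) →ₗ[ℂ] 𝓢(Euc m, ℂ)) (c : Cl m) :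
    tensorOp (k • A) c = k • tensorOp A c :=
  TensorProduct.AlgebraTensorModule.map_smul_left _ _ _

theorem tensorOp_neg_right (A : 𝓢(Euc m, ℂ) →ₗ[ℂ] 𝓢(Euc m, ℂ)) (c : Cl m) :
    tensorOp A (-c) = -tensorOp A c := by
  ext f u
  simp [tensorOp_tmul, TensorProduct.tmul_neg]

theorem tensorOp_sum_left {ι : Type*} (s : Finset ι) (A : ι → 𝓢(Euc m, ℂ) →ₗ[ℂ] 𝓢(Euc m, ℂ))
    (c : Cl m) : tensorOp (∑ i ∈ s, A i) c = ∑ i ∈ s, tensorOp (A i) c := by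
  ext f u
  simp [tensorOp_tmul, TensorProduct.sum_tmul, LinearMap.sum_apply]

/-- The square of `∑ⱼ Aⱼ eⱼ` for commuting operators `Aⱼ`. -/
theorem sum_tensorOp_gen_sq (A : Fin m → Module.End ℂ 𝓢(Euc m, ℂ))
    (hA : ∀ i j, A i * A j = A j * A i) :
    (∑ j, tensorOp (A j) (gen j)) * (∑ j, tensorOp (A j) (gen j))
      = - tensorOp (∑ j, A j * A j) 1 := by
  have h2 : (2 : ℂ) • ((∑ j, tensorOp (A j) (gen j)) * (∑ j, tensorOp (A j) (gen j)))
      = (2 : ℂ) • (- tensorOp (∑ j, A j * A j) 1) := by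
    have h1 := Finset.sum_mul_sum Finset.univ Finset.univ (fun j => tensorOp (A j) (gen j))
      (fun j => tensorOp (A j) (gen j))
    rw [two_smul]
    nth_rewrite 2 [h1.trans Finset.sum_comm]
    rw [h1, ← Finset.sum_add_distrib]
    simp only [← Finset.sum_add_distrib, tensorOp_mul]
    rw [tensorOp_sum_left, ← Finset.sum_neg_distrib, Finset.smul_sum]
    refine Finset.sum_congr rfl fun i _ => ?_
    rw [Finset.sum_eq_single i]
    · rw [gen_mul_self, tensorOp_neg_right, two_smul]
    · intro j _ hj
      rw [hA j i, gen_mul_gen_of_ne hj, tensorOp_neg_right, add_neg_cancel]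
    · simp
  exact smul_right_injective _ two_ne_zero h2

theorem vecVar_sq (m : ℕ) :
    vecVar m * vecVar m = - tensorOp (∑ j, mulCoord j * mulCoord j) 1 :=
  sum_tensorOp_gen_sq _ fun i j => LinearMap.ext fun f => mulCoord_comm i j f

theorem dirac_sq (m : ℕ) :
    dirac m * dirac m = - tensorOp (∑ j, partialDeriv j * partialDeriv j) 1 :=
  sum_tensorOp_gen_sq _ fun i j => LinearMap.ext fun f => partialDeriv_comm i j f

theorem sqrt_two_div_two_sq : ((√2 / 2 : ℝ) : ℂ) * ((√2 / 2 : ℝ) : ℂ) = 1 / 2 := by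
  rw [← Complex.ofReal_mul, div_mul_div_comm, Real.mul_self_sqrt (by norm_num)]
  norm_num

theorem hOp_eq (m : ℕ) :
    hOp m = (1 / 2 : ℂ) • (dirac m * dirac m - vecVar m * vecVar m) := by
  have h := sqrt_two_div_two_sq
  rw [hOp, bMinus, bPlus]
  simp only [smul_mul_smul_comm, neg_mul, mul_neg, h]
  rw [← smul_add]
  simp only [mul_add, add_mul, mul_sub, sub_mul]
  module

theorem hOp_eq_tensorOp (m : ℕ) : hOp m = (1 / 2 : ℂ) • tensorOp (hermiteOp m) 1 := by
  rw [hOp_eq, dirac_sq, vecVar_sq, hermiteOp, Finset.sum_sub_distrib, sub_eq_add_neg (∑ _, _),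
    tensorOp_add_left, ← neg_one_smul ℂ (∑ _, partialDeriv _ * partialDeriv _),
    tensorOp_smul_left]
  module

theorem coordComp_hOp (a : Fin (clDim m)) (F : CSchwartz m) :
    coordComp m a (hOp m F) = (1 / 2 : ℂ) • hermiteOp m (coordComp m a F) := by
  rw [hOp_eq_tensorOp, LinearMap.smul_apply, map_smul]
  congr 1
  rw [coordComp, componentℂ_apply, component_tensorOp]
  congr 2
  ext u
  simp

end Component

/-! ### The Hilbert space structure and the adjoints of the ladder operators -/

section Hilbert

variable {m : ℕ}

/-- The Hilbert space `L²(ℝᵐ) ⊗ Cl_m`. -/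
abbrev ClHilbert (m : ℕ) : Type :=
  PiLp 2 fun _ : Fin (clDim m) => Lp ℂ 2 (volume : Measure (Euc m))

/-- The embedding of `S(ℝᵐ) ⊗ Cl_m` into `L²(ℝᵐ) ⊗ Cl_m`. -/
def toHilbert (m : ℕ) : CSchwartz m →ₗ[ℂ] ClHilbert m :=
  (WithLp.linearEquiv 2 ℂ (Fin (clDim m) → Lp ℂ 2 (volume : Measure (Euc m)))).symm.toLinearMap ∘ₗ
    LinearMap.pi fun a => (toL2 m).toLinearMap ∘ₗ coordComp m a

theorem toHilbert_apply (F : CSchwartz m) (a : Fin (clDim m)) :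
    toHilbert m F a = toL2 m (coordComp m a F) := rfl

theorem toHilbert_injective (m : ℕ) : Function.Injective (toHilbert m) := fun F G h =>
  ext_coordComp fun a => toL2_injective m (by rw [← toHilbert_apply, h, toHilbert_apply])

theorem continuous_toHilbert (m : ℕ) : Continuous (toHilbert m) := by
  refine (PiLp.continuous_toLp 2 _).comp (continuous_pi fun a => ?_)
  exact (toL2 m).continuous.comp (continuous_coordComp a)

theorem inner_toHilbert (F G : CSchwartz m) : inner ℂ (toHilbert m F) (toHilbert m G)
    = ∑ a, inner ℂ (toL2 m (coordComp m a F)) (toL2 m (coordComp m a G)) :=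
  PiLp.inner_apply _ _

theorem norm_toL2_coordComp_le (F : CSchwartz m) (a : Fin (clDim m)) :
    ‖toL2 m (coordComp m a F)‖ ≤ ‖toHilbert m F‖ :=
  PiLp.norm_apply_le (toHilbert m F) a

theorem coordComp_tensorOp (a : Fin (clDim m)) (A : 𝓢(Euc m, ℂ) →ₗ[ℂ] 𝓢(Euc m, ℂ)) (c : Cl m)
    (F : CSchwartz m) : coordComp m a (tensorOp A c F)
      = ∑ a', (((clBasis m).repr (c * clBasis m a') a : ℝ) : ℂ) • A (coordComp m a' F) := by
  rw [coordComp, componentℂ_apply, component_tensorOp, component_eq_sum, map_sum]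
  refine Finset.sum_congr rfl fun a' _ => ?_
  rw [← Complex.coe_smul, map_smul]
  rfl

/-- Left multiplication by a generator is skew in `clBasis`, so tensoring with it reverses the
symmetry type: `x` becomes skew and `∂` symmetric. -/
theorem inner_tensorOp_gen {A : 𝓢(Euc m, ℂ) →ₗ[ℂ] 𝓢(Euc m, ℂ)} {ε : ℂ}
    (hA : ∀ f g, inner ℂ (toL2 m (A f)) (toL2 m g) = ε * inner ℂ (toL2 m f) (toL2 m (A g)))
    (j : Fin m) (F G : CSchwartz m) :
    inner ℂ (toHilbert m (tensorOp A (gen j) F)) (toHilbert m G)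
      = -ε * inner ℂ (toHilbert m F) (toHilbert m (tensorOp A (gen j) G)) := by
  simp only [inner_toHilbert, coordComp_tensorOp, map_sum, map_smul, sum_inner, inner_sum,
    inner_smul_left, inner_smul_right, Complex.conj_ofReal, hA, Finset.mul_sum]
  rw [Finset.sum_comm]
  refine Finset.sum_congr rfl fun a _ => Finset.sum_congr rfl fun a' _ => ?_
  rw [clBasis_repr_gen_mul j a a']
  push_cast
  ring

theorem inner_vecVar (F G : CSchwartz m) :
    inner ℂ (toHilbert m (vecVar m F)) (toHilbert m G)
      = - inner ℂ (toHilbert m F) (toHilbert m (vecVar m G)) := by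
  have h : ∀ j : Fin m, ∀ f g : 𝓢(Euc m, ℂ), inner ℂ (toL2 m (mulCoord j f)) (toL2 m g)
      = 1 * inner ℂ (toL2 m f) (toL2 m (mulCoord j g)) := fun j f g => by
    rw [one_mul, inner_mulCoord]
  simp only [vecVar, LinearMap.sum_apply, map_sum, sum_inner, inner_sum, inner_tensorOp_gen (h _)]
  simp

theorem inner_dirac (F G : CSchwartz m) :
    inner ℂ (toHilbert m (dirac m F)) (toHilbert m G)
      = inner ℂ (toHilbert m F) (toHilbert m (dirac m G)) := by
  have h : ∀ j : Fin m, ∀ f g : 𝓢(Euc m, ℂ), inner ℂ (toL2 m (partialDeriv j f)) (toL2 m g)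
      = (-1) * inner ℂ (toL2 m f) (toL2 m (partialDeriv j g)) := fun j f g => by
    rw [neg_one_mul, inner_partialDeriv]
  simp only [dirac, LinearMap.sum_apply, map_sum, sum_inner, inner_sum, inner_tensorOp_gen (h _)]
  simp

theorem bPlus_apply (F : CSchwartz m) :
    bPlus m F = ((√2 / 2 : ℝ) : ℂ) • (vecVar m F - dirac m F) := rfl

theorem bMinus_apply (F : CSchwartz m) :
    bMinus m F = -(((√2 / 2 : ℝ) : ℂ) • (vecVar m F + dirac m F)) := by
  rw [bMinus, LinearMap.smul_apply, neg_smul]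
  rfl

theorem inner_bPlus (F G : CSchwartz m) :
    inner ℂ (toHilbert m (bPlus m F)) (toHilbert m G)
      = inner ℂ (toHilbert m F) (toHilbert m (bMinus m G)) := by
  rw [bPlus_apply, bMinus_apply, map_smul, map_neg, map_smul, map_sub, map_add, inner_smul_left,
    inner_neg_right, inner_smul_right, inner_sub_left, inner_add_right, inner_vecVar, inner_dirac,
    Complex.conj_ofReal]
  ring

theorem inner_bMinus (F G : CSchwartz m) :
    inner ℂ (toHilbert m (bMinus m F)) (toHilbert m G)
      = inner ℂ (toHilbert m F) (toHilbert m (bPlus m G)) := by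
  rw [← inner_conj_symm, ← inner_bPlus, inner_conj_symm]

theorem hOp_apply (F : CSchwartz m) :
    hOp m F = (1 / 2 : ℂ) • (bMinus m (bPlus m F) + bPlus m (bMinus m F)) := rfl

theorem inner_hOp (F G : CSchwartz m) :
    inner ℂ (toHilbert m (hOp m F)) (toHilbert m G)
      = inner ℂ (toHilbert m F) (toHilbert m (hOp m G)) := by
  rw [hOp_apply, hOp_apply, map_smul, map_smul, map_add, map_add, inner_smul_left,
    inner_smul_right, inner_add_left, inner_add_right, inner_bMinus, inner_bPlus, inner_bPlus,
    inner_bMinus]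
  simp [Complex.conj_ofNat]

/-! ### The relations of `osp(1|2)` -/

theorem hOp_mul_vecVar (m : ℕ) : hOp m * vecVar m = vecVar m * hOp m - dirac m := by
  have h : ∀ j : Fin m, hermiteOp m * mulCoord j
      = mulCoord j * hermiteOp m + (-2 : ℂ) • partialDeriv j := fun j => by
    ext1 f
    simp [hermiteOp_mulCoord, sub_eq_add_neg]
  simp only [hOp_eq_tensorOp, vecVar, dirac, smul_mul_assoc, mul_smul_comm, Finset.mul_sum,
    Finset.sum_mul, tensorOp_mul, one_mul, mul_one, h, tensorOp_add_left, tensorOp_smul_left,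
    Finset.sum_add_distrib, ← Finset.smul_sum]
  module

theorem hOp_mul_dirac (m : ℕ) : hOp m * dirac m = dirac m * hOp m - vecVar m := by
  have h : ∀ j : Fin m, hermiteOp m * partialDeriv j
      = partialDeriv j * hermiteOp m + (-2 : ℂ) • mulCoord j := fun j => by
    ext1 f
    simp [hermiteOp_partialDeriv, sub_eq_add_neg]
  simp only [hOp_eq_tensorOp, vecVar, dirac, smul_mul_assoc, mul_smul_comm, Finset.mul_sum,
    Finset.sum_mul, tensorOp_mul, one_mul, mul_one, h, tensorOp_add_left, tensorOp_smul_left,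
    Finset.sum_add_distrib, ← Finset.smul_sum]
  module

theorem hOp_mul_bPlus (m : ℕ) : hOp m * bPlus m = bPlus m * hOp m + bPlus m := by
  simp only [bPlus, mul_smul_comm, smul_mul_assoc, mul_sub, sub_mul, hOp_mul_vecVar, hOp_mul_dirac]
  module

theorem continuous_hOp (m : ℕ) : Continuous (hOp m) := by
  have h : ⇑(hOp m) = fun F => (1 / 2 : ℂ) • (dirac m (dirac m F) - vecVar m (vecVar m F)) := by
    rw [hOp_eq]
    rfl
  rw [h]
  have h1 := continuous_dirac m
  have h2 := continuous_vecVar m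
  exact (continuous_const_smul (1 / 2 : ℂ)).comp ((h1.comp h1).sub (h2.comp h2))

/-- The factor in `b⁻ b⁺ʲ v = c b⁺ʲ⁻¹ v` for a lowest weight vector `v` of weight `ν`. -/
def lowerCoeff (ν : ℂ) : ℕ → ℂ
  | 0 => 0
  | j + 1 => 2 * (ν + j) - lowerCoeff ν j

theorem lowerCoeff_add_two (ν : ℂ) (j : ℕ) : lowerCoeff ν (j + 2) = lowerCoeff ν j + 2 := by
  rw [lowerCoeff, lowerCoeff]
  push_cast
  ring

/-- The coefficients are `2p` at `j = 2p` and `2ν + 2p` at `j = 2p + 1`, so only the one at `0`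
vanishes. Hence `b⁻` can undo `b⁺`. -/
theorem lowerCoeff_ne_zero {ν : ℝ} (hν : 0 < ν) (j : ℕ) : lowerCoeff ν (j + 1) ≠ 0 := by
  have h : ∃ r : ℝ, 0 < r ∧ lowerCoeff ν (j + 1) = r := by
    induction j using Nat.twoStepInduction with
    | zero => exact ⟨2 * ν, by positivity, by simp [lowerCoeff]⟩
    | one => exact ⟨2, by positivity, by simp [lowerCoeff]; ring⟩
    | more j ih _ =>
      obtain ⟨r, hr, h⟩ := ih
      exact ⟨r + 2, by positivity, by rw [lowerCoeff_add_two, h]; push_cast; ring⟩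
  obtain ⟨r, hr, h⟩ := h
  rw [h]
  exact_mod_cast hr.ne'

/-! ### Lowest weight modules of `osp(1|2)` -/

section LowestWeight

variable {ν : ℂ} {v : CSchwartz m}

theorem bPlus_pow_succ (j : ℕ) (v : CSchwartz m) :
    (bPlus m ^ (j + 1)) v = bPlus m ((bPlus m ^ j) v) := by
  rw [pow_succ']
  rfl

theorem hOp_bPlus_pow (hv : hOp m v = ν • v) (j : ℕ) : hOp m ((bPlus m ^ j) v) = (ν + j) • (bPlus m ^ j) v := by
  induction j with
  | zero => simpa using hv
  | succ j ih =>
    have h := LinearMap.congr_fun (hOp_mul_bPlus m) ((bPlus m ^ j) v)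
    simp only [Module.End.mul_apply, LinearMap.add_apply] at h
    rw [bPlus_pow_succ, h, ih, map_smul]
    push_cast
    module

theorem bMinus_bPlus_pow_succ (h0 : bMinus m v = 0) (hv : hOp m v = ν • v) (j : ℕ) :
    bMinus m ((bPlus m ^ (j + 1)) v) = lowerCoeff ν (j + 1) • (bPlus m ^ j) v := by
  have key : ∀ F : CSchwartz m, bMinus m (bPlus m F) = (2 : ℂ) • hOp m F - bPlus m (bMinus m F) := by
    intro F
    rw [hOp_apply]
    module
  induction j with
  | zero =>
    rw [bPlus_pow_succ, key, hOp_bPlus_pow hv]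
    simp [h0, lowerCoeff, smul_smul]
  | succ j ih =>
    rw [bPlus_pow_succ, key, hOp_bPlus_pow hv, ih, map_smul, ← bPlus_pow_succ,
      show lowerCoeff ν (j + 1 + 1) = 2 * (ν + (j + 1 : ℕ)) - lowerCoeff ν (j + 1) from rfl]
    push_cast
    module

theorem bPlus_bMinus_bPlus_pow (h0 : bMinus m v = 0) (hv : hOp m v = ν • v) (j : ℕ) :
    bPlus m (bMinus m ((bPlus m ^ j) v)) = lowerCoeff ν j • (bPlus m ^ j) v := by
  cases j with
  | zero => simp [h0, lowerCoeff]
  | succ j => rw [bMinus_bPlus_pow_succ h0 hv, map_smul, ← bPlus_pow_succ]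

/-- With `λ_j = lowerCoeff ν j`, the weight `ν + j` is the mean of `λ_j` and `λ_{j+1}`, and the
Casimir element acts by `((λ_{j+1} - λ_j - 1)/2)²`. The differences `λ_{j+1} - λ_j` alternate
between `2ν` and `2 - 2ν`, and both give `(ν - 1/2)²`. -/
theorem casimir_bPlus_pow (h0 : bMinus m v = 0) (hv : hOp m v = ν • v) (j : ℕ) :
    casimir m ((bPlus m ^ j) v) = ((ν - 1 / 2) ^ 2) • (bPlus m ^ j) v := by
  have hmm : bMinus m (bPlus m ((bPlus m ^ j) v)) = lowerCoeff ν (j + 1) • (bPlus m ^ j) v := by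
    rw [← bPlus_pow_succ, bMinus_bPlus_pow_succ h0 hv]
  have hfe : bMinus m (bMinus m (bPlus m (bPlus m ((bPlus m ^ j) v))))
      = (lowerCoeff ν (j + 1) * lowerCoeff ν (j + 2)) • (bPlus m ^ j) v := by
    rw [← bPlus_pow_succ, ← bPlus_pow_succ, bMinus_bPlus_pow_succ h0 hv, map_smul,
      bMinus_bPlus_pow_succ h0 hv, smul_smul, mul_comm]
  -- For `j ≥ 1` the second factor is `lowerCoeff ν (j - 1)`, written as `lowerCoeff ν (j + 1) - 2`.
  -- At `j = 0` the first factor is zero.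
  have hef : bPlus m (bPlus m (bMinus m (bMinus m ((bPlus m ^ j) v))))
      = (lowerCoeff ν j * (lowerCoeff ν (j + 1) - 2)) • (bPlus m ^ j) v := by
    cases j with
    | zero => simp [h0, lowerCoeff]
    | succ j =>
      rw [bMinus_bPlus_pow_succ h0 hv, map_smul, map_smul, bPlus_bMinus_bPlus_pow h0 hv, map_smul,
        map_smul, ← bPlus_pow_succ, smul_smul, lowerCoeff_add_two, add_sub_cancel_right]
  have hsq : ((lowerCoeff ν (j + 1) - lowerCoeff ν j - 1) / 2) ^ 2 = (ν - 1 / 2) ^ 2 := by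
    have : ∀ j, lowerCoeff ν (j + 1) - lowerCoeff ν j = 2 * ν ∨
        lowerCoeff ν (j + 1) - lowerCoeff ν j = 2 - 2 * ν := by
      intro j
      induction j with
      | zero => left; simp [lowerCoeff]
      | succ j ih =>
        rw [lowerCoeff_add_two]
        rcases ih with h | h
        · right; rw [← h]; ring
        · left; linear_combination -h
    rcases this j with h | h <;> rw [h] <;> ring
  have hsum : ν + j = (lowerCoeff ν (j + 1) + lowerCoeff ν j) / 2 := by
    rw [lowerCoeff]; ring
  have hC : casimir m ((bPlus m ^ j) v) = (1 / 4 : ℂ) • (bPlus m ^ j) v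
      + (1 / 2 : ℂ) • bMinus m (bPlus m ((bPlus m ^ j) v))
      - (1 / 2 : ℂ) • bPlus m (bMinus m ((bPlus m ^ j) v))
      + hOp m (hOp m ((bPlus m ^ j) v))
      - (1 / 2 : ℂ) • bPlus m (bPlus m (bMinus m (bMinus m ((bPlus m ^ j) v))))
      - (1 / 2 : ℂ) • bMinus m (bMinus m (bPlus m (bPlus m ((bPlus m ^ j) v)))) := by
    simp only [casimir, eOp, fOp, LinearMap.add_apply, LinearMap.sub_apply, LinearMap.smul_apply,
      Module.End.mul_apply, Module.End.one_apply, map_add, map_smul]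
    module
  rw [hC, hmm, hfe, hef, bPlus_bMinus_bPlus_pow h0 hv, hOp_bPlus_pow hv, map_smul,
    hOp_bPlus_pow hv, ← hsq, hsum, lowerCoeff_add_two]
  module

end LowestWeight

end Hilbert

/-! ### Operators on Clifford-valued polynomials -/

section Polynomials

variable {m : ℕ}

theorem gaussMul_X_mul (j : Fin m) (p : MvPolynomial (Fin m) ℂ) :
    gaussMul m (MvPolynomial.X j * p) = mulCoord j (gaussMul m p) := by
  ext x
  simp [gaussMul_apply, mulCoord_apply, polyFun, mul_assoc]

theorem gaussMul_C (a : ℂ) : gaussMul m (MvPolynomial.C a) = a • gauss m := by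
  ext x
  simp [gaussMul_apply, polyFun, gauss_apply]

theorem partialDeriv_gauss (j : Fin m) : partialDeriv j (gauss m) = -mulCoord j (gauss m) := by
  ext x
  rw [partialDeriv_apply, neg_apply, mulCoord_apply]
  have h1 : HasFDerivAt (fun x : Euc m => -(‖x‖ ^ 2 / 2)) (-innerSL ℝ x) x := by
    have h := ((hasStrictFDerivAt_norm_sq x).hasFDerivAt.const_mul (1 / 2 : ℝ)).neg
    refine (h.congr_fderiv ?_).congr_of_eventuallyEq (Filter.Eventually.of_forall fun y => ?_)
    · ext v
      simp
    · simp only [Pi.neg_apply]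
      ring
  have h2 : HasFDerivAt (gaussFun m) _ x := Complex.ofRealCLM.hasFDerivAt.comp x h1.exp
  have h3 : (⇑(gauss m) : Euc m → ℂ) = gaussFun m := rfl
  rw [h3, h2.fderiv]
  simp [gaussFun, EuclideanSpace.inner_single_right, mul_comm]

/-- Conjugation by the Gaussian turns `∂_j` into `∂_j - x_j`. All analytic operators on polynomials
times the Gaussian thereby become polynomial ones. -/
theorem partialDeriv_gaussMul (j : Fin m) (p : MvPolynomial (Fin m) ℂ) :
    partialDeriv j (gaussMul m p)
      = gaussMul m (MvPolynomial.pderiv j p - MvPolynomial.X j * p) := by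
  induction p using MvPolynomial.induction_on with
  | C a =>
    rw [gaussMul_C, map_smul, partialDeriv_gauss, MvPolynomial.pderiv_C, zero_sub, map_neg,
      gaussMul_X_mul, gaussMul_C, map_smul, smul_neg]
  | add p q hp hq =>
    simp only [map_add, hp, hq]
    rw [← map_add (gaussMul m)]
    congr 1
    ring
  | mul_X p i hp =>
    rw [mul_comm, gaussMul_X_mul, partialDeriv_mulCoord, hp, ← gaussMul_X_mul,
      Derivation.leibniz, MvPolynomial.pderiv_X]
    by_cases h : j = i
    · subst h
      rw [if_pos rfl, ← map_add]
      congr 1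
      simp
      ring
    · rw [if_neg h, add_zero]
      congr 1
      simp [h]
      ring

/-- The operator `A ⊗ (left multiplication by c)` on Clifford-valued polynomials. -/
def polyTensorOp (A : Module.End ℂ (MvPolynomial (Fin m) ℂ)) (c : Cl m) :
    Module.End ℂ (CPoly m) :=
  TensorProduct.AlgebraTensorModule.map A (LinearMap.mulLeft ℝ c)

theorem polyTensorOp_tmul (A : Module.End ℂ (MvPolynomial (Fin m) ℂ)) (c : Cl m)
    (p : MvPolynomial (Fin m) ℂ) (u : Cl m) :
    polyTensorOp A c (p ⊗ₜ[ℝ] u) = A p ⊗ₜ[ℝ] (c * u) := rfl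

theorem polyTensorOp_mul (A B : Module.End ℂ (MvPolynomial (Fin m) ℂ)) (c d : Cl m) :
    polyTensorOp A c * polyTensorOp B d = polyTensorOp (A * B) (c * d) := by
  ext f u
  simp [polyTensorOp_tmul, mul_assoc]

theorem polyTensorOp_add_left (A B : Module.End ℂ (MvPolynomial (Fin m) ℂ)) (c : Cl m) :
    polyTensorOp (A + B) c = polyTensorOp A c + polyTensorOp B c :=
  TensorProduct.AlgebraTensorModule.map_add_left _ _ _

theorem polyTensorOp_neg_right (A : Module.End ℂ (MvPolynomial (Fin m) ℂ)) (c : Cl m) :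
    polyTensorOp A (-c) = -polyTensorOp A c := by
  ext f u
  simp [polyTensorOp_tmul, TensorProduct.tmul_neg]

theorem polyTensorOp_one_one : polyTensorOp (1 : Module.End ℂ (MvPolynomial (Fin m) ℂ)) 1 = 1 := by
  ext f u
  simp [polyTensorOp_tmul]

/-- Multiplication by a scalar polynomial, as an endomorphism. -/
def mulEnd (q : MvPolynomial (Fin m) ℂ) : Module.End ℂ (MvPolynomial (Fin m) ℂ) :=
  LinearMap.mulLeft ℂ q

/-- The partial derivative of polynomials, as an endomorphism. -/
def pderivEnd (j : Fin m) : Module.End ℂ (MvPolynomial (Fin m) ℂ) :=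
  (MvPolynomial.pderiv (R := ℂ) j).toLinearMap

theorem mulEnd_apply (q p : MvPolynomial (Fin m) ℂ) : mulEnd q p = q * p := rfl

theorem pderivEnd_apply (j : Fin m) (p : MvPolynomial (Fin m) ℂ) :
    pderivEnd j p = MvPolynomial.pderiv j p := rfl

theorem mulEnd_mul (p q : MvPolynomial (Fin m) ℂ) : mulEnd p * mulEnd q = mulEnd (p * q) :=
  LinearMap.ext fun r => (mul_assoc p q r).symm

theorem pderivEnd_mulEnd (j : Fin m) (q : MvPolynomial (Fin m) ℂ) :
    pderivEnd j * mulEnd q = mulEnd q * pderivEnd j + mulEnd (MvPolynomial.pderiv j q) := by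
  refine LinearMap.ext fun p => ?_
  simp only [Module.End.mul_apply, LinearMap.add_apply, mulEnd_apply, pderivEnd_apply,
    Derivation.leibniz, smul_eq_mul]
  ring

theorem polyDirac_eq (m : ℕ) : polyDirac m = ∑ j, polyTensorOp (pderivEnd j) (gen j) := rfl

theorem polyVecVar_eq (m : ℕ) :
    polyVecVar m = ∑ j, polyTensorOp (mulEnd (MvPolynomial.X j)) (gen j) := rfl

theorem polyMul_eq (q : MvPolynomial (Fin m) ℂ) : polyMul q = polyTensorOp (mulEnd q) 1 := by
  rw [polyMul, polyTensorOp, LinearMap.mulLeft_one]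
  rfl

/-- The polynomial `|x|²`. -/
def normSqPoly (m : ℕ) : MvPolynomial (Fin m) ℂ := ∑ i : Fin m, MvPolynomial.X i ^ 2

theorem polyMul_polyMul (p q : MvPolynomial (Fin m) ℂ) (P : CPoly m) :
    polyMul p (polyMul q P) = polyMul (p * q) P := by
  rw [polyMul_eq, polyMul_eq, polyMul_eq, ← Module.End.mul_apply, polyTensorOp_mul, mulEnd_mul,
    one_mul]

theorem polyMul_add (p q : MvPolynomial (Fin m) ℂ) (P : CPoly m) :
    polyMul (p + q) P = polyMul p P + polyMul q P := by
  induction P using TensorProduct.induction_on with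
  | zero => simp
  | tmul f u => simp [polyMul, add_mul, TensorProduct.add_tmul]
  | add P Q hP hQ => rw [map_add, hP, hQ, map_add, map_add]; abel

theorem polyMul_smul (c : ℂ) (q : MvPolynomial (Fin m) ℂ) (P : CPoly m) :
    polyMul (c • q) P = c • polyMul q P := by
  induction P using TensorProduct.induction_on with
  | zero => simp
  | tmul f u => simp [polyMul, TensorProduct.smul_tmul']
  | add P Q hP hQ => rw [map_add, hP, hQ, map_add, smul_add]

/-- Adding the double sum to its transpose cancels the off-diagonal terms by anticommutation. This
is why twice the square is computed. -/
theorem polyVecVar_polyVecVar (P : CPoly m) :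
    polyVecVar m (polyVecVar m P) = -polyMul (normSqPoly m) P := by
  have h2 : (2 : ℂ) • (polyVecVar m * polyVecVar m : Module.End ℂ (CPoly m))
      = (-2 : ℂ) • (polyMul (normSqPoly m) : Module.End ℂ (CPoly m)) := by
    have h1 := Finset.sum_mul_sum Finset.univ Finset.univ
      (fun j : Fin m => polyTensorOp (mulEnd (MvPolynomial.X j)) (gen j))
      (fun j => polyTensorOp (mulEnd (MvPolynomial.X j)) (gen j))
    have h3 : polyMul (normSqPoly m)
        = ∑ j : Fin m, polyTensorOp (mulEnd (MvPolynomial.X j * MvPolynomial.X j)) 1 := by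
      ext p u
      simp [polyMul_eq, polyTensorOp_tmul, normSqPoly, mulEnd_apply, Finset.sum_mul,
        TensorProduct.sum_tmul, pow_two]
    rw [two_smul, polyVecVar_eq]
    nth_rewrite 2 [h1.trans Finset.sum_comm]
    rw [h1, ← Finset.sum_add_distrib, h3, Finset.smul_sum]
    simp only [← Finset.sum_add_distrib, polyTensorOp_mul, mulEnd_mul]
    refine Finset.sum_congr rfl fun i _ => ?_
    rw [Finset.sum_eq_single i]
    · rw [gen_mul_self, polyTensorOp_neg_right]
      module
    · intro j _ hj
      rw [mul_comm (MvPolynomial.X j), gen_mul_gen_of_ne hj, polyTensorOp_neg_right]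
      exact add_neg_cancel (polyTensorOp (m := m) _ _)
    · simp
  have h4 : (2 : ℂ) • polyVecVar m (polyVecVar m P) = (-2 : ℂ) • polyMul (normSqPoly m) P :=
    LinearMap.congr_fun h2 P
  refine smul_right_injective _ (two_ne_zero (α := ℂ)) (h4.trans ?_)
  module

/-- The Euler operator. -/
def polyEuler (m : ℕ) : Module.End ℂ (CPoly m) :=
  ∑ j : Fin m, polyTensorOp (mulEnd (MvPolynomial.X j) * pderivEnd j) 1

/-- The anticommutator of the Dirac operator and the vector variable is `-(m + 2 Euler)`: off the
diagonal the generators anticommute, and on it `[∂_j, x_j] = 1`. On a monogenic of degree `k` this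
is the scalar `-(m + 2k)`. -/
theorem polyDirac_polyVecVar (P : CPoly m) :
    polyDirac m (polyVecVar m P) = -((m : ℂ) • P) - (2 : ℂ) • polyEuler m P
      - polyVecVar m (polyDirac m P) := by
  have h : polyDirac m * polyVecVar m + polyVecVar m * polyDirac m
      = (-1 : ℂ) • ((m : ℂ) • (1 : Module.End ℂ (CPoly m))) + (-2 : ℂ) • polyEuler m := by
    have h3 : (m : ℂ) • (1 : Module.End ℂ (CPoly m)) = ∑ _j : Fin m, 1 := by
      simp [Nat.cast_smul_eq_nsmul]
    rw [polyDirac_eq, polyVecVar_eq, Finset.sum_mul_sum, Finset.sum_mul_sum, Finset.sum_comm,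
      ← Finset.sum_add_distrib, polyEuler, h3, Finset.smul_sum, Finset.smul_sum,
      ← Finset.sum_add_distrib]
    simp only [← Finset.sum_add_distrib, polyTensorOp_mul, pderivEnd_mulEnd, polyTensorOp_add_left]
    refine Finset.sum_congr rfl fun i _ => ?_
    rw [Finset.sum_eq_single i]
    · have h1 : mulEnd (MvPolynomial.pderiv i (MvPolynomial.X i : MvPolynomial (Fin m) ℂ)) = 1 := by
        refine LinearMap.ext fun p => ?_
        simp [mulEnd_apply]
      rw [gen_mul_self, polyTensorOp_neg_right, polyTensorOp_neg_right, h1, polyTensorOp_one_one]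
      module
    · intro j _ hj
      have h1 : mulEnd (MvPolynomial.pderiv j (MvPolynomial.X i : MvPolynomial (Fin m) ℂ)) = 0 := by
        refine LinearMap.ext fun p => ?_
        simp [mulEnd_apply, hj.symm]
      have h2 : polyTensorOp (0 : Module.End ℂ (MvPolynomial (Fin m) ℂ)) (gen j * gen i) = 0 := by
        ext p u
        simp [polyTensorOp_tmul]
      rw [h1, h2, gen_mul_gen_of_ne hj, polyTensorOp_neg_right]
      abel
    · simp
  have h' := LinearMap.congr_fun h P
  simp only [LinearMap.add_apply, LinearMap.smul_apply, Module.End.mul_apply,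
    Module.End.one_apply] at h'
  rw [eq_sub_iff_add_eq, h']
  module

theorem polyDirac_polyMul (q : MvPolynomial (Fin m) ℂ) (P : CPoly m) :
    polyDirac m (polyMul q P) = polyMul q (polyDirac m P)
      + ∑ j, polyTensorOp (mulEnd (MvPolynomial.pderiv j q)) (gen j) P := by
  have h : polyDirac m * polyMul q = polyMul q * polyDirac m
      + ∑ j, polyTensorOp (mulEnd (MvPolynomial.pderiv j q)) (gen j) := by
    rw [polyDirac_eq, polyMul_eq, Finset.sum_mul, Finset.mul_sum, ← Finset.sum_add_distrib]
    simp only [polyTensorOp_mul, pderivEnd_mulEnd, polyTensorOp_add_left, mul_one, one_mul]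
  have h' := LinearMap.congr_fun h P
  simpa only [LinearMap.add_apply, Module.End.mul_apply, LinearMap.sum_apply] using h'

/-- The chain rule `∂_j q(|x|²) = 2 x_j q'(|x|²)`, summed against the generators. -/
theorem polyDirac_polyMul_aeval (q : Polynomial ℝ) (P : CPoly m) :
    polyDirac m (polyMul (Polynomial.aeval (normSqPoly m) q) P)
      = polyMul (Polynomial.aeval (normSqPoly m) q) (polyDirac m P)
        + (2 : ℂ) • polyMul (Polynomial.aeval (normSqPoly m) (Polynomial.derivative q))
            (polyVecVar m P) := by
  rw [polyDirac_polyMul]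
  congr 1
  have h : ∀ j : Fin m, MvPolynomial.pderiv j (Polynomial.aeval (normSqPoly m) q)
      = Polynomial.aeval (normSqPoly m) (Polynomial.derivative q)
        * ((2 : ℂ) • MvPolynomial.X j) := by
    intro j
    have h1 := Derivation.map_aeval
      ((MvPolynomial.pderiv (R := ℂ) j).restrictScalars ℝ) q (normSqPoly m)
    have h2 : MvPolynomial.pderiv j (normSqPoly m) = (2 : ℂ) • MvPolynomial.X j := by
      simp only [normSqPoly, map_sum, pow_two, Derivation.leibniz, smul_eq_mul]
      rw [Finset.sum_eq_single j]
      · rw [MvPolynomial.pderiv_X_self, mul_one, two_smul]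
      · intro i _ hi
        rw [MvPolynomial.pderiv_X_of_ne hi]
        simp
      · simp
    rw [← h2]
    exact h1
  rw [polyMul_eq, polyVecVar_eq]
  simp only [h, LinearMap.sum_apply, map_sum, Finset.smul_sum, ← mulEnd_mul]
  refine Finset.sum_congr rfl fun j _ => ?_
  rw [← Module.End.mul_apply (polyTensorOp _ 1), polyTensorOp_mul, one_mul, ← LinearMap.smul_apply]
  congr 1
  ext p u
  simp [polyTensorOp_tmul, mulEnd_apply, TensorProduct.smul_tmul']

theorem polyVecVar_polyMul (q : MvPolynomial (Fin m) ℂ) (P : CPoly m) :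
    polyVecVar m (polyMul q P) = polyMul q (polyVecVar m P) := by
  have h : polyVecVar m * polyMul q = polyMul q * polyVecVar m := by
    rw [polyVecVar_eq, polyMul_eq, Finset.sum_mul, Finset.mul_sum]
    simp only [polyTensorOp_mul, mulEnd_mul, mul_one, one_mul, mul_comm q]
  exact LinearMap.congr_fun h P

/-! ### The ladder operators on polynomials times the Gaussian -/

theorem vecVar_gaussMulCl (P : CPoly m) :
    vecVar m (gaussMulCl m P) = gaussMulCl m (polyVecVar m P) := by
  induction P using TensorProduct.induction_on with
  | zero => simp
  | tmul p u =>
    simp only [vecVar, polyVecVar_eq, LinearMap.sum_apply, map_sum, polyTensorOp_tmul, gaussMulCl,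
      TensorProduct.AlgebraTensorModule.map_tmul, LinearMap.id_apply, tensorOp_tmul, mulEnd_apply,
      gaussMul_X_mul]
  | add P Q hP hQ => simp only [map_add, hP, hQ]

theorem dirac_gaussMulCl (P : CPoly m) :
    dirac m (gaussMulCl m P) = gaussMulCl m (polyDirac m P - polyVecVar m P) := by
  induction P using TensorProduct.induction_on with
  | zero => simp
  | tmul p u =>
    rw [polyDirac_eq, polyVecVar_eq, LinearMap.sum_apply, LinearMap.sum_apply,
      ← Finset.sum_sub_distrib]
    simp only [dirac, LinearMap.sum_apply, map_sum, polyTensorOp_tmul, gaussMulCl,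
      TensorProduct.AlgebraTensorModule.map_tmul, LinearMap.id_apply, tensorOp_tmul, mulEnd_apply,
      pderivEnd_apply, partialDeriv_gaussMul, ← TensorProduct.sub_tmul]
  | add P Q hP hQ =>
    simp only [map_add, hP, hQ]
    rw [← map_add (gaussMulCl m)]
    congr 1
    abel

/-- The raising operator on Clifford-valued polynomials. -/
def polyPlus (m : ℕ) : Module.End ℂ (CPoly m) :=
  ((√2 / 2 : ℝ) : ℂ) • ((2 : ℂ) • polyVecVar m - polyDirac m)

theorem bPlus_gaussMulCl (P : CPoly m) :
    bPlus m (gaussMulCl m P) = gaussMulCl m (polyPlus m P) := by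
  rw [bPlus_apply, vecVar_gaussMulCl, dirac_gaussMulCl, ← map_sub, ← map_smul]
  congr 1
  simp only [polyPlus, LinearMap.smul_apply, LinearMap.sub_apply]
  module

theorem bPlus_pow_gaussMulCl (s : ℕ) (P : CPoly m) :
    (bPlus m ^ s) (gaussMulCl m P) = gaussMulCl m ((polyPlus m ^ s) P) := by
  induction s with
  | zero => rfl
  | succ s ih => rw [bPlus_pow_succ, ih, bPlus_gaussMulCl, pow_succ' (polyPlus m)]; rfl

theorem bMinus_gaussMulCl (P : CPoly m) :
    bMinus m (gaussMulCl m P) = gaussMulCl m (-(((√2 / 2 : ℝ) : ℂ) • polyDirac m P)) := by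
  rw [bMinus_apply, vecVar_gaussMulCl, dirac_gaussMulCl, ← map_add, ← map_smul, ← map_neg]
  congr 3
  abel

theorem polyDirac_of_mem_monogenics {k : ℕ} {P : CPoly m} (hP : P ∈ monogenics m k) :
    polyDirac m P = 0 := hP.2

theorem polyEuler_of_mem_monogenics {k : ℕ} {P : CPoly m} (hP : P ∈ monogenics m k) :
    polyEuler m P = (k : ℂ) • P := by
  obtain ⟨Q, rfl⟩ := hP.1
  clear hP
  induction Q using TensorProduct.induction_on with
  | zero => simp
  | tmul p u =>
    rw [TensorProduct.AlgebraTensorModule.map_tmul, polyEuler, LinearMap.sum_apply]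
    simp only [polyTensorOp_tmul, one_mul, ← TensorProduct.sum_tmul, Module.End.mul_apply,
      mulEnd_apply, pderivEnd_apply, LinearMap.id_apply, Submodule.subtype_apply]
    have h : (p : MvPolynomial (Fin m) ℂ).IsHomogeneous k :=
      (MvPolynomial.mem_homogeneousSubmodule k _).1 p.2
    rw [h.sum_X_mul_pderiv, TensorProduct.smul_tmul', Nat.cast_smul_eq_nsmul]
  | add P Q hP hQ => simp only [map_add, hP, hQ, smul_add]

theorem polyDirac_polyVecVar_of_mem_monogenics {k : ℕ} {P : CPoly m} (hP : P ∈ monogenics m k) :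
    polyDirac m (polyVecVar m P) = -((m + 2 * k : ℂ) • P) := by
  rw [polyDirac_polyVecVar, polyDirac_of_mem_monogenics hP, polyEuler_of_mem_monogenics hP,
    map_zero]
  module

theorem bMinus_gaussMulCl_of_mem_monogenics {k : ℕ} {P : CPoly m} (hP : P ∈ monogenics m k) :
    bMinus m (gaussMulCl m P) = 0 := by
  rw [bMinus_gaussMulCl, polyDirac_of_mem_monogenics hP]
  simp

theorem hOp_gaussMulCl_of_mem_monogenics {k : ℕ} {P : CPoly m} (hP : P ∈ monogenics m k) :
    hOp m (gaussMulCl m P) = ((m : ℂ) / 2 + k) • gaussMulCl m P := by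
  rw [hOp_apply, bMinus_gaussMulCl_of_mem_monogenics hP, map_zero, add_zero, bPlus_gaussMulCl,
    bMinus_gaussMulCl, ← (gaussMulCl m).map_smul, ← (gaussMulCl m).map_smul]
  refine congrArg (gaussMulCl m) ?_
  simp only [polyPlus, LinearMap.smul_apply, LinearMap.sub_apply, map_smul, map_sub,
    polyDirac_of_mem_monogenics hP, polyDirac_polyVecVar_of_mem_monogenics hP, map_zero]
  rw [smul_smul, sqrt_two_div_two_sq]
  module

end Polynomials

/-! ### Two identities for Laguerre polynomials -/

section Laguerre

open Polynomial

theorem coeff_laguerre (j : ℕ) (α : ℝ) (n : ℕ) : (laguerre j α).coeff n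
    = if n ≤ j then (-1) ^ n * (Real.Gamma (j + α + 1) /
      (Nat.factorial n * Nat.factorial (j - n) * Real.Gamma (n + α + 1))) else 0 := by
  have h : ∀ i : ℕ, (-X : ℝ[X]) ^ i = C ((-1) ^ i) * X ^ i := fun i => by
    rw [neg_pow]; simp
  simp only [laguerre, finsetSum_coeff, h, coeff_C_mul, coeff_X_pow, mul_ite, mul_one, mul_zero]
  rw [Finset.sum_ite_eq]
  simp only [Finset.mem_range, Nat.lt_succ_iff, mul_comm]

theorem Gamma_natCast_add_succ {α : ℝ} (hα : -1 < α) (n : ℕ) :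
    Real.Gamma (n + α + 1 + 1) = (n + α + 1) * Real.Gamma (n + α + 1) := by
  have : (0 : ℝ) ≤ n := by positivity
  exact Real.Gamma_add_one (by linarith)

/-- This is the step of `b⁺` from even to odd index. The condition `-1 < α` keeps the Gamma values
in the denominators finite and nonzero, so the coefficients can be compared. -/
theorem laguerre_sub_derivative (j : ℕ) {α : ℝ} (hα : -1 < α) :
    laguerre j α - derivative (laguerre j α) = laguerre j (α + 1) := by
  ext n
  rw [coeff_sub, coeff_derivative, coeff_laguerre, coeff_laguerre, coeff_laguerre]
  have hG : Real.Gamma (n + α + 1) ≠ 0 :=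
    (Real.Gamma_pos_of_pos (by have : (0 : ℝ) ≤ n := by positivity
                               linarith)).ne'
  have hn : (n + α + 1 : ℝ) ≠ 0 := by
    have : (0 : ℝ) ≤ n := by positivity
    linarith
  have e1 : ∀ k : ℕ, Real.Gamma (k + (α + 1) + 1) = (k + α + 1) * Real.Gamma (k + α + 1) := by
    intro k
    rw [← Gamma_natCast_add_succ hα]
    congr 1
    ring
  have e2 : Real.Gamma ((n + 1 : ℕ) + α + 1) = (n + α + 1) * Real.Gamma (n + α + 1) := by
    rw [← Gamma_natCast_add_succ hα]
    congr 1
    push_cast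
    ring
  have hf : ∀ k : ℕ, (Nat.factorial k : ℝ) ≠ 0 := fun k => by positivity
  rcases lt_trichotomy n j with h | rfl | h
  · obtain ⟨r, rfl⟩ := Nat.exists_eq_add_of_lt h
    rw [if_pos (by omega), if_pos (by omega), if_pos (by omega), e1, e1, e2,
      show n + r + 1 - n = r + 1 by omega, show n + r + 1 - (n + 1) = r by omega,
      Nat.factorial_succ, Nat.factorial_succ]
    have hr : (r + 1 : ℝ) ≠ 0 := by positivity
    have hn1 : (n + 1 : ℝ) ≠ 0 := by positivity
    have := hf n
    have := hf r
    push_cast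
    field_simp
    ring
  · rw [if_pos le_rfl, if_neg (by omega), if_pos le_rfl, e1, Nat.sub_self]
    have := hf n
    field_simp
    ring
  · rw [if_neg (by omega), if_neg (by omega), if_neg (by omega)]
    simp

/-- This is the step of `b⁺` from odd to even index, where the constant `α + 1 = m/2 + k` comes from
the anticommutator of the Dirac operator and the vector variable. -/
theorem laguerre_succ (j : ℕ) {α : ℝ} (hα : -1 < α) :
    C ((j : ℝ) + 1) * laguerre (j + 1) α
      = X * (derivative (laguerre j (α + 1)) - laguerre j (α + 1))
        + C (α + 1) * laguerre j (α + 1) := by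
  have hf : ∀ k : ℕ, (Nat.factorial k : ℝ) ≠ 0 := fun k => by positivity
  have e1 : ∀ k : ℕ, Real.Gamma (k + (α + 1) + 1) = (k + α + 1) * Real.Gamma (k + α + 1) := by
    intro k
    rw [← Gamma_natCast_add_succ hα]
    congr 1
    ring
  have e2 : ∀ k : ℕ, Real.Gamma ((k + 1 : ℕ) + α + 1) = (k + α + 1) * Real.Gamma (k + α + 1) := by
    intro k
    rw [← Gamma_natCast_add_succ hα]
    congr 1
    push_cast
    ring
  ext n
  have hG : ∀ n : ℕ, Real.Gamma (n + α + 1) ≠ 0 := fun n =>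
    (Real.Gamma_pos_of_pos (by have : (0 : ℝ) ≤ n := by positivity
                               linarith)).ne'
  have hn : ∀ n : ℕ, (n + α + 1 : ℝ) ≠ 0 := fun n => by
    have : (0 : ℝ) ≤ n := by positivity
    linarith
  rw [coeff_C_mul, coeff_add, coeff_C_mul]
  cases n with
  | zero =>
    have h0 := hG 0
    have h1 := hn 0
    rw [coeff_X_mul_zero, coeff_laguerre, coeff_laguerre, if_pos (by omega), if_pos (by omega),
      e1, e1, e2, Nat.sub_zero, Nat.sub_zero, Nat.factorial_succ]
    have := hf j
    have hj : (j + 1 : ℝ) ≠ 0 := by positivity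
    push_cast at h0 h1 ⊢
    rw [zero_add] at h0 h1 ⊢
    field_simp
    ring
  | succ n =>
    rw [coeff_X_mul, coeff_sub, coeff_derivative, coeff_laguerre, coeff_laguerre, coeff_laguerre]
    have h0 := hG n
    have h1 := hn n
    have h2 := hn (n + 1)
    push_cast at h2
    have hn1 : (n + 1 : ℝ) ≠ 0 := by positivity
    have hfn := hf n
    rcases lt_trichotomy n j with h | rfl | h
    · obtain ⟨r, rfl⟩ := Nat.exists_eq_add_of_lt h
      rw [if_pos (by omega), if_pos (by omega), if_pos (by omega),
        show n + r + 1 - n = r + 1 by omega, show n + r + 1 - (n + 1) = r by omega,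
        show n + r + 1 + 1 - (n + 1) = r + 1 by omega]
      simp only [e1, e2, Nat.factorial_succ]
      have hr : (r + 1 : ℝ) ≠ 0 := by positivity
      have := hf r
      push_cast
      field_simp
      ring
    · rw [if_pos (by omega), if_neg (by omega), if_pos le_rfl, Nat.sub_self, Nat.sub_self]
      simp only [e1, e2, Nat.factorial_succ]
      push_cast
      field_simp
      ring
    · rw [if_neg (by omega), if_neg (by omega), if_neg (by omega)]
      simp

end Laguerre

/-! ### Clifford–Hermite functions as iterated images under the raising operator -/

section Psi

variable {m : ℕ}

theorem laguerreSq_eq (j : ℕ) (α : ℝ) :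
    laguerreSq m j α = Polynomial.aeval (normSqPoly m) (laguerre j α) := rfl

theorem psi_two_mul (p k : ℕ) (P : CPoly m) : psi m (2 * p) k P
    = ((2 ^ p * Nat.factorial p : ℝ) : ℂ) •
      gaussMulCl m (polyMul (laguerreSq m p ((m : ℝ) / 2 + k - 1)) P) := by
  rw [psi, if_pos (even_two_mul p), Nat.mul_div_cancel_left p two_pos]

theorem psi_two_mul_add_one (p k : ℕ) (P : CPoly m) : psi m (2 * p + 1) k P
    = ((2 ^ p * Nat.factorial p * √2 : ℝ) : ℂ) •
      gaussMulCl m (polyMul (laguerreSq m p ((m : ℝ) / 2 + k)) (polyVecVar m P)) := by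
  rw [psi, if_neg (by simp), show (2 * p + 1) / 2 = p by omega]

theorem sqrt_two_eq : ((√2 / 2 : ℝ) : ℂ) * 2 = ((√2 : ℝ) : ℂ) := by
  push_cast
  ring

theorem bPlus_psi_even (hm : 1 ≤ m) (p k : ℕ) {P : CPoly m} (hP : P ∈ monogenics m k) :
    bPlus m (psi m (2 * p) k P) = psi m (2 * p + 1) k P := by
  have hα : -1 < (m : ℝ) / 2 + k - 1 := by
    have : (1 : ℝ) ≤ m := by exact_mod_cast hm
    have : (0 : ℝ) ≤ k := by positivity
    linarith
  rw [psi_two_mul, psi_two_mul_add_one, map_smul, bPlus_gaussMulCl, laguerreSq_eq, laguerreSq_eq]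
  have hL := laguerre_sub_derivative p hα
  rw [sub_add_cancel] at hL
  rw [← hL, polyPlus, LinearMap.smul_apply, LinearMap.sub_apply, polyDirac_polyMul_aeval,
    polyDirac_of_mem_monogenics hP, map_zero, zero_add, LinearMap.smul_apply, polyVecVar_polyMul,
    map_sub, ← smul_sub, smul_smul, sqrt_two_eq, map_smul, smul_smul, ← Complex.ofReal_mul]
  congr 2
  rw [sub_eq_add_neg (Polynomial.aeval _ _), polyMul_add, ← neg_one_smul ℂ (Polynomial.aeval _ _),
    polyMul_smul]
  module

theorem bPlus_psi_odd (hm : 1 ≤ m) (p k : ℕ) {P : CPoly m} (hP : P ∈ monogenics m k) :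
    bPlus m (psi m (2 * p + 1) k P) = psi m (2 * (p + 1)) k P := by
  have hα : -1 < (m : ℝ) / 2 + k - 1 := by
    have : (1 : ℝ) ≤ m := by exact_mod_cast hm
    have : (0 : ℝ) ≤ k := by positivity
    linarith
  rw [psi_two_mul, psi_two_mul_add_one, map_smul, bPlus_gaussMulCl, laguerreSq_eq, laguerreSq_eq]
  have hL := congrArg (Polynomial.aeval (normSqPoly m)) (laguerre_succ p hα)
  rw [sub_add_cancel] at hL
  set q := laguerre p ((m : ℝ) / 2 + k) with hq
  have hs : ∀ (c : ℝ) (g : MvPolynomial (Fin m) ℂ),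
      algebraMap ℝ (MvPolynomial (Fin m) ℂ) c * g = (c : ℂ) • g := by
    intro c g
    rw [← Algebra.smul_def]
    exact (Complex.coe_smul c g).symm
  rw [map_mul, Polynomial.aeval_C, hs, map_add (Polynomial.aeval (normSqPoly m)), map_mul, map_mul,
    Polynomial.aeval_C, Polynomial.aeval_X, hs, map_sub] at hL
  have hL' := congrArg (fun g => polyMul g P) hL
  simp only [polyMul_smul, polyMul_add] at hL'
  have hfac : ((2 ^ (p + 1) * Nat.factorial (p + 1) : ℝ) : ℂ)
      = ((2 ^ (p + 1) * Nat.factorial p : ℝ) : ℂ) * ((p + 1 : ℝ) : ℂ) := by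
    rw [Nat.factorial_succ]
    push_cast
    ring
  rw [hfac, mul_smul]
  simp only [← (gaussMulCl m).map_smul]
  refine congrArg (gaussMulCl m) ?_
  rw [hL', polyPlus, LinearMap.smul_apply, LinearMap.sub_apply,
    polyDirac_polyMul_aeval, polyDirac_polyVecVar_of_mem_monogenics hP, LinearMap.smul_apply,
    polyVecVar_polyMul, polyVecVar_polyVecVar, map_neg, map_neg, map_neg, map_smul,
    polyMul_polyMul, polyMul_polyMul, mul_sub, sub_eq_add_neg (normSqPoly m * _), polyMul_add,
    ← neg_one_smul ℂ (normSqPoly m * _), polyMul_smul, mul_comm _ (normSqPoly m),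
    mul_comm _ (normSqPoly m)]
  have h2 : ((2 ^ p * Nat.factorial p * √2 : ℝ) : ℂ) * ((√2 / 2 : ℝ) : ℂ)
      = ((2 ^ p * Nat.factorial p : ℝ) : ℂ) := by
    rw [← Complex.ofReal_mul]
    congr 1
    have := Real.mul_self_sqrt (show (0 : ℝ) ≤ 2 by norm_num)
    linear_combination (2 ^ p * (Nat.factorial p : ℝ) / 2) * this
  rw [smul_smul, h2, pow_succ]
  push_cast
  module

/-- The Clifford–Hermite functions are generated from the Gaussian monogenics by `b⁺`. -/
theorem psi_eq (hm : 1 ≤ m) (j k : ℕ) {P : CPoly m} (hP : P ∈ monogenics m k) :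
    psi m j k P = (bPlus m ^ j) (gaussMulCl m P) := by
  induction j with
  | zero =>
    have h0 : laguerreSq m 0 ((m : ℝ) / 2 + k - 1) = 1 := by
      have hα : 0 < (m : ℝ) / 2 + k := by
        have : (1 : ℝ) ≤ m := by exact_mod_cast hm
        have : (0 : ℝ) ≤ k := by positivity
        linarith
      have hne : ((Real.Gamma ((m : ℝ) / 2 + k) : ℝ) : ℂ) ≠ 0 :=
        Complex.ofReal_ne_zero.2 (Real.Gamma_pos_of_pos hα).ne'
      simp [laguerreSq, laguerre, div_self hne]
    have h1 := psi_two_mul 0 k P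
    rw [mul_zero] at h1
    rw [h1, h0]
    have h2 : polyMul (1 : MvPolynomial (Fin m) ℂ) P = P := by
      rw [polyMul_eq, mulEnd, LinearMap.mulLeft_one]
      exact LinearMap.congr_fun polyTensorOp_one_one P
    rw [h2]
    simp
  | succ j ih =>
    rw [bPlus_pow_succ, ← ih]
    rcases Nat.even_or_odd' j with ⟨p, rfl | rfl⟩
    · rw [bPlus_psi_even hm p k hP]
    · rw [bPlus_psi_odd hm p k hP]
      rfl

end Psi

/-! ### The Fischer decomposition -/

section Fischer

variable {m : ℕ}

/-- The Gaussian has no zeros, and a complex polynomial that vanishes on all real points is zero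
because `ℝ` is an infinite subset of `ℂ`. -/
theorem gaussMul_injective (m : ℕ) : Function.Injective (gaussMul m) := by
  rw [← LinearMap.ker_eq_bot, LinearMap.ker_eq_bot']
  intro p hp
  refine MvPolynomial.funext_set (fun _ => Set.range ((↑) : ℝ → ℂ))
    (fun _ => Set.infinite_range_of_injective Complex.ofReal_injective) fun x hx => ?_
  choose y hy using fun i => hx i (Set.mem_univ i)
  have h := congrArg (fun f : 𝓢(Euc m, ℂ) => f (WithLp.toLp 2 y)) hp
  simp only [gaussMul_apply, zero_apply, mul_eq_zero] at h
  have hg : gaussFun m (WithLp.toLp 2 y) ≠ 0 := by simp [gaussFun]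
  have h2 := h.resolve_right hg
  simp only [polyFun, hy] at h2
  rw [map_zero]
  exact h2

theorem gaussMulCl_injective (m : ℕ) : Function.Injective (gaussMulCl m) := by
  have h := Module.Flat.rTensor_preserves_injective_linearMap (M := Cl m)
    ((gaussMul m).restrictScalars ℝ) (gaussMul_injective m)
  exact h

/-- The homogeneous component of a Clifford-valued polynomial. -/
def polyComponent (m n : ℕ) : Module.End ℂ (CPoly m) :=
  TensorProduct.AlgebraTensorModule.map (MvPolynomial.homogeneousComponent n) LinearMap.id

theorem pderiv_homogeneousComponent (j : Fin m) (n : ℕ) (p : MvPolynomial (Fin m) ℂ) :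
    MvPolynomial.pderiv j (MvPolynomial.homogeneousComponent (n + 1) p)
      = MvPolynomial.homogeneousComponent n (MvPolynomial.pderiv j p) := by
  induction p using MvPolynomial.induction_on' with
  | add p q hp hq => simp only [map_add, hp, hq]
  | monomial u a =>
    have hu : (MvPolynomial.monomial u a).IsHomogeneous u.degree :=
      MvPolynomial.isHomogeneous_monomial a rfl
    have hd := hu.pderiv (i := j)
    rw [MvPolynomial.homogeneousComponent_of_mem hu, MvPolynomial.homogeneousComponent_of_mem hd]
    by_cases h0 : u.degree = 0
    · have hu0 : u = 0 := (Finsupp.degree_eq_zero_iff u).1 h0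
      subst hu0
      simp
    · by_cases h : n + 1 = u.degree
      · rw [if_pos h, if_pos (by omega)]
      · rw [if_neg h, if_neg (by omega), map_zero]

theorem polyDirac_polyComponent (n : ℕ) (P : CPoly m) :
    polyDirac m (polyComponent m (n + 1) P) = polyComponent m n (polyDirac m P) := by
  induction P using TensorProduct.induction_on with
  | zero => simp
  | tmul p u =>
    simp only [polyDirac_eq, LinearMap.sum_apply, map_sum, polyTensorOp_tmul, polyComponent,
      TensorProduct.AlgebraTensorModule.map_tmul, LinearMap.id_apply, pderivEnd_apply,
      pderiv_homogeneousComponent]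
  | add P Q hP hQ => simp only [map_add, hP, hQ]

theorem polyDirac_polyComponent_zero (P : CPoly m) :
    polyDirac m (polyComponent m 0 P) = 0 := by
  induction P using TensorProduct.induction_on with
  | zero => simp
  | tmul p u =>
    simp [polyDirac_eq, polyTensorOp_tmul, polyComponent, pderivEnd_apply,
      MvPolynomial.homogeneousComponent_zero]
  | add P Q hP hQ => simp only [map_add, hP, hQ, add_zero]

theorem polyComponent_mem_range (n : ℕ) (P : CPoly m) :
    polyComponent m n P ∈ LinearMap.range (TensorProduct.AlgebraTensorModule.map
      (MvPolynomial.homogeneousSubmodule (Fin m) ℂ n).subtype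
      (LinearMap.id : Cl m →ₗ[ℝ] Cl m)) := by
  induction P using TensorProduct.induction_on with
  | zero => simp
  | tmul p u =>
    exact ⟨⟨_, MvPolynomial.homogeneousComponent_mem n p⟩ ⊗ₜ[ℝ] u, rfl⟩
  | add P Q hP hQ =>
    rw [map_add]
    exact Submodule.add_mem _ hP hQ

theorem exists_sum_polyComponent (P : CPoly m) :
    ∃ N, ∀ n, N ≤ n → ∑ k ∈ Finset.range n, polyComponent m k P = P := by
  induction P using TensorProduct.induction_on with
  | zero => exact ⟨0, fun n _ => by simp⟩
  | tmul p u =>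
    refine ⟨p.totalDegree + 1, fun n hn => ?_⟩
    simp only [polyComponent, TensorProduct.AlgebraTensorModule.map_tmul, LinearMap.id_apply,
      ← TensorProduct.sum_tmul]
    congr 1
    conv_rhs => rw [← MvPolynomial.sum_homogeneousComponent p]
    refine (Finset.sum_subset (Finset.range_mono hn) fun k _ hk => ?_).symm
    exact MvPolynomial.homogeneousComponent_eq_zero _ _ (by simpa [Nat.lt_succ_iff] using hk)
  | add P Q hP hQ =>
    obtain ⟨N, hN⟩ := hP
    obtain ⟨N', hN'⟩ := hQ
    refine ⟨max N N', fun n hn => ?_⟩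
    simp only [map_add, Finset.sum_add_distrib]
    rw [hN n (le_of_max_le_left hn), hN' n (le_of_max_le_right hn)]

theorem polyDirac_pow_polyComponent (n s : ℕ) (P : CPoly m) :
    (polyDirac m ^ s) (polyComponent m (n + s) P) = polyComponent m n ((polyDirac m ^ s) P) := by
  induction s generalizing P with
  | zero => rfl
  | succ s ih =>
    rw [pow_succ, Module.End.mul_apply, ← add_assoc, polyDirac_polyComponent, ih]
    rfl

/-- The Dirac operator is locally nilpotent on polynomials. -/
theorem exists_polyDirac_pow_eq_zero (P : CPoly m) : ∃ s, (polyDirac m ^ s) P = 0 := by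
  obtain ⟨N, hN⟩ := exists_sum_polyComponent P
  have h0 : ∀ n, N ≤ n → polyComponent m n P = 0 := fun n hn => by
    have h1 := hN (n + 1) (by omega)
    rw [Finset.sum_range_succ, hN n hn] at h1
    exact left_eq_add.1 h1.symm
  refine ⟨N, ?_⟩
  obtain ⟨N', hN'⟩ := exists_sum_polyComponent ((polyDirac m ^ N) P)
  rw [← hN' N' le_rfl]
  refine Finset.sum_eq_zero fun k _ => ?_
  rw [← polyDirac_pow_polyComponent, h0 _ (by omega), map_zero]

theorem polyComponent_mem_monogenics {P : CPoly m} (hP : polyDirac m P = 0) (n : ℕ) :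
    polyComponent m n P ∈ monogenics m n := by
  refine ⟨polyComponent_mem_range n P, LinearMap.mem_ker.2 ?_⟩
  cases n with
  | zero => exact polyDirac_polyComponent_zero P
  | succ n => rw [polyDirac_polyComponent, hP, map_zero]

/-- The span of the Clifford–Hermite functions `ψ_{j,k,ℓ}` for fixed `j` and `k`. -/
def hermiteSpace (m j k : ℕ) : Submodule ℂ (CSchwartz m) :=
  (monogenics m k).map ((bPlus m ^ j) ∘ₗ gaussMulCl m)

theorem bPlus_pow_mem_hermiteSpace (j : ℕ) {k : ℕ} {P : CPoly m} (hP : P ∈ monogenics m k) :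
    (bPlus m ^ j) (gaussMulCl m P) ∈ hermiteSpace m j k := ⟨P, hP, rfl⟩

/-- Each `b⁻` removes one `b⁺` at the cost of a factor `lowerCoeff`, which is nonzero for positive
weight. -/
theorem bMinus_pow_bPlus_pow {ν : ℝ} (hν : 0 < ν) {v : CSchwartz m} (h0 : bMinus m v = 0)
    (hv : hOp m v = (ν : ℂ) • v) (s : ℕ) :
    ∃ c : ℂ, c ≠ 0 ∧ (bMinus m ^ s) ((bPlus m ^ s) v) = c • v := by
  induction s with
  | zero => exact ⟨1, one_ne_zero, by simp⟩
  | succ s ih =>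
    obtain ⟨c, hc, h⟩ := ih
    refine ⟨lowerCoeff ν (s + 1) * c, mul_ne_zero (lowerCoeff_ne_zero hν s) hc, ?_⟩
    rw [pow_succ (bMinus m), Module.End.mul_apply, bMinus_bPlus_pow_succ h0 hv, map_smul, h,
      smul_smul]

theorem bMinus_pow_gaussMulCl (s : ℕ) (P : CPoly m) :
    (bMinus m ^ s) (gaussMulCl m P)
      = ((-(√2 / 2 : ℝ) : ℂ) ^ s) • gaussMulCl m ((polyDirac m ^ s) P) := by
  induction s with
  | zero => simp
  | succ s ih =>
    rw [pow_succ', Module.End.mul_apply, ih, map_smul, bMinus_gaussMulCl, pow_succ' (polyDirac m),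
      Module.End.mul_apply, map_neg, map_smul, pow_succ]
    module

theorem hOp_weight_pos (hm : 1 ≤ m) (k : ℕ) : 0 < (m : ℝ) / 2 + k := by
  have : (1 : ℝ) ≤ m := by exact_mod_cast hm
  have : (0 : ℝ) ≤ k := by positivity
  linarith

theorem hOp_gaussMulCl_of_mem_monogenics' {k : ℕ} {P : CPoly m} (hP : P ∈ monogenics m k) :
    hOp m (gaussMulCl m P) = (((m : ℝ) / 2 + k : ℝ) : ℂ) • gaussMulCl m P := by
  rw [hOp_gaussMulCl_of_mem_monogenics hP]
  push_cast
  rfl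

/-- Every polynomial times the Gaussian is a combination of Clifford–Hermite functions. -/
theorem gaussMulCl_mem_iSup_hermiteSpace (hm : 1 ≤ m) (P : CPoly m) :
    gaussMulCl m P ∈ ⨆ jk : ℕ × ℕ, hermiteSpace m jk.1 jk.2 := by
  have hne : (-(√2 / 2 : ℝ) : ℂ) ≠ 0 :=
    neg_ne_zero.2 (Complex.ofReal_ne_zero.2 (by positivity))
  obtain ⟨s, hs⟩ := exists_polyDirac_pow_eq_zero P
  induction s generalizing P with
  | zero =>
    rw [pow_zero, Module.End.one_apply] at hs
    rw [hs, map_zero]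
    exact Submodule.zero_mem _
  | succ s ih =>
    -- `Q` is the last nontrivial Dirac derivative of `P`, so its homogeneous parts are monogenic.
    set Q := (polyDirac m ^ s) P with hQ
    have hQ0 : polyDirac m Q = 0 := by
      rw [hQ, ← Module.End.mul_apply, ← pow_succ', hs]
    obtain ⟨N, hN⟩ := exists_sum_polyComponent Q
    have hmem := fun k => polyComponent_mem_monogenics hQ0 k
    choose c hc hcv using fun k => bMinus_pow_bPlus_pow (hOp_weight_pos hm k)
      (bMinus_gaussMulCl_of_mem_monogenics (hmem k)) (hOp_gaussMulCl_of_mem_monogenics' (hmem k)) s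
    -- `R` consists of `s`-fold raised monogenics, normalized so that its `s`-th Dirac derivative is
    -- `Q`: the scalar `(-√2/2)^s` converts Dirac powers to powers of `b⁻`, and `c k` is the factor
    -- from lowering `s` times. Then `P - R` is killed by the `s`-th power and the induction
    -- applies.
    set R : CPoly m := ∑ k ∈ Finset.range N,
      (((-(√2 / 2 : ℝ) : ℂ) ^ s) * (c k)⁻¹) • (polyPlus m ^ s) (polyComponent m k Q) with hR
    have hRd : (polyDirac m ^ s) R = Q := by
      apply gaussMulCl_injective m
      apply smul_right_injective _ (pow_ne_zero s hne)
      simp only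
      rw [← bMinus_pow_gaussMulCl, hR, map_sum, map_sum]
      conv_rhs => rw [← hN N le_rfl, map_sum, Finset.smul_sum]
      refine Finset.sum_congr rfl fun k _ => ?_
      rw [map_smul, map_smul, ← bPlus_pow_gaussMulCl, hcv, smul_smul, mul_assoc,
        inv_mul_cancel₀ (hc k), mul_one]
    have h1 := ih (P - R) (by rw [map_sub, hRd, sub_self])
    have h2 : gaussMulCl m R ∈ ⨆ jk : ℕ × ℕ, hermiteSpace m jk.1 jk.2 := by
      rw [hR, map_sum]
      refine Submodule.sum_mem _ fun k _ => ?_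
      rw [map_smul, ← bPlus_pow_gaussMulCl]
      exact Submodule.smul_mem _ _ (Submodule.mem_iSup_of_mem (s, k)
        (bPlus_pow_mem_hermiteSpace s (hmem k)))
    have h3 := Submodule.add_mem _ h1 h2
    rwa [← map_add, sub_add_cancel] at h3

theorem finite_tensorProduct_cl (V : Type*) [AddCommGroup V] [Module ℂ V] [Module ℝ V]
    [IsScalarTower ℝ ℂ V] [Module.Finite ℂ V] : Module.Finite ℂ (V ⊗[ℝ] Cl m) := by
  let f : (Fin (clDim m) → V) →ₗ[ℂ] V ⊗[ℝ] Cl m :=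
    { toFun := fun g => ∑ a, g a ⊗ₜ[ℝ] clBasis m a
      map_add' := fun g g' => by simp [TensorProduct.add_tmul, Finset.sum_add_distrib]
      map_smul' := fun c g => by simp [TensorProduct.smul_tmul', Finset.smul_sum] }
  refine Module.Finite.of_surjective f fun w => ?_
  induction w using TensorProduct.induction_on with
  | zero => exact ⟨0, map_zero _⟩
  | tmul v u =>
    refine ⟨fun a => (clBasis m).repr u a • v, ?_⟩
    simp only [f, LinearMap.coe_mk, AddHom.coe_mk, TensorProduct.smul_tmul,
      ← TensorProduct.tmul_sum]
    rw [(clBasis m).sum_repr]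
  | add w w' hw hw' =>
    obtain ⟨g, rfl⟩ := hw
    obtain ⟨g', rfl⟩ := hw'
    exact ⟨g + g', map_add _ _ _⟩

instance (k : ℕ) : Module.Finite ℂ (monogenics m k) := by
  have h1 : Module.Finite ℂ (MvPolynomial.homogeneousSubmodule (Fin m) ℂ k) :=
    Module.Finite.iff_fg.2 (MvPolynomial.homogeneousSubmodule_fg _ _ k)
  have h3 := finite_tensorProduct_cl (m := m) (MvPolynomial.homogeneousSubmodule (Fin m) ℂ k)
  have h2 : Module.Finite ℂ (LinearMap.range (TensorProduct.AlgebraTensorModule.map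
      (MvPolynomial.homogeneousSubmodule (Fin m) ℂ k).subtype
      (LinearMap.id : Cl m →ₗ[ℝ] Cl m))) := Module.Finite.range _
  exact Submodule.finiteDimensional_of_le (inf_le_left : monogenics m k ≤ _)

instance (j k : ℕ) : Module.Finite ℂ (hermiteSpace m j k) :=
  inferInstanceAs (Module.Finite ℂ ((monogenics m k).map ((bPlus m ^ j) ∘ₗ gaussMulCl m)))

end Fischer

/-! ### Orthogonal projections and the Hermite expansion -/

section Projection

variable {m : ℕ}

theorem hOp_of_mem_hermiteSpace {j k : ℕ} {v : CSchwartz m} (hv : v ∈ hermiteSpace m j k) :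
    hOp m v = (((m : ℝ) / 2 + k + j : ℝ) : ℂ) • v := by
  obtain ⟨P, hP, rfl⟩ := hv
  have h := hOp_bPlus_pow (hOp_gaussMulCl_of_mem_monogenics' hP) j
  simp only [LinearMap.comp_apply, h]
  push_cast
  rfl

theorem casimir_of_mem_hermiteSpace {j k : ℕ} {v : CSchwartz m} (hv : v ∈ hermiteSpace m j k) :
    casimir m v = (((m : ℂ) / 2 + k - 1 / 2) ^ 2) • v := by
  obtain ⟨P, hP, rfl⟩ := hv
  have h := casimir_bPlus_pow (bMinus_gaussMulCl_of_mem_monogenics hP)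
    (hOp_gaussMulCl_of_mem_monogenics hP) j
  simp only [LinearMap.comp_apply, h]

theorem inner_bPlus_pow (j : ℕ) (F G : CSchwartz m) :
    inner ℂ (toHilbert m ((bPlus m ^ j) F)) (toHilbert m G)
      = inner ℂ (toHilbert m F) (toHilbert m ((bMinus m ^ j) G)) := by
  induction j generalizing G with
  | zero => rfl
  | succ j ih =>
    rw [bPlus_pow_succ, inner_bPlus, ih, pow_succ]
    rfl

/-- Moving all `j` raising operators to the other side as lowering operators exhausts the `j' < j`
raising operators there and then kills the Gaussian monogenic. -/
theorem inner_bPlus_pow_eq_zero (hm : 1 ≤ m) {j j' k' : ℕ} (hj : j' < j) (F : CSchwartz m)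
    {Q : CPoly m} (hQ : Q ∈ monogenics m k') :
    inner ℂ (toHilbert m ((bPlus m ^ j) F)) (toHilbert m ((bPlus m ^ j') (gaussMulCl m Q))) = 0 := by
  obtain ⟨s, rfl⟩ := Nat.exists_eq_add_of_lt hj
  obtain ⟨c, -, h⟩ := bMinus_pow_bPlus_pow (hOp_weight_pos hm k')
    (bMinus_gaussMulCl_of_mem_monogenics hQ) (hOp_gaussMulCl_of_mem_monogenics' hQ) j'
  rw [inner_bPlus_pow, show j' + s + 1 = s + 1 + j' by ring, pow_add, Module.End.mul_apply, h,
    map_smul, pow_succ, Module.End.mul_apply, bMinus_gaussMulCl_of_mem_monogenics hQ]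
  simp

/-- Different `j` are separated by the ladder. For equal `j` and different `k` the weights `m/2 + k
+ j` of the symmetric operator `h` differ. -/
theorem inner_hermiteSpace_of_ne (hm : 1 ≤ m) {j k j' k' : ℕ} (h : (j, k) ≠ (j', k'))
    {v w : CSchwartz m} (hv : v ∈ hermiteSpace m j k) (hw : w ∈ hermiteSpace m j' k') :
    inner ℂ (toHilbert m v) (toHilbert m w) = 0 := by
  rcases lt_trichotomy j j' with hj | rfl | hj
  · obtain ⟨P, hP, rfl⟩ := hv
    obtain ⟨Q, hQ, rfl⟩ := hw
    rw [← inner_conj_symm]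
    simp only [LinearMap.comp_apply]
    rw [inner_bPlus_pow_eq_zero hm hj _ hP, map_zero]
  · have hk : k ≠ k' := fun hk => h (by rw [hk])
    have h1 := inner_hOp v w
    rw [hOp_of_mem_hermiteSpace hv, hOp_of_mem_hermiteSpace hw, map_smul, map_smul,
      inner_smul_left, inner_smul_right, Complex.conj_ofReal, ← sub_eq_zero, ← sub_mul] at h1
    refine (mul_eq_zero.1 h1).resolve_left ?_
    rw [← Complex.ofReal_sub, Complex.ofReal_eq_zero]
    intro h2
    exact hk (by exact_mod_cast (by linarith : (k : ℝ) = k'))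
  · obtain ⟨P, hP, rfl⟩ := hv
    obtain ⟨Q, hQ, rfl⟩ := hw
    exact inner_bPlus_pow_eq_zero hm hj _ hQ

/-- The orthogonal projection onto the span of the `ψ_{j,k,ℓ}` for fixed `j` and `k`. -/
def hermiteProj (m j k : ℕ) : Module.End ℂ (CSchwartz m) :=
  (hermiteSpace m j k).subtype ∘ₗ
    (Submodule.equivMapOfInjective (toHilbert m) (toHilbert_injective m)
      (hermiteSpace m j k)).symm.toLinearMap ∘ₗ
    ((hermiteSpace m j k).map (toHilbert m)).orthogonalProjectionOnto.toLinearMap ∘ₗ toHilbert m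

theorem hermiteProj_mem (j k : ℕ) (F : CSchwartz m) :
    hermiteProj m j k F ∈ hermiteSpace m j k := Submodule.coe_mem _

theorem toHilbert_hermiteProj (j k : ℕ) (F : CSchwartz m) : toHilbert m (hermiteProj m j k F)
    = ((hermiteSpace m j k).map (toHilbert m)).orthogonalProjectionOnto (toHilbert m F) := by
  have h := LinearEquiv.apply_symm_apply (Submodule.equivMapOfInjective (toHilbert m)
    (toHilbert_injective m) (hermiteSpace m j k))
    (((hermiteSpace m j k).map (toHilbert m)).orthogonalProjectionOnto (toHilbert m F))
  exact congrArg Subtype.val h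

theorem norm_toHilbert_hermiteProj_le (j k : ℕ) (F : CSchwartz m) :
    ‖toHilbert m (hermiteProj m j k F)‖ ≤ ‖toHilbert m F‖ := by
  rw [toHilbert_hermiteProj]
  exact Submodule.norm_orthogonalProjectionOnto_apply_le
    ((hermiteSpace m j k).map (toHilbert m)) (toHilbert m F)

theorem inner_hermiteProj {j k : ℕ} {v : CSchwartz m} (hv : v ∈ hermiteSpace m j k)
    (F : CSchwartz m) : inner ℂ (toHilbert m v) (toHilbert m (hermiteProj m j k F))
      = inner ℂ (toHilbert m v) (toHilbert m F) := by
  rw [toHilbert_hermiteProj]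
  exact Submodule.inner_orthogonalProjectionOnto_eq_of_mem_left
    (⟨_, Submodule.mem_map_of_mem hv⟩ : (hermiteSpace m j k).map (toHilbert m)) _

theorem hermiteProj_eq {j k : ℕ} {F u : CSchwartz m} (hu : u ∈ hermiteSpace m j k)
    (h : ∀ v ∈ hermiteSpace m j k, inner ℂ (toHilbert m v) (toHilbert m u)
      = inner ℂ (toHilbert m v) (toHilbert m F)) : hermiteProj m j k F = u := by
  refine toHilbert_injective m ?_
  rw [← sub_eq_zero, ← map_sub, ← inner_self_eq_zero (𝕜 := ℂ)]
  have hd : hermiteProj m j k F - u ∈ hermiteSpace m j k :=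
    Submodule.sub_mem _ (hermiteProj_mem j k F) hu
  conv_lhs => rw [map_sub (toHilbert m) (hermiteProj m j k F) u, inner_sub_right, ← map_sub]
  rw [inner_hermiteProj hd, h _ hd, sub_self]

theorem hermiteProj_of_mem {j k : ℕ} {v : CSchwartz m} (hv : v ∈ hermiteSpace m j k) :
    hermiteProj m j k v = v := hermiteProj_eq hv fun _ _ => rfl

theorem hermiteProj_of_mem_of_ne (hm : 1 ≤ m) {j k j' k' : ℕ} (h : (j', k') ≠ (j, k))
    {v : CSchwartz m} (hv : v ∈ hermiteSpace m j k) : hermiteProj m j' k' v = 0 :=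
  hermiteProj_eq (Submodule.zero_mem _) fun w hw => by
    rw [inner_hermiteSpace_of_ne hm h hw hv, map_zero, inner_zero_right]

theorem hermiteProj_hOp (j k : ℕ) (F : CSchwartz m) : hermiteProj m j k (hOp m F)
    = (((m : ℝ) / 2 + k + j : ℝ) : ℂ) • hermiteProj m j k F := by
  refine hermiteProj_eq (Submodule.smul_mem _ _ (hermiteProj_mem j k F)) fun v hv => ?_
  rw [← inner_hOp, hOp_of_mem_hermiteSpace hv, map_smul, map_smul, inner_smul_left,
    inner_smul_right, Complex.conj_ofReal, inner_hermiteProj hv]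

theorem hermiteProj_hOp_pow (j k N : ℕ) (F : CSchwartz m) : hermiteProj m j k ((hOp m ^ N) F)
    = ((((m : ℝ) / 2 + k + j) ^ N : ℝ) : ℂ) • hermiteProj m j k F := by
  induction N with
  | zero => simp
  | succ N ih =>
    rw [pow_succ', Module.End.mul_apply, hermiteProj_hOp, ih, smul_smul, ← Complex.ofReal_mul,
      pow_succ']

/-- Since `h` is symmetric, the projection turns `h^N` into the `N`-th power of the weight. As `h^N
F` is again square-integrable, the components decay rapidly. -/
theorem norm_hermiteProj_le_hOp_pow (j k N : ℕ) (F : CSchwartz m) :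
    ((m : ℝ) / 2 + k + j) ^ N * ‖toHilbert m (hermiteProj m j k F)‖
      ≤ ‖toHilbert m ((hOp m ^ N) F)‖ := by
  have h := norm_toHilbert_hermiteProj_le j k ((hOp m ^ N) F)
  rw [hermiteProj_hOp_pow, map_smul, norm_smul, Complex.norm_real, Real.norm_of_nonneg
    (by positivity)] at h
  exact h

/-- A summable weight that dominates the Hermite expansion. -/
def hermiteWeight (jk : ℕ × ℕ) : ℝ := (((jk.1 : ℝ) + 1 / 2) ^ 2)⁻¹ * (((jk.2 : ℝ) + 1 / 2) ^ 2)⁻¹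

theorem summable_hermiteWeight : Summable hermiteWeight := by
  have h : Summable fun n : ℕ => (((n : ℝ) + 1 / 2) ^ 2)⁻¹ := by
    have := (Real.summable_one_div_nat_add_rpow (1 / 2) 2).2 one_lt_two
    refine this.congr fun n => ?_
    rw [abs_of_pos (by positivity), one_div]
    norm_cast
  exact h.mul_of_nonneg h (fun n => by positivity) (fun n => by positivity)

/-- The terms of the Hermite expansion decay rapidly in every Schwartz seminorm. -/
theorem exists_seminorm_hermiteProj_le (hm : 1 ≤ m) (s n : ℕ) : ∃ (C : ℝ) (N : ℕ), 0 ≤ C ∧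
    ∀ (j k : ℕ) (a : Fin (clDim m)) (F : CSchwartz m),
      SchwartzMap.seminorm ℂ s n (coordComp m a (hermiteProj m j k F))
        ≤ C * hermiteWeight (j, k) * ‖toHilbert m ((hOp m ^ N) F)‖ := by
  obtain ⟨C, L, hC, H⟩ := polyBounded_seminorm (m := m) s n
  -- Of the `L + 4` powers of the weight `c`, `L` pay for the growth of the seminorm and four give a
  -- summable weight in `(j, k)`. The factor `4^L` comes from `1 + 2c ≤ 4c`, as `c ≥ 1/2`.
  refine ⟨C * 4 ^ L, L + 4, by positivity, fun j k a F => ?_⟩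
  set c : ℝ := (m : ℝ) / 2 + k + j with hc
  have hm' : (1 : ℝ) ≤ m := by exact_mod_cast hm
  have hj : (0 : ℝ) ≤ j := by positivity
  have hk : (0 : ℝ) ≤ k := by positivity
  have hc0 : 0 < c := by linarith
  have heig : hermiteOp m (coordComp m a (hermiteProj m j k F))
      = ((2 * c : ℝ) : ℂ) • coordComp m a (hermiteProj m j k F) := by
    have h1 := coordComp_hOp a (hermiteProj m j k F)
    rw [hOp_of_mem_hermiteSpace (hermiteProj_mem j k F), map_smul] at h1
    have h2 := congrArg (fun f => (2 : ℂ) • f) h1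
    simp only [smul_smul] at h2
    rw [show (2 : ℂ) * (1 / 2) = 1 by norm_num, one_smul] at h2
    rw [← h2, ← hc, Complex.ofReal_mul, Complex.ofReal_ofNat]
  have hN := norm_hermiteProj_le_hOp_pow j k (L + 4) F
  rw [← hc] at hN
  have hw : (c ^ 4)⁻¹ ≤ hermiteWeight (j, k) := by
    rw [hermiteWeight, ← mul_inv]
    refine inv_anti₀ (by positivity) ?_
    calc ((j : ℝ) + 1 / 2) ^ 2 * ((k : ℝ) + 1 / 2) ^ 2 ≤ c ^ 2 * c ^ 2 := by
          gcongr <;> linarith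
      _ = c ^ 4 := by ring
  calc SchwartzMap.seminorm ℂ s n (coordComp m a (hermiteProj m j k F))
      ≤ C * (1 + |2 * c|) ^ L * ‖toL2 m (coordComp m a (hermiteProj m j k F))‖ := H _ _ heig
    _ ≤ C * (4 * c) ^ L * ‖toHilbert m (hermiteProj m j k F)‖ := by
        rw [abs_of_pos (by positivity)]
        gcongr
        · linarith
        · exact norm_toL2_coordComp_le _ a
    _ = C * 4 ^ L * (c ^ 4)⁻¹ * (c ^ (L + 4) * ‖toHilbert m (hermiteProj m j k F)‖) := by
        rw [mul_pow, pow_add]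
        field_simp
    _ ≤ C * 4 ^ L * hermiteWeight (j, k) * ‖toHilbert m ((hOp m ^ (L + 4)) F)‖ := by
        have h0 : 0 ≤ hermiteWeight (j, k) := le_trans (by positivity) hw
        gcongr

/-! ### Bounded multipliers of the Hermite expansion -/

section Multiplier

variable {w : ℕ × ℕ → ℂ} {B : ℝ}

theorem exists_seminorm_smul_hermiteProj_le (hm : 1 ≤ m) (hw : ∀ jk, ‖w jk‖ ≤ B) (s n : ℕ) :
    ∃ (C : ℝ) (N : ℕ), 0 ≤ C ∧ ∀ (jk : ℕ × ℕ) (a : Fin (clDim m)) (F : CSchwartz m),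
      SchwartzMap.seminorm ℂ s n (coordComp m a (w jk • hermiteProj m jk.1 jk.2 F))
        ≤ hermiteWeight jk * (C * ‖toHilbert m ((hOp m ^ N) F)‖) := by
  obtain ⟨C, N, hC, H⟩ := exists_seminorm_hermiteProj_le hm s n
  have hB : 0 ≤ B := (norm_nonneg _).trans (hw 0)
  refine ⟨B * C, N, by positivity, fun jk a F => ?_⟩
  rw [map_smul, map_smul_eq_mul]
  calc _ ≤ B * (C * hermiteWeight (jk.1, jk.2) * ‖toHilbert m ((hOp m ^ N) F)‖) :=
        mul_le_mul (hw jk) (H jk.1 jk.2 a F) (apply_nonneg _ _) hB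
    _ = _ := by ring

theorem summable_seminorm_smul_hermiteProj (hm : 1 ≤ m) (hw : ∀ jk, ‖w jk‖ ≤ B)
    (a : Fin (clDim m)) (F : CSchwartz m) (s n : ℕ) : Summable fun jk : ℕ × ℕ =>
      SchwartzMap.seminorm ℂ s n (coordComp m a (w jk • hermiteProj m jk.1 jk.2 F)) := by
  obtain ⟨C, N, hC, H⟩ := exists_seminorm_smul_hermiteProj_le hm hw s n
  exact (summable_hermiteWeight.mul_right _).of_nonneg_of_le (fun _ => apply_nonneg _ _)
    fun jk => H jk a F

/-- The operator that acts on `ψ_{j,k,ℓ}` by the scalar `w (j, k)`. -/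
def multiplier (m : ℕ) (w : ℕ × ℕ → ℂ) (F : CSchwartz m) : CSchwartz m :=
  ∑' jk : ℕ × ℕ, w jk • hermiteProj m jk.1 jk.2 F

theorem hasSum_coordComp_multiplier (hm : 1 ≤ m) (hw : ∀ jk, ‖w jk‖ ≤ B) (F : CSchwartz m) :
    HasSum (fun jk : ℕ × ℕ => w jk • hermiteProj m jk.1 jk.2 F) (multiplier m w F) ∧
    ∀ a, coordComp m a (multiplier m w F)
      = schwartzTsum _ (summable_seminorm_smul_hermiteProj hm hw a F) := by
  have h : HasSum (fun jk : ℕ × ℕ => w jk • hermiteProj m jk.1 jk.2 F)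
      (∑ a, schwartzTsum _ (summable_seminorm_smul_hermiteProj hm hw a F) ⊗ₜ clBasis m a) := by
    refine hasSum_of_coordComp fun a => ?_
    convert hasSum_schwartzTsum _ (summable_seminorm_smul_hermiteProj hm hw a F) using 1
    simp [map_sum, coordComp_tmul, Finsupp.single_apply]
  have h' : multiplier m w F = _ := h.tsum_eq
  refine ⟨h' ▸ h, fun a => ?_⟩
  rw [h']
  simp [map_sum, coordComp_tmul, Finsupp.single_apply]

theorem hasSum_multiplier (hm : 1 ≤ m) (hw : ∀ jk, ‖w jk‖ ≤ B) (F : CSchwartz m) :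
    HasSum (fun jk : ℕ × ℕ => w jk • hermiteProj m jk.1 jk.2 F) (multiplier m w F) :=
  (hasSum_coordComp_multiplier hm hw F).1

/-- `multiplier` as a linear map. -/
def multiplierLM (hm : 1 ≤ m) (hw : ∀ jk, ‖w jk‖ ≤ B) : CSchwartz m →ₗ[ℂ] CSchwartz m where
  toFun := multiplier m w
  map_add' F G := by
    refine (hasSum_multiplier hm hw (F + G)).unique ?_
    convert (hasSum_multiplier hm hw F).add (hasSum_multiplier hm hw G) using 2 with jk
    rw [map_add, smul_add]
  map_smul' c F := by
    refine (hasSum_multiplier hm hw (c • F)).unique ?_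
    have h := (hasSum_multiplier hm hw F).const_smul c
    simp only [smul_comm c] at h
    simp only [map_smul]
    exact h

theorem multiplierLM_apply (hm : 1 ≤ m) (hw : ∀ jk, ‖w jk‖ ≤ B) (F : CSchwartz m) :
    multiplierLM hm hw F = multiplier m w F := rfl

theorem continuous_hOp_pow (N : ℕ) : Continuous (hOp m ^ N) := by
  rw [Module.End.coe_pow]
  exact (continuous_hOp m).iterate N

/-- Summing the termwise estimates bounds every Schwartz seminorm of a coordinate of the image by a
constant times `‖h^N F‖` in `L²`, which is a continuous seminorm. -/
theorem continuous_multiplierLM (hm : 1 ≤ m) (hw : ∀ jk, ‖w jk‖ ≤ B) :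
    Continuous (multiplierLM hm hw) := by
  refine continuous_of_coordComp fun a => ?_
  refine WithSeminorms.continuous_of_continuous_comp (schwartz_withSeminorms ℂ (Euc m) ℂ)
    (coordComp m a ∘ₗ multiplierLM hm hw) ?_
  rintro ⟨s, n⟩
  obtain ⟨C, N, hC, H⟩ := exists_seminorm_smul_hermiteProj_le hm hw s n
  set S : ℝ := ∑' jk, hermiteWeight jk with hS
  have hS0 : 0 ≤ S := tsum_nonneg fun jk => by unfold hermiteWeight; positivity
  set K : NNReal := ⟨S * C, mul_nonneg hS0 hC⟩ with hK
  set q : Seminorm ℂ (CSchwartz m) :=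
    K • (normSeminorm ℂ (ClHilbert m)).comp (toHilbert m ∘ₗ (hOp m ^ N)) with hq
  have hqF : ∀ F, q F = S * C * ‖toHilbert m ((hOp m ^ N) F)‖ := fun F => rfl
  refine Seminorm.continuous_of_le (q := q) ?_ fun F => ?_
  · simp_rw [show ⇑q = fun F => S * C * ‖toHilbert m ((hOp m ^ N) F)‖ from funext hqF]
    exact continuous_const.mul ((continuous_toHilbert m).comp (continuous_hOp_pow N)).norm
  · rw [hqF]
    have h1 : SchwartzMap.seminorm ℂ s n (coordComp m a (multiplier m w F))
        ≤ S * C * ‖toHilbert m ((hOp m ^ N) F)‖ := by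
      rw [(hasSum_coordComp_multiplier hm hw F).2 a]
      refine (seminorm_schwartzTsum_le _ _ s n).trans ?_
      rw [mul_assoc, hS, ← tsum_mul_right]
      exact (summable_seminorm_smul_hermiteProj hm hw a F s n).tsum_le_tsum
        (fun jk => H jk a F) (summable_hermiteWeight.mul_right _)
    exact h1

theorem multiplier_of_mem {j k : ℕ} (hm : 1 ≤ m) {v : CSchwartz m}
    (hv : v ∈ hermiteSpace m j k) : multiplier m w v = w (j, k) • v := by
  rw [multiplier, tsum_eq_single (j, k) fun jk hjk => ?_]
  · rw [hermiteProj_of_mem hv]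
  · rw [hermiteProj_of_mem_of_ne hm hjk hv, smul_zero]

end Multiplier

/-- The orthogonal complement of `F` contains every polynomial times the Gaussian by the Fischer
decomposition. Testing against `p ⊗ clBasis m a` reduces the claim to the scalar case in each
coordinate. -/
theorem eq_zero_of_inner_hermiteSpace (hm : 1 ≤ m) {F : CSchwartz m}
    (h : ∀ (j k : ℕ), ∀ v ∈ hermiteSpace m j k, inner ℂ (toHilbert m v) (toHilbert m F) = 0) :
    F = 0 := by
  have hle : (⨆ jk : ℕ × ℕ, hermiteSpace m jk.1 jk.2)
      ≤ ((ℂ ∙ toHilbert m F)ᗮ).comap (toHilbert m) := by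
    refine iSup_le fun jk v hv => ?_
    rw [Submodule.mem_comap, Submodule.mem_orthogonal_singleton_iff_inner_left]
    exact h _ _ v hv
  refine ext_coordComp fun a => ?_
  rw [map_zero]
  refine eq_zero_of_inner_gaussMul fun p => ?_
  have h1 := hle (gaussMulCl_mem_iSup_hermiteSpace hm (p ⊗ₜ clBasis m a))
  rw [Submodule.mem_comap, Submodule.mem_orthogonal_singleton_iff_inner_left, inner_toHilbert,
    Finset.sum_eq_single a] at h1
  · simpa [gaussMulCl, coordComp_tmul] using h1
  · intro b _ hb
    simp [gaussMulCl, coordComp_tmul, hb.symm]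
  · simp

/-- The Hermite expansion of a Clifford-valued Schwartz function. -/
theorem hasSum_hermiteProj (hm : 1 ≤ m) (F : CSchwartz m) :
    HasSum (fun jk : ℕ × ℕ => hermiteProj m jk.1 jk.2 F) F := by
  -- The multiplier with constant symbol 1 provides convergence to some Schwartz function. Its
  -- difference from `F` is orthogonal to all Hermite spaces.
  have hw : ∀ jk : ℕ × ℕ, ‖(fun _ => 1 : ℕ × ℕ → ℂ) jk‖ ≤ 1 := fun _ => by simp
  have hs := hasSum_multiplier hm hw F
  simp only [one_smul] at hs
  convert hs using 1
  rw [← sub_eq_zero]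
  refine eq_zero_of_inner_hermiteSpace hm fun j k v hv => ?_
  rw [map_sub, inner_sub_right, sub_eq_zero]
  have h1 := hs.map ((innerₛₗ ℂ (toHilbert m v)) ∘ₗ toHilbert m)
    (continuous_const.inner (continuous_toHilbert m))
  have h2 := h1.unique (hasSum_single (j, k) fun jk hjk => ?_)
  · simpa [inner_hermiteProj hv] using h2.symm
  · exact inner_hermiteSpace_of_ne hm hjk.symm hv (hermiteProj_mem _ _ F)

/-- A linear relation between continuous maps that holds on all `ψ_{j,k,ℓ}` holds everywhere. -/
theorem eq_of_eqOn_hermiteSpace (hm : 1 ≤ m) {S T : CSchwartz m →ₗ[ℂ] CSchwartz m}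
    (hS : Continuous S) (hT : Continuous T)
    (h : ∀ (j k : ℕ), ∀ v ∈ hermiteSpace m j k, S v = T v) : S = T := by
  refine LinearMap.ext fun F => ?_
  have h1 := (hasSum_hermiteProj hm F).map S hS
  have h2 := (hasSum_hermiteProj hm F).map T hT
  refine h1.unique ?_
  rwa [show S ∘ (fun jk : ℕ × ℕ => hermiteProj m jk.1 jk.2 F)
    = T ∘ fun jk => hermiteProj m jk.1 jk.2 F from
      funext fun jk => h _ _ _ (hermiteProj_mem _ _ F)]

end Projection

/-! ### The values of `E_n` and `D_n` as binomial coefficients -/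

section Values

/-- The factors are `(k - l)(k + l + 1)`, so the product is `(k+n)(k+n-1)⋯(k-n+1)`. For `k < n` both
sides already vanish, so truncated subtraction does no harm. -/
theorem prod_sq_half_sub (n k : ℕ) :
    ∏ l ∈ Finset.range n, (((k : ℂ) + 1 / 2) ^ 2 - ((l : ℂ) + 1 / 2) ^ 2)
      = (((k + n).descFactorial (2 * n) : ℕ) : ℂ) := by
  induction n with
  | zero => simp
  | succ n ih =>
    rw [Finset.prod_range_succ, ih, show 2 * (n + 1) = 2 * n + 1 + 1 by ring, ← add_assoc,
      Nat.succ_descFactorial_succ, Nat.descFactorial_succ]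
    rcases le_or_gt n k with h | h
    · rw [show k + n - 2 * n = k - n by omega]
      push_cast [h]
      ring
    · rw [Nat.descFactorial_of_lt (by omega : k + n < 2 * n)]
      simp

theorem prod_sq_sub (n k : ℕ) :
    ∏ l ∈ Finset.range (n + 1), ((k : ℂ) ^ 2 - (l : ℂ) ^ 2)
      = k * (((k + n).descFactorial (2 * n + 1) : ℕ) : ℂ) := by
  induction n with
  | zero => simp [sq]
  | succ n ih =>
    rw [Finset.prod_range_succ, ih, show 2 * (n + 1) + 1 = 2 * n + 1 + 1 + 1 by ring, ← add_assoc,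
      Nat.succ_descFactorial_succ, Nat.descFactorial_succ _ (2 * n + 1)]
    rcases le_or_gt (n + 1) k with h | h
    · rw [show k + n - (2 * n + 1) = k - (n + 1) by omega]
      push_cast [h]
      ring
    · rw [Nat.descFactorial_of_lt (by omega : k + n < 2 * n + 1)]
      simp

/-- The value `D_n(k + 1/2)`. -/
def dNum (n k : ℕ) : ℕ := (k + n).choose (2 * n)

/-- The value `E_n(k)` for `n ≥ 1`. -/
def eNum (n k : ℕ) : ℕ := (k + n).choose (2 * n) + (k + n - 1).choose (2 * n)

theorem dNum_eq_zero {n k : ℕ} (h : k < n) : dNum n k = 0 :=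
  Nat.choose_eq_zero_of_lt (by omega)

theorem eNum_eq_zero {n k : ℕ} (h : k < n) : eNum n k = 0 := by
  rw [eNum, Nat.choose_eq_zero_of_lt (by omega), Nat.choose_eq_zero_of_lt (by omega)]

theorem eval_Dpoly (n k : ℕ) : (Dpoly n).eval (((k : ℂ) + 1 / 2) ^ 2) = dNum n k := by
  have h1 := prod_sq_half_sub n n
  rw [← two_mul, Nat.descFactorial_self] at h1
  have h2 := prod_sq_half_sub n k
  rw [Nat.descFactorial_eq_factorial_mul_choose] at h2
  have h3 : ((2 * n).factorial : ℂ) ≠ 0 := by exact_mod_cast Nat.factorial_ne_zero _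
  simp only [Dpoly, Polynomial.eval_prod, Polynomial.eval_mul, Polynomial.eval_C,
    Polynomial.eval_sub, Polynomial.eval_X, Finset.prod_mul_distrib, Finset.prod_inv_distrib]
  rw [h1, h2, dNum]
  push_cast
  field_simp

/-- The value is `2k (k+n-1)⋯(k-n+1)/(2n)!`, and `2k = (k + n) + (k - n)` splits it into two
adjacent binomial coefficients. The case `n = 0` is excluded since `eNum 0 k` is 2 and not 1. -/
theorem eval_Epoly {n : ℕ} (hn : 1 ≤ n) (k : ℕ) : (Epoly n).eval ((k : ℂ) ^ 2) = eNum n k := by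
  obtain ⟨n, rfl⟩ := Nat.exists_eq_add_of_le' hn
  have h1 := prod_sq_sub n (n + 1)
  rw [show n + 1 + n = 2 * n + 1 by ring, Nat.descFactorial_self] at h1
  have h2 := prod_sq_sub n k
  have h3 : ((2 * n + 1).factorial : ℂ) ≠ 0 := by exact_mod_cast Nat.factorial_ne_zero _
  have h4 : ((n : ℂ) + 1) ≠ 0 := by exact_mod_cast Nat.succ_ne_zero n
  simp only [Epoly, Polynomial.eval_prod, Polynomial.eval_mul, Polynomial.eval_C,
    Polynomial.eval_sub, Polynomial.eval_X, Finset.prod_mul_distrib, Finset.prod_inv_distrib]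
  rw [h1, h2, eNum]
  have h5 : ((2 * n + 2).factorial : ℂ) * ((k + n + 1).choose (2 * n + 2)
      + (k + n).choose (2 * n + 2)) = 2 * (k * (k + n).descFactorial (2 * n + 1)) := by
    rw [mul_add]
    norm_cast
    rw [← Nat.descFactorial_eq_factorial_mul_choose, ← Nat.descFactorial_eq_factorial_mul_choose,
      Nat.succ_descFactorial_succ, Nat.descFactorial_succ _ (2 * n + 1)]
    rcases le_or_gt (n + 1) k with h | h
    · rw [← add_mul, show k + n + 1 + (k + n - (2 * n + 1)) = 2 * k by omega]
      ring
    · rw [Nat.descFactorial_of_lt (by omega : k + n < 2 * n + 1)]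
      simp
  have h6 : ((2 * n + 2).factorial : ℂ) = 2 * (n + 1) * (2 * n + 1).factorial := by
    rw [Nat.factorial_succ (2 * n + 1)]
    push_cast
    ring
  rw [h6] at h5
  rw [show k + (n + 1) - 1 = k + n by omega, show 2 * (n + 1) = 2 * n + 2 by ring, ← add_assoc]
  push_cast at h5 ⊢
  field_simp
  linear_combination -h5 / 2

end Values

/-! ### Operator series on eigenvectors -/

section Eigen

variable {m : ℕ} {A : Module.End ℂ (CSchwartz m)} {μ : ℂ} {v : CSchwartz m}

theorem aeval_apply_of_eigenvector (h : A v = μ • v) (p : Polynomial ℂ) :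
    Polynomial.aeval A p v = p.eval μ • v := by
  induction p using Polynomial.induction_on' with
  | add p q hp hq => simp [hp, hq, add_smul]
  | monomial n a =>
    have hn : (A ^ n) v = μ ^ n • v := by
      induction n with
      | zero => simp
      | succ n ih => rw [pow_succ', Module.End.mul_apply, ih, map_smul, h, smul_smul, pow_succ]
    rw [Polynomial.aeval_monomial, Polynomial.eval_monomial, Module.End.mul_apply, hn,
      Module.algebraMap_end_apply, smul_smul]

theorem opSeries_of_eigenvector (h : A v = μ • v) (p : ℕ → Polynomial ℂ) {f : ℕ → ℕ}
    (hf : ∀ n, (p n).eval μ = f n) {N : ℕ} (hN : ∀ n, N ≤ n → f n = 0) :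
    opSeries A p v = ((∑ n ∈ Finset.range N, f n : ℕ) : ℂ) • v := by
  rw [opSeries, tsum_eq_sum (s := Finset.range N) fun n hn => ?_]
  · simp only [aeval_apply_of_eigenvector h, hf, Nat.cast_sum, Finset.sum_smul]
  · rw [aeval_apply_of_eigenvector h, hf, hN n (by simpa using hn), Nat.cast_zero, zero_smul]

/-- The terms of `∑_{n ≥ 1} (g_{2^n+s} + ∑_{1 ≤ i < n} 2 g_{2^n+s+2^i})`. -/
def dyadicTerm (g : ℕ → ℕ) (s n : ℕ) : ℕ :=
  g (2 ^ (n + 1) + s) + ∑ i ∈ Finset.Ico 1 (n + 1), 2 * g (2 ^ (n + 1) + s + 2 ^ i)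

theorem dyadicTerm_eq_zero {g : ℕ → ℕ} {k : ℕ} (hg : ∀ n, k < n → g n = 0) (s : ℕ) {n : ℕ}
    (hn : k ≤ n) : dyadicTerm g s n = 0 := by
  have h1 : n + 1 < 2 ^ (n + 1) := Nat.lt_two_pow_self
  rw [dyadicTerm, hg _ (by omega), zero_add]
  refine Finset.sum_eq_zero fun i _ => ?_
  have h2 : 1 ≤ 2 ^ i := Nat.one_le_two_pow
  rw [hg (2 ^ (n + 1) + s + 2 ^ i) (by omega), mul_zero]

/-- The value of `F` of type `ℰ` at the integer `k`. -/
def valueE (a b c d k : ℕ) : ℕ :=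
  a + b * eNum 1 k + c * (eNum 2 k + 2 * eNum 3 k)
    + d * ∑ n ∈ Finset.range k, dyadicTerm (fun n => eNum n k) 1 n

/-- The value of `F` of type `𝒟` at the half-integer `k + 1/2`. -/
def valueD (a b c d k : ℕ) : ℕ :=
  a + b * (dNum 1 k + 2 * dNum 2 k) + c * ∑ n ∈ Finset.range k, dyadicTerm (fun n => dNum n k) 0 n
    + d * (2 * dNum 3 k + (dNum 2 k + ∑ n ∈ Finset.range k, dyadicTerm (fun n => dNum n k) 1 n))

theorem typeE_of_eigenvector {k : ℕ} (h : A v = ((k : ℂ) ^ 2) • v) (a b c d : ℕ) :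
    typeE A a b c d v = (valueE a b c d k : ℂ) • v := by
  rw [typeE, opSeries_of_eigenvector h _ (f := dyadicTerm (fun n => eNum n k) 1) (N := k)
    (fun n => ?_) (fun n hn => dyadicTerm_eq_zero (fun n hn => eNum_eq_zero hn) 1 hn)]
  · simp only [aeval_apply_of_eigenvector h, Polynomial.eval_add, Polynomial.eval_mul,
      Polynomial.eval_ofNat, eval_Epoly le_rfl, eval_Epoly one_le_two,
      eval_Epoly (by norm_num : 1 ≤ 3), smul_smul, ← add_smul, valueE]
    push_cast
    rfl
  · simp only [Polynomial.eval_add, Polynomial.eval_finsetSum, Polynomial.eval_mul,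
      Polynomial.eval_ofNat, dyadicTerm]
    push_cast
    rw [eval_Epoly (Nat.le_add_left 1 _)]
    congr 1
    refine Finset.sum_congr rfl fun i _ => ?_
    rw [eval_Epoly ((Nat.le_add_left 1 _).trans (Nat.le_add_right _ _))]

theorem typeD_of_eigenvector {k : ℕ} (h : A v = (((k : ℂ) + 1 / 2) ^ 2) • v) (a b c d : ℕ) :
    typeD A a b c d v = (valueD a b c d k : ℂ) • v := by
  have h0 : ∀ s n, k ≤ n → dyadicTerm (fun n => dNum n k) s n = 0 := fun s n hn =>
    dyadicTerm_eq_zero (fun n hn => dNum_eq_zero hn) s hn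
  have h1 := opSeries_of_eigenvector h (fun n => Dpoly (2 ^ (n + 1))
      + ∑ i ∈ Finset.Ico 1 (n + 1), 2 * Dpoly (2 ^ (n + 1) + 2 ^ i))
    (f := dyadicTerm (fun n => dNum n k) 0) (N := k) (fun n => ?_) (h0 0)
  · have h2 := opSeries_of_eigenvector h (fun n => Dpoly (2 ^ n + 1)
        + ∑ i ∈ Finset.Ico 1 n, 2 * Dpoly (2 ^ n + 1 + 2 ^ i))
      (f := fun n => dNum (2 ^ n + 1) k + ∑ i ∈ Finset.Ico 1 n, 2 * dNum (2 ^ n + 1 + 2 ^ i) k)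
      (N := k + 1) (fun n => ?_) (fun n hn => ?_)
    -- This series starts at `n = 0`. Its first term is `D_2` with an empty inner sum, and it is
    -- split off so that the rest has the shape of `dyadicTerm` with shift 1. This is also why the
    -- cutoff is `k + 1`.
    · rw [Finset.sum_range_succ', show Finset.Ico 1 0 = ∅ from rfl, Finset.sum_empty, pow_zero,
        one_add_one_eq_two, add_zero] at h2
      rw [typeD, h1, h2]
      simp only [aeval_apply_of_eigenvector h, Polynomial.eval_add, Polynomial.eval_mul,
        Polynomial.eval_ofNat, eval_Dpoly, smul_smul, ← add_smul, valueD, dyadicTerm]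
      congr 1
      push_cast
      ring
    · simp only [Polynomial.eval_add, Polynomial.eval_finsetSum, Polynomial.eval_mul,
        Polynomial.eval_ofNat, eval_Dpoly]
      push_cast
      rfl
    · obtain ⟨n, rfl⟩ := Nat.exists_eq_add_of_le' (le_of_add_le_right hn)
      exact h0 1 n (by omega)
  · simp only [Polynomial.eval_add, Polynomial.eval_finsetSum, Polynomial.eval_mul,
      Polynomial.eval_ofNat, dyadicTerm, eval_Dpoly]
    push_cast
    rfl

end Eigen

/-! ### Generating functions modulo 4 -/

section Periodicity

open PowerSeries

/-- `∑ t^k` modulo `4`. -/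
def geom : PowerSeries (ZMod 4) := PowerSeries.mk 1

/-- `t / (1 - t)²` modulo `4`. -/
def koebe : PowerSeries (ZMod 4) := X * geom ^ 2

theorem geom_mul : geom * (1 - X) = 1 := PowerSeries.mk_one_mul_one_sub_eq_one (ZMod 4)

theorem four_eq_zero : (4 : PowerSeries (ZMod 4)) = 0 := by
  have h : (4 : ZMod 4) = 0 := rfl
  rw [← map_ofNat (C (R := ZMod 4)) 4, h, map_zero]

/-- The expansion `tⁿ/(1-t)^(2n+1) = ∑ C(k+n, 2n) t^k`. -/
theorem coeff_koebe_pow (n k : ℕ) : coeff k (koebe ^ n * geom) = (dNum n k : ZMod 4) := by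
  rw [koebe, mul_pow, ← pow_mul, mul_assoc, ← pow_succ, coeff_X_pow_mul', geom,
    mk_one_pow_eq_mk_choose_add]
  split_ifs with h
  · rw [coeff_mk, dNum, show 2 * n + (k - n) = k + n by omega]
  · rw [dNum_eq_zero (by omega), Nat.cast_zero]

theorem coeff_koebe_pow' {n : ℕ} (hn : 1 ≤ n) (k : ℕ) :
    coeff k (koebe ^ n * ((1 + X) * geom)) = (eNum n k : ZMod 4) := by
  rw [show koebe ^ n * ((1 + X) * geom) = koebe ^ n * geom + X * (koebe ^ n * geom) by ring,
    map_add, coeff_koebe_pow, eNum]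
  cases k with
  | zero =>
    rw [coeff_zero_X_mul, Nat.choose_eq_zero_of_lt (by omega : 0 + n - 1 < 2 * n)]
    simp [dNum]
  | succ k =>
    rw [coeff_succ_X_mul, coeff_koebe_pow, dNum, dNum, show k + 1 + n - 1 = k + n by omega]
    push_cast
    rfl

/-- `t² / (1 + t²)` modulo `4`. -/
def evenGeom : PowerSeries (ZMod 4) := X ^ 2 * PowerSeries.invOfUnit (1 + X ^ 2) 1

theorem evenGeom_mul : evenGeom * (1 + X ^ 2) = X ^ 2 := by
  rw [evenGeom, mul_assoc, mul_comm (invOfUnit _ _), mul_invOfUnit _ _ (by simp), mul_one]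

theorem isUnit_one_sub_X : IsUnit (1 - X : PowerSeries (ZMod 4)) :=
  IsUnit.of_mul_eq_one_right _ geom_mul

theorem isUnit_one_add_X_sq : IsUnit (1 + X ^ 2 : PowerSeries (ZMod 4)) :=
  IsUnit.of_mul_eq_one _ (mul_invOfUnit _ 1 (by simp))

theorem koebe_mul : koebe * (1 - X) ^ 2 = X := by
  rw [koebe]
  linear_combination X * (geom * (1 - X) + 1) * geom_mul

theorem one_sub_X_pow_four : (1 - X : PowerSeries (ZMod 4)) ^ 4 = (1 + X ^ 2) ^ 2 := by
  linear_combination (-X + X ^ 2 - X ^ 3) * four_eq_zero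

/-- Modulo 4, `t²/(1-t)⁴ = t²/(1+t²)²`. With `v = t²/(1+t²)` one has `1 - v = 1/(1+t²)`, so this is
`v(1 - v)`. -/
theorem koebe_sq : koebe ^ 2 = evenGeom - evenGeom ^ 2 := by
  have h := koebe_mul
  have h1 := evenGeom_mul
  refine (isUnit_one_add_X_sq.pow 2).mul_right_cancel ?_
  calc koebe ^ 2 * (1 + X ^ 2) ^ 2 = (koebe * (1 - X) ^ 2) ^ 2 := by
        rw [← one_sub_X_pow_four]
        ring
    _ = X ^ 2 := by rw [h]
    _ = _ := by linear_combination (-(1 + X ^ 2) + evenGeom * (1 + X ^ 2) + X ^ 2) * h1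

theorem exists_sub_pow_two_pow {R : Type*} [CommRing R] (a b : R) (N : ℕ) :
    ∃ r, (a - b) ^ 2 ^ N = a ^ 2 ^ N - b ^ 2 ^ N + 2 * r := by
  induction N with
  | zero => exact ⟨0, by simp⟩
  | succ N ih =>
    obtain ⟨r, hr⟩ := ih
    rw [pow_succ, pow_mul, pow_mul a, pow_mul b, hr]
    exact ⟨b ^ 2 ^ N * b ^ 2 ^ N - a ^ 2 ^ N * b ^ 2 ^ N + 2 * r * (a ^ 2 ^ N - b ^ 2 ^ N)
      + 2 * r ^ 2, by ring⟩

/-- `∑_{1 ≤ n ≤ N} (u^{2^n} + ∑_{1 ≤ i < n} 2 u^{2^n+2^i})`. -/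
def dyadicSum (u : PowerSeries (ZMod 4)) (N : ℕ) : PowerSeries (ZMod 4) :=
  ∑ n ∈ Finset.range N, (u ^ 2 ^ (n + 1) + ∑ i ∈ Finset.Ico 1 (n + 1), 2 * u ^ (2 ^ (n + 1) + 2 ^ i))

/-- Squaring `∑ u^(2^n)` produces exactly the cross terms `2u^(2^n + 2^i)`, and diagonal terms that
are the original ones shifted by one index. The boundary terms account for the shift. -/
theorem dyadicSum_eq (u : PowerSeries (ZMod 4)) (N : ℕ) : dyadicSum u N
    = (∑ n ∈ Finset.range N, u ^ 2 ^ (n + 1)) ^ 2 + u ^ 2 - u ^ 2 ^ (N + 1) := by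
  induction N with
  | zero => simp [dyadicSum]
  | succ N ih =>
    have h : dyadicSum u (N + 1) = dyadicSum u N + (u ^ 2 ^ (N + 1)
      + 2 * u ^ 2 ^ (N + 1) * ∑ n ∈ Finset.range N, u ^ 2 ^ (n + 1)) := by
      rw [dyadicSum, Finset.sum_range_succ, Finset.sum_Ico_eq_sum_range, Finset.mul_sum]
      congr 2
      refine Finset.sum_congr rfl fun i _ => ?_
      rw [add_comm 1 i, pow_add]
      ring
    rw [h, ih, Finset.sum_range_succ, pow_succ 2 (N + 1), pow_mul u]
    ring

/-- Modulo 2, `K^(2^(n+1)) = (v - v²)^(2^n) = v^(2^n) - v^(2^(n+1))`, which telescopes. Knowing the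
sum modulo 2 is enough, since only its square modulo 4 is needed. -/
theorem exists_sum_koebe_pow (N : ℕ) : ∃ r, ∑ n ∈ Finset.range N, koebe ^ 2 ^ (n + 1)
    = evenGeom - evenGeom ^ 2 ^ N + 2 * r := by
  induction N with
  | zero => exact ⟨0, by simp⟩
  | succ N ih =>
    obtain ⟨r, hr⟩ := ih
    obtain ⟨r', hr'⟩ := exists_sub_pow_two_pow evenGeom (evenGeom ^ 2) N
    refine ⟨r + r', ?_⟩
    rw [Finset.sum_range_succ, hr, pow_succ' 2 N, pow_mul koebe, koebe_sq, hr', pow_mul evenGeom]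
    ring

/-- The dyadic series converges to `t² / (1 + t²)` modulo `4`. -/
theorem X_pow_dvd_dyadicSum_sub (N : ℕ) :
    X ^ 2 ^ (N + 1) ∣ dyadicSum koebe N - evenGeom := by
  obtain ⟨r, hr⟩ := exists_sum_koebe_pow N
  have h : dyadicSum koebe N - evenGeom
      = evenGeom ^ 2 ^ N * (evenGeom ^ 2 ^ N - 2 * evenGeom) - koebe ^ 2 ^ (N + 1) := by
    rw [dyadicSum_eq, hr, koebe_sq]
    linear_combination (r * (evenGeom - evenGeom ^ 2 ^ N) + r ^ 2) * four_eq_zero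
  rw [h]
  refine dvd_sub (Dvd.dvd.mul_right ?_ _) (pow_dvd_pow_of_dvd ⟨geom ^ 2, rfl⟩ _)
  rw [pow_succ', pow_mul]
  exact pow_dvd_pow_of_dvd ⟨_, rfl⟩ _

theorem coeff_dyadicSum_mul (k : ℕ) (f : PowerSeries (ZMod 4)) :
    coeff k (dyadicSum koebe k * f) = coeff k (evenGeom * f) := by
  rw [← sub_eq_zero, ← map_sub, ← sub_mul]
  obtain ⟨q, hq⟩ := X_pow_dvd_dyadicSum_sub k
  have h1 : k + 1 < 2 ^ (k + 1) := Nat.lt_two_pow_self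
  rw [hq, mul_assoc, coeff_X_pow_mul', if_neg (by omega)]

theorem coeff_eq_of_mul_one_sub {f : PowerSeries (ZMod 4)} {p : ZMod 4 → ZMod 4}
    (h : (1 - X ^ 4) * f = C (p 0) + C (p 1) * X + C (p 2) * X ^ 2 + C (p 3) * X ^ 3) (k : ℕ) :
    coeff k f = p (k : ZMod 4) := by
  have hk : ∀ k, coeff k f - (if 4 ≤ k then coeff (k - 4) f else 0)
      = coeff k (C (p 0) + C (p 1) * X + C (p 2) * X ^ 2 + C (p 3) * X ^ 3) := fun k => by
    rw [← h, sub_mul, one_mul, map_sub, coeff_X_pow_mul']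
  simp only [map_add, coeff_C_mul, coeff_C, coeff_X, coeff_X_pow] at hk
  induction k using Nat.strong_induction_on with
  | _ k ih =>
    have h1 := hk k
    match k, h1, ih with
    | 0, h1, _ => simpa using h1
    | 1, h1, _ => simpa using h1
    | 2, h1, _ => simpa using h1
    | 3, h1, _ => simpa using h1
    | k + 4, h1, ih =>
      have h2 : ((k + 4 : ℕ) : ZMod 4) = k := by
        rw [Nat.cast_add, show ((4 : ℕ) : ZMod 4) = 0 from rfl, add_zero]
      rw [h2, ← ih k (by omega), ← sub_eq_zero]
      simpa using h1

theorem isUnit_combination (a b : ℕ) :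
    IsUnit ((1 - X : PowerSeries (ZMod 4)) ^ a * (1 + X ^ 2) ^ b) :=
  (isUnit_one_sub_X.pow a).mul (isUnit_one_add_X_sq.pow b)

/-- The function on `ℤ/4` with the values `p`, `q`, `r`, `s` at `0`, `1`, `2`, `3`. -/
def pattern (p q r s : ZMod 4) (x : ZMod 4) : ZMod 4 := (![p, q, r, s] : Fin 4 → ZMod 4) x

@[simp] theorem pattern_zero (p q r s : ZMod 4) : pattern p q r s 0 = p := rfl

@[simp] theorem pattern_one (p q r s : ZMod 4) : pattern p q r s 1 = q := rfl

@[simp] theorem pattern_two (p q r s : ZMod 4) : pattern p q r s 2 = r := rfl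

@[simp] theorem pattern_three (p q r s : ZMod 4) : pattern p q r s 3 = s := rfl

theorem zmod_four_cases (x : ZMod 4) : x = 0 ∨ x = 1 ∨ x = 2 ∨ x = 3 := by
  revert x
  decide

theorem koebe_pow_mul_geom (n : ℕ) : koebe ^ n * geom * (1 - X) ^ (2 * n + 1) = X ^ n := by
  calc _ = (koebe * (1 - X) ^ 2) ^ n * (geom * (1 - X)) := by
        rw [mul_pow, ← pow_mul]
        ring
    _ = _ := by rw [koebe_mul, geom_mul, mul_one]

/-- A 4-periodic sequence has generating function with denominator `1 - t⁴`. The remaining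
denominators are cleared by `(1-t)^a (1+t²)^b`, which may be cancelled as a unit even though `ℤ/4`
has zero divisors. What is left is a polynomial congruence modulo 4. -/
theorem coeff_eq_pattern {f : PowerSeries (ZMod 4)} {a b : ℕ} {p q r s : ZMod 4}
    (h : (1 - X) ^ a * (1 + X ^ 2) ^ b * ((1 - X ^ 4) * f) = (1 - X) ^ a * (1 + X ^ 2) ^ b *
      (C p + C q * X + C r * X ^ 2 + C s * X ^ 3)) (k : ℕ) : coeff k f = pattern p q r s k := by
  refine coeff_eq_of_mul_one_sub (p := pattern p q r s) ?_ k
  rw [pattern_zero, pattern_one, pattern_two, pattern_three]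
  exact (isUnit_combination a b).mul_left_cancel h

theorem natCast_eNum_one (k : ℕ) : (eNum 1 k : ZMod 4) = pattern 0 1 0 1 k := by
  rw [← coeff_koebe_pow' le_rfl]
  refine coeff_eq_pattern (a := 3) (b := 0) ?_ k
  simp only [map_zero, map_one]
  -- The polynomial multiplying `four_eq_zero` is a quarter of the integral difference of the two
  -- sides after the rational functions have been cleared. The later pattern identities are checked
  -- in the same way.
  linear_combination (1 - X ^ 4) * (1 + X) * koebe_pow_mul_geom 1
    + (X ^ 2 - X ^ 3 + X ^ 4 - X ^ 5) * four_eq_zero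

theorem natCast_eNum_two (k : ℕ) :
    ((eNum 2 k + 2 * eNum 3 k : ℕ) : ZMod 4) = pattern 0 0 1 0 k := by
  have h : ((eNum 2 k + 2 * eNum 3 k : ℕ) : ZMod 4)
      = coeff k (koebe ^ 2 * ((1 + X) * geom)
        + (koebe ^ 3 * ((1 + X) * geom) + koebe ^ 3 * ((1 + X) * geom))) := by
    rw [map_add, map_add, coeff_koebe_pow' one_le_two, coeff_koebe_pow' (by norm_num : 1 ≤ 3)]
    push_cast
    ring
  rw [h]
  refine coeff_eq_pattern (a := 7) (b := 0) ?_ k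
  simp only [map_zero, map_one]
  linear_combination (1 - X ^ 4) * (1 + X) * (1 - X) ^ 2 * koebe_pow_mul_geom 2
    + 2 * (1 - X ^ 4) * (1 + X) * koebe_pow_mul_geom 3
    + (2 * X ^ 3 - 5 * X ^ 4 + 9 * X ^ 5 - 9 * X ^ 6 + 5 * X ^ 7 - 2 * X ^ 8) * four_eq_zero

/-- The shift `s` in the indices becomes a factor `K^s`, and the truncated dyadic sum agrees with
`v` up to degree `k`. The factor `f` is `(1+t)/(1-t)` for type `ℰ` and `1/(1-t)` for type `𝒟`. -/
theorem natCast_sum_dyadicTerm {g : ℕ → ℕ} {k : ℕ} {f : PowerSeries (ZMod 4)}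
    (hg : ∀ n, 1 ≤ n → coeff k (koebe ^ n * f) = (g n : ZMod 4)) (s : ℕ) :
    ((∑ n ∈ Finset.range k, dyadicTerm g s n : ℕ) : ZMod 4)
      = coeff k (evenGeom * (koebe ^ s * f)) := by
  rw [← coeff_dyadicSum_mul, dyadicSum, Finset.sum_mul, map_sum, Nat.cast_sum]
  refine Finset.sum_congr rfl fun n _ => ?_
  have h1 : ∀ e : ℕ, 1 ≤ e → ((g (e + s) : ℕ) : ZMod 4) = coeff k (koebe ^ e * (koebe ^ s * f)) :=
    fun e he => by rw [← mul_assoc, ← pow_add, hg _ (by omega)]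
  rw [dyadicTerm, add_mul, map_add, Nat.cast_add, h1 _ Nat.one_le_two_pow, Finset.sum_mul, map_sum,
    Nat.cast_sum]
  congr 1
  refine Finset.sum_congr rfl fun i _ => ?_
  have h2 := h1 (2 ^ (n + 1) + 2 ^ i) (Nat.one_le_two_pow.trans (Nat.le_add_right _ _))
  rw [show 2 * koebe ^ (2 ^ (n + 1) + 2 ^ i) * (koebe ^ s * f)
    = koebe ^ (2 ^ (n + 1) + 2 ^ i) * (koebe ^ s * f)
      + koebe ^ (2 ^ (n + 1) + 2 ^ i) * (koebe ^ s * f) by ring, map_add, ← h2,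
    show 2 ^ (n + 1) + s + 2 ^ i = 2 ^ (n + 1) + 2 ^ i + s by ring]
  push_cast
  ring

theorem natCast_sum_dyadicTerm_eNum (k : ℕ) :
    ((∑ n ∈ Finset.range k, dyadicTerm (fun n => eNum n k) 1 n : ℕ) : ZMod 4)
      = pattern 0 0 0 1 k := by
  rw [natCast_sum_dyadicTerm (fun n hn => coeff_koebe_pow' hn k)]
  refine coeff_eq_pattern (a := 3) (b := 1) ?_ k
  simp only [map_zero, map_one]
  linear_combination (1 - X ^ 4) * (1 + X) * (1 + X ^ 2) * evenGeom * koebe_pow_mul_geom 1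
    + (1 - X ^ 4) * (1 + X) * X * evenGeom_mul
    + (X ^ 4 - X ^ 5 + X ^ 6 - X ^ 7) * four_eq_zero

theorem natCast_dNum_one (k : ℕ) :
    ((dNum 1 k + 2 * dNum 2 k : ℕ) : ZMod 4) = pattern 0 1 1 0 k := by
  have h : ((dNum 1 k + 2 * dNum 2 k : ℕ) : ZMod 4)
      = coeff k (koebe ^ 1 * geom + (koebe ^ 2 * geom + koebe ^ 2 * geom)) := by
    simp only [map_add, coeff_koebe_pow]
    push_cast
    ring
  rw [h]
  refine coeff_eq_pattern (a := 5) (b := 0) ?_ k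
  simp only [map_zero, map_one]
  linear_combination (1 - X ^ 4) * (1 - X) ^ 2 * koebe_pow_mul_geom 1
    + 2 * (1 - X ^ 4) * koebe_pow_mul_geom 2 + (X ^ 2 - X ^ 3 + X ^ 5 - X ^ 6) * four_eq_zero

theorem natCast_sum_dyadicTerm_dNum (k : ℕ) :
    ((∑ n ∈ Finset.range k, dyadicTerm (fun n => dNum n k) 0 n : ℕ) : ZMod 4)
      = pattern 0 0 1 1 k := by
  rw [natCast_sum_dyadicTerm (fun n _ => coeff_koebe_pow n k)]
  refine coeff_eq_pattern (a := 1) (b := 1) ?_ k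
  simp only [map_zero, map_one]
  linear_combination (1 - X ^ 4) * (1 + X ^ 2) * evenGeom * geom_mul + (1 - X ^ 4) * evenGeom_mul

theorem natCast_dNum_two (k : ℕ) :
    ((2 * dNum 3 k + (dNum 2 k
      + ∑ n ∈ Finset.range k, dyadicTerm (fun n => dNum n k) 1 n) : ℕ) : ZMod 4)
      = pattern 0 0 1 0 k := by
  have h : ((2 * dNum 3 k + (dNum 2 k
      + ∑ n ∈ Finset.range k, dyadicTerm (fun n => dNum n k) 1 n) : ℕ) : ZMod 4)
      = coeff k (koebe ^ 3 * geom + koebe ^ 3 * geom + (koebe ^ 2 * geom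
        + evenGeom * (koebe ^ 1 * geom))) := by
    rw [Nat.cast_add, Nat.cast_add, natCast_sum_dyadicTerm (fun n _ => coeff_koebe_pow n k)]
    simp only [map_add, coeff_koebe_pow]
    push_cast
    ring
  rw [h]
  refine coeff_eq_pattern (a := 7) (b := 1) ?_ k
  simp only [map_zero, map_one]
  linear_combination 2 * (1 - X ^ 4) * (1 + X ^ 2) * koebe_pow_mul_geom 3
    + (1 - X ^ 4) * (1 + X ^ 2) * (1 - X) ^ 2 * koebe_pow_mul_geom 2
    + (1 - X ^ 4) * (1 - X) ^ 4 * (1 + X ^ 2) * evenGeom * koebe_pow_mul_geom 1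
    + (1 - X ^ 4) * (1 - X) ^ 4 * X * evenGeom_mul
    + (2 * X ^ 3 - 6 * X ^ 4 + 12 * X ^ 5 - 15 * X ^ 6 + 14 * X ^ 7 - 10 * X ^ 8 + 4 * X ^ 9
      - X ^ 10) * four_eq_zero

theorem natCast_valueE (a b c d k : ℕ) :
    (valueE a b c d k : ZMod 4) = pattern a (a + b) (a + c) (a + b + d) k := by
  rw [valueE, Nat.cast_add, Nat.cast_add, Nat.cast_add, Nat.cast_mul, Nat.cast_mul, Nat.cast_mul,
    natCast_eNum_one, natCast_eNum_two, natCast_sum_dyadicTerm_eNum]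
  rcases zmod_four_cases (k : ZMod 4) with h | h | h | h <;> simp [h]

theorem natCast_valueD (a b c d k : ℕ) :
    (valueD a b c d k : ZMod 4) = pattern a (a + b) (a + b + c + d) (a + c) k := by
  rw [valueD, Nat.cast_add, Nat.cast_add, Nat.cast_add, Nat.cast_mul, Nat.cast_mul, Nat.cast_mul,
    natCast_dNum_one, natCast_dNum_two, natCast_sum_dyadicTerm_dNum]
  rcases zmod_four_cases (k : ZMod 4) with h | h | h | h <;> simp [h]

end Periodicity

/-! ### The two exponentials as multipliers -/

section OpExp

variable {m : ℕ}

/-- The value of `F` on the eigenspaces of the Casimir element. -/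
def casimirValue (m a b c d k : ℕ) : ℕ :=
  if Even m then valueD a b c d (k + (m - 1) / 2) else valueE a b c d (k + (m - 1) / 2)

/-- The root of the Casimir eigenvalue is `k + (m-1)/2`. It is the integer `k + r` for `m = 2r + 1`
and the half-integer `k + r + 1/2` for `m = 2r + 2`; in both cases `r` is the natural number
quotient `(m - 1) / 2`. -/
theorem FCasimir_of_mem_hermiteSpace (hm : 1 ≤ m) (a b c d : ℕ) {j k : ℕ} {v : CSchwartz m}
    (hv : v ∈ hermiteSpace m j k) :
    FCasimir m a b c d v = (casimirValue m a b c d k : ℂ) • v := by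
  have h := casimir_of_mem_hermiteSpace hv
  rw [FCasimir, casimirValue]
  split_ifs with hp
  · refine typeD_of_eigenvector ?_ a b c d
    obtain ⟨r, hr⟩ := hp
    obtain ⟨r, rfl⟩ := Nat.exists_eq_add_of_le' (by omega : 1 ≤ r)
    have hr' : (m : ℂ) = r + 1 + (r + 1) := by exact_mod_cast hr
    rw [h, show (m - 1) / 2 = r by omega, hr']
    congr 2
    push_cast
    ring
  · refine typeE_of_eigenvector ?_ a b c d
    obtain ⟨r, hr⟩ := Nat.not_even_iff_odd.1 hp
    have hr' : (m : ℂ) = 2 * r + 1 := by exact_mod_cast hr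
    rw [h, show (m - 1) / 2 = r by omega, hr']
    congr 2
    push_cast
    ring

theorem I_pow_eq_of_natCast_eq {a b : ℕ} (h : (a : ZMod 4) = b) : Complex.I ^ a = Complex.I ^ b := by
  rw [Complex.I_pow_eq_pow_mod a, Complex.I_pow_eq_pow_mod b,
    (ZMod.natCast_eq_natCast_iff' a b 4).1 h]

/-- The patterns of the basic functions form a basis of the functions on `ℤ/4`, so the coefficients
are read off from `ν` by back substitution. -/
theorem exists_casimirValue (m : ℕ) (ν : ZMod 4 → ZMod 4) : ∃ a b c d : Fin 4, ∀ k,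
    (casimirValue m a b c d k : ZMod 4) = ν ((k + (m - 1) / 2 : ℕ) : ZMod 4) := by
  by_cases hp : Even m
  · refine ⟨⟨(ν 0).val, ZMod.val_lt _⟩, ⟨(ν 1 - ν 0).val, ZMod.val_lt _⟩,
      ⟨(ν 3 - ν 0).val, ZMod.val_lt _⟩, ⟨(ν 2 - ν 1 - (ν 3 - ν 0)).val, ZMod.val_lt _⟩,
      fun k => ?_⟩
    rw [casimirValue, if_pos hp, natCast_valueD]
    simp only [ZMod.natCast_zmod_val]
    rcases zmod_four_cases ((k + (m - 1) / 2 : ℕ) : ZMod 4) with h | h | h | h <;> rw [h] <;> simp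
  · refine ⟨⟨(ν 0).val, ZMod.val_lt _⟩, ⟨(ν 1 - ν 0).val, ZMod.val_lt _⟩,
      ⟨(ν 2 - ν 0).val, ZMod.val_lt _⟩, ⟨(ν 3 - ν 1).val, ZMod.val_lt _⟩, fun k => ?_⟩
    rw [casimirValue, if_neg hp, natCast_valueE]
    simp only [ZMod.natCast_zmod_val]
    rcases zmod_four_cases ((k + (m - 1) / 2 : ℕ) : ZMod 4) with h | h | h | h <;> rw [h] <;> simp

theorem natCast_casimirValue_add_four (m a b c d k : ℕ) :
    (casimirValue m a b c d (k + 4) : ZMod 4) = casimirValue m a b c d k := by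
  have h : ((k + 4 + (m - 1) / 2 : ℕ) : ZMod 4) = ((k + (m - 1) / 2 : ℕ) : ZMod 4) := by
    rw [show k + 4 + (m - 1) / 2 = k + (m - 1) / 2 + 4 by ring, Nat.cast_add,
      show ((4 : ℕ) : ZMod 4) = 0 from rfl, add_zero]
  rw [casimirValue, casimirValue]
  split_ifs
  · rw [natCast_valueD, natCast_valueD, h]
  · rw [natCast_valueE, natCast_valueE, h]

variable {ι : ℕ → Type*} {M : ∀ k, Module.Basis (ι k) ℂ (monogenics m k)}

theorem psi_mem_hermiteSpace (hm : 1 ≤ m) (j k : ℕ) (P : monogenics m k) :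
    psi m j k P ∈ hermiteSpace m j k := by
  rw [psi_eq hm j k P.2]
  exact bPlus_pow_mem_hermiteSpace j P.2

theorem eqOn_hermiteSpace (hm : 1 ≤ m) {S T : CSchwartz m →ₗ[ℂ] CSchwartz m} {j k : ℕ}
    (h : ∀ l, S (psi m j k (M k l)) = T (psi m j k (M k l))) {v : CSchwartz m}
    (hv : v ∈ hermiteSpace m j k) : S v = T v := by
  obtain ⟨P, hP, rfl⟩ := hv
  have h1 : S ∘ₗ ((bPlus m ^ j) ∘ₗ gaussMulCl m) ∘ₗ (monogenics m k).subtype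
      = T ∘ₗ ((bPlus m ^ j) ∘ₗ gaussMulCl m) ∘ₗ (monogenics m k).subtype := by
    refine (M k).ext fun l => ?_
    have h2 := h l
    rw [psi_eq hm j k (M k l).2] at h2
    exact h2
  exact LinearMap.congr_fun h1 ⟨P, hP⟩

theorem hasSum_exp_of_eigenvector {A : CSchwartz m → CSchwartz m} {θ : ℂ} {j k : ℕ}
    (hA : ∀ v ∈ hermiteSpace m j k, A v = θ • v) {v : CSchwartz m} (hv : v ∈ hermiteSpace m j k) :
    HasSum (fun n : ℕ => (Nat.factorial n : ℂ)⁻¹ • A^[n] v) (Complex.exp θ • v) := by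
  have h1 : ∀ n : ℕ, A^[n] v = θ ^ n • v := fun n => by
    induction n with
    | zero => simp
    | succ n ih =>
      rw [Function.iterate_succ_apply', ih, hA _ (Submodule.smul_mem _ _ hv), smul_smul, pow_succ']
  have h2 := (NormedSpace.expSeries_div_hasSum_exp (𝔸 := ℂ) θ).smul_const v
  rw [← Complex.exp_eq_exp_ℂ] at h2
  convert h2 using 2 with n
  rw [h1, smul_smul, div_eq_inv_mul]

/-- On each Hermite space `A` is a scalar, so the exponential series converges to the scalar
exponential. This replaces the chosen bases of monogenics by the spaces they span. -/
theorem isOpExp_iff (hm : 1 ≤ m) {A : CSchwartz m → CSchwartz m} {θ : ℕ → ℕ → ℂ}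
    (hA : ∀ j k, ∀ v ∈ hermiteSpace m j k, A v = θ j k • v) (P : CSchwartz m →ₗ[ℂ] CSchwartz m) :
    IsOpExp (hermiteBasis M) A P ↔
      Continuous P ∧ ∀ j k, ∀ v ∈ hermiteSpace m j k, P v = Complex.exp (θ j k) • v := by
  constructor
  · intro h
    refine ⟨h.continuous, fun j k v hv => ?_⟩
    refine eqOn_hermiteSpace (M := M) (T := Complex.exp (θ j k) • LinearMap.id) hm (fun l => ?_) hv
    exact (h.hasSum _ ⟨j, k, l, rfl⟩).unique
      (hasSum_exp_of_eigenvector (hA j k) (psi_mem_hermiteSpace hm j k _))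
  · rintro ⟨hc, h⟩
    refine ⟨hc, ?_⟩
    rintro _ ⟨j, k, l, rfl⟩
    rw [h j k _ (psi_mem_hermiteSpace hm j k _)]
    exact hasSum_exp_of_eigenvector (hA j k) (psi_mem_hermiteSpace hm j k _)

theorem exp_I_pi_div_two_mul (n : ℕ) :
    Complex.exp (Complex.I * (Real.pi / 2) * n) = Complex.I ^ n := by
  rw [mul_comm, Complex.exp_nat_mul, mul_comm, Complex.exp_pi_div_two_mul_I]

theorem isExpCasimir_iff (hm : 1 ≤ m) (a b c d : ℕ) (P : CSchwartz m →ₗ[ℂ] CSchwartz m) :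
    IsExpCasimir M a b c d P ↔ Continuous P ∧ ∀ j k, ∀ v ∈ hermiteSpace m j k,
      P v = Complex.I ^ casimirValue m a b c d k • v := by
  rw [IsExpCasimir, isOpExp_iff hm (θ := fun _ k =>
    Complex.I * (Real.pi / 2) * casimirValue m a b c d k) fun j k v hv => by
      rw [FCasimir_of_mem_hermiteSpace hm a b c d hv, smul_smul]]
  simp only [exp_I_pi_div_two_mul]

theorem isExpOscillator_iff (hm : 1 ≤ m) (Q : CSchwartz m →ₗ[ℂ] CSchwartz m) :
    IsExpOscillator M Q ↔ Continuous Q ∧ ∀ j k, ∀ v ∈ hermiteSpace m j k,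
      Q v = Complex.I ^ (j + k) • v := by
  rw [IsExpOscillator, isOpExp_iff hm (θ := fun j k =>
    Complex.I * (Real.pi / 2) * (j + k : ℕ)) fun j k v hv => by
      rw [hOp_of_mem_hermiteSpace hv, ← sub_smul, smul_smul]
      congr 2
      push_cast
      ring]
  simp only [exp_I_pi_div_two_mul]

theorem norm_I_pow_le (e : ℕ → ℕ → ℕ) (jk : ℕ × ℕ) : ‖Complex.I ^ e jk.1 jk.2‖ ≤ 1 := by
  simp

theorem existsUnique_multiplier (hm : 1 ≤ m) (e : ℕ → ℕ → ℕ) :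
    ∃! P : CSchwartz m →ₗ[ℂ] CSchwartz m, Continuous P ∧
      ∀ j k, ∀ v ∈ hermiteSpace m j k, P v = Complex.I ^ e j k • v := by
  have h : ∀ j k, ∀ v ∈ hermiteSpace m j k,
      multiplierLM hm (norm_I_pow_le e) v = Complex.I ^ e j k • v := fun j k v hv => by
    rw [multiplierLM_apply, multiplier_of_mem hm hv]
  refine ⟨multiplierLM hm (norm_I_pow_le e), ⟨continuous_multiplierLM hm _, h⟩, ?_⟩
  rintro P ⟨hc, hP⟩
  refine eq_of_eqOn_hermiteSpace hm hc (continuous_multiplierLM hm _) fun j k v hv => ?_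
  rw [hP j k v hv, h j k v hv]

end OpExp

/-! ### Clifford–Helmholtz relations and operators commuting with the oscillator -/

section Helmholtz

variable {m : ℕ}

/-- The Clifford–Helmholtz relations in terms of the ladder operators. -/
theorem cliffordHelmholtz_iff (T : CSchwartz m →ₗ[ℂ] CSchwartz m) : CliffordHelmholtz T ↔
    (∀ F, T (bPlus m F) = Complex.I • bPlus m (T F)) ∧
    (∀ F, T (bMinus m F) = -Complex.I • bMinus m (T F)) := by
  have hne : ((√2 / 2 : ℝ) : ℂ) ≠ 0 := Complex.ofReal_ne_zero.2 (by positivity)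
  constructor
  · rintro ⟨h1, h2⟩
    have h1' : ∀ F, T (dirac m F) = -Complex.I • vecVar m (T F) := LinearMap.congr_fun h1
    have h2' : ∀ F, T (vecVar m F) = -Complex.I • dirac m (T F) := LinearMap.congr_fun h2
    refine ⟨fun F => ?_, fun F => ?_⟩
    · rw [bPlus_apply, bPlus_apply, map_smul, map_sub, h1', h2']
      module
    · rw [bMinus_apply, bMinus_apply, map_neg, map_smul, map_add, h1', h2']
      module
  · rintro ⟨h1, h2⟩
    have h3 : ∀ F, T (vecVar m F) - T (dirac m F)
        = Complex.I • (vecVar m (T F) - dirac m (T F)) := fun F => by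
      have h := h1 F
      rw [bPlus_apply, bPlus_apply, map_smul, map_sub, smul_comm] at h
      exact smul_right_injective _ hne h
    have h4 : ∀ F, T (vecVar m F) + T (dirac m F)
        = -Complex.I • (vecVar m (T F) + dirac m (T F)) := fun F => by
      have h := h2 F
      rw [bMinus_apply, bMinus_apply, map_neg, map_smul, map_add, smul_neg, neg_inj,
        smul_comm] at h
      exact smul_right_injective _ hne h
    refine ⟨LinearMap.ext fun F => ?_, LinearMap.ext fun F => ?_⟩
    · change T (dirac m F) = -Complex.I • vecVar m (T F)
      linear_combination (norm := module) (1 / 2 : ℂ) • h4 F - (1 / 2 : ℂ) • h3 F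
    · change T (vecVar m F) = -Complex.I • dirac m (T F)
      linear_combination (norm := module) (1 / 2 : ℂ) • h4 F + (1 / 2 : ℂ) • h3 F

theorem continuous_bPlus (m : ℕ) : Continuous (bPlus m) :=
  ((continuous_vecVar m).sub (continuous_dirac m)).const_smul _

theorem continuous_bMinus (m : ℕ) : Continuous (bMinus m) :=
  ((continuous_vecVar m).add (continuous_dirac m)).const_smul _

theorem bPlus_mem_hermiteSpace {j k : ℕ} {v : CSchwartz m} (hv : v ∈ hermiteSpace m j k) :
    bPlus m v ∈ hermiteSpace m (j + 1) k := by
  obtain ⟨P, hP, rfl⟩ := hv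
  exact ⟨P, hP, bPlus_pow_succ j _⟩

theorem bMinus_of_mem_hermiteSpace_zero {k : ℕ} {v : CSchwartz m} (hv : v ∈ hermiteSpace m 0 k) :
    bMinus m v = 0 := by
  obtain ⟨P, hP, rfl⟩ := hv
  exact bMinus_gaussMulCl_of_mem_monogenics hP

theorem bMinus_mem_hermiteSpace {j k : ℕ} {v : CSchwartz m} (hv : v ∈ hermiteSpace m (j + 1) k) :
    bMinus m v ∈ hermiteSpace m j k := by
  obtain ⟨P, hP, rfl⟩ := hv
  have h := bMinus_bPlus_pow_succ (bMinus_gaussMulCl_of_mem_monogenics hP)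
    (hOp_gaussMulCl_of_mem_monogenics hP) j
  rw [LinearMap.comp_apply, h]
  exact Submodule.smul_mem _ _ (bPlus_pow_mem_hermiteSpace j hP)

/-- A continuous operator with eigenvalues `i^(F_k + j + k)` on the Hermite spaces satisfies the
Clifford–Helmholtz relations. -/
theorem cliffordHelmholtz_of_hermiteSpace (hm : 1 ≤ m) {T : CSchwartz m →ₗ[ℂ] CSchwartz m}
    (hT : Continuous T) {e : ℕ → ℕ}
    (h : ∀ j k, ∀ v ∈ hermiteSpace m j k, T v = Complex.I ^ (e k + j) • v) :
    CliffordHelmholtz T := by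
  rw [cliffordHelmholtz_iff]
  have hp : T ∘ₗ bPlus m = Complex.I • (bPlus m ∘ₗ T) := by
    refine eq_of_eqOn_hermiteSpace hm (hT.comp (continuous_bPlus m))
      (((continuous_bPlus m).comp hT).const_smul _) fun j k v hv => ?_
    rw [LinearMap.comp_apply, LinearMap.smul_apply, LinearMap.comp_apply, h j k v hv,
      h (j + 1) k _ (bPlus_mem_hermiteSpace hv), map_smul, smul_smul, ← add_assoc, pow_succ']
  have hq : T ∘ₗ bMinus m = -Complex.I • (bMinus m ∘ₗ T) := by
    refine eq_of_eqOn_hermiteSpace hm (hT.comp (continuous_bMinus m))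
      (((continuous_bMinus m).comp hT).const_smul _) fun j k v hv => ?_
    rw [LinearMap.comp_apply, LinearMap.smul_apply, LinearMap.comp_apply, h j k v hv]
    cases j with
    | zero => simp [bMinus_of_mem_hermiteSpace_zero hv]
    | succ j =>
      rw [h j k _ (bMinus_mem_hermiteSpace hv), map_smul, smul_smul, ← add_assoc, pow_succ',
        ← mul_assoc, neg_mul, Complex.I_mul_I, neg_neg, one_mul]
  exact ⟨LinearMap.congr_fun hp, LinearMap.congr_fun hq⟩

theorem map_hOp_of_ladder {T : CSchwartz m →ₗ[ℂ] CSchwartz m}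
    (h1 : ∀ F, T (bPlus m F) = Complex.I • bPlus m (T F))
    (h2 : ∀ F, T (bMinus m F) = -Complex.I • bMinus m (T F)) (F : CSchwartz m) :
    T (hOp m F) = hOp m (T F) := by
  rw [hOp_apply, hOp_apply, map_smul, map_add, h2, h1, h1, h2, map_smul, map_smul, smul_smul,
    smul_smul, neg_mul, mul_neg, Complex.I_mul_I, neg_neg, one_smul, one_smul]

/-- Apart from a finite sum of its Hermite components, every Clifford-valued Schwartz function is
in the range of `h - m/2 - n`. -/
theorem exists_hOp_sub_smul_eq (hm : 1 ≤ m) (n : ℕ) (F : CSchwartz m) : ∃ G,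
    hOp m G - (((m : ℝ) / 2 + n : ℝ) : ℂ) • G
      = F - ∑ jk ∈ Finset.HasAntidiagonal.antidiagonal n, hermiteProj m jk.1 jk.2 F := by
  -- The resolvent of `h - m/2` at `n`. On the eigenspaces with `j + k = n` the convention `0⁻¹ = 0`
  -- gives the symbol 0; elsewhere the denominator is a nonzero integer, so the symbol is bounded by
  -- 1.
  set w : ℕ × ℕ → ℂ := fun jk => (((jk.1 : ℝ) + jk.2 - n : ℝ) : ℂ)⁻¹ with hw
  have hb : ∀ jk, ‖w jk‖ ≤ 1 := fun jk => by
    rw [hw, norm_inv, Complex.norm_real]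
    rcases eq_or_ne (jk.1 + jk.2) n with h | h
    · rw [← h]
      simp
    · refine inv_le_one_of_one_le₀ ?_
      have h1 : ((jk.1 : ℤ) + jk.2 - n) ≠ 0 := by omega
      have h2 := Int.one_le_abs h1
      rw [Real.norm_eq_abs]
      exact_mod_cast h2
  refine ⟨multiplier m w F, ?_⟩
  have h1 := hasSum_multiplier hm hb F
  have h2 := (h1.map (hOp m) (continuous_hOp m)).sub
    (h1.const_smul (((m : ℝ) / 2 + n : ℝ) : ℂ))
  refine h2.unique ?_
  have h3 : HasSum (fun jk => if jk ∈ Finset.HasAntidiagonal.antidiagonal n then hermiteProj m jk.1 jk.2 F else 0)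
      (∑ jk ∈ Finset.HasAntidiagonal.antidiagonal n, hermiteProj m jk.1 jk.2 F) := by
    rw [← Finset.sum_congr rfl fun jk hjk => if_pos hjk]
    exact hasSum_sum_of_ne_finset_zero fun jk hjk => if_neg hjk
  convert (hasSum_hermiteProj hm F).sub h3 using 2 with jk
  rw [Function.comp_apply, map_smul, hOp_of_mem_hermiteSpace (hermiteProj_mem _ _ F), smul_smul,
    smul_smul, ← sub_smul, mul_comm (w jk), ← sub_mul, ← Complex.ofReal_sub,
    show (m : ℝ) / 2 + jk.2 + jk.1 - (m / 2 + n) = jk.1 + jk.2 - n by ring]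
  split_ifs with h
  · rw [Finset.HasAntidiagonal.mem_antidiagonal] at h
    rw [← h]
    simp
  · rw [Finset.HasAntidiagonal.mem_antidiagonal] at h
    have h4 : ((jk.1 : ℤ) + jk.2 - n) ≠ 0 := by omega
    have h5 : (((jk.1 : ℝ) + jk.2 - n : ℝ) : ℂ) ≠ 0 := by exact_mod_cast h4
    rw [hw, mul_inv_cancel₀ h5, one_smul, sub_zero]

/-- An operator that commutes with `h` and vanishes on the functions `ψ_{j,k,ℓ}` is zero, even if
it is not known to be continuous. -/
theorem eq_zero_of_commute_hOp (hm : 1 ≤ m) {U : CSchwartz m →ₗ[ℂ] CSchwartz m}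
    (hU : ∀ F, U (hOp m F) = hOp m (U F))
    (h : ∀ j k, ∀ v ∈ hermiteSpace m j k, U v = 0) (F : CSchwartz m) : U F = 0 := by
  refine (hasSum_hermiteProj hm (U F)).unique ?_
  have h0 : ∀ jk : ℕ × ℕ, hermiteProj m jk.1 jk.2 (U F) = 0 := fun jk => by
    -- With `n = j + k`, `U F` lies in the range of `h - (m/2 + j + k)`, which the projection at
    -- `(j, k)` annihilates.
    obtain ⟨G, hG⟩ := exists_hOp_sub_smul_eq hm (jk.2 + jk.1) F
    have h1 : U F = hOp m (U G) - (((m : ℝ) / 2 + (jk.2 + jk.1 : ℕ) : ℝ) : ℂ) • U G := by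
      rw [← hU, ← map_smul, ← map_sub, hG, map_sub, map_sum,
        Finset.sum_eq_zero fun jk _ => h _ _ _ (hermiteProj_mem jk.1 jk.2 F), sub_zero]
    rw [h1, map_sub, map_smul, hermiteProj_hOp, Nat.cast_add, add_assoc, sub_self]
  simp only [h0]
  exact hasSum_zero

theorem exists_eq_I_pow {z : ℂ} (hz : z ^ 4 = 1) : ∃ n : ℕ, z = Complex.I ^ n := by
  have h : (z - 1) * ((z + 1) * ((z - Complex.I) * (z + Complex.I))) = 0 := by
    linear_combination hz - (z ^ 2 - 1) * Complex.I_sq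
  rcases mul_eq_zero.1 h with h | h
  · exact ⟨0, by rw [pow_zero]; exact sub_eq_zero.1 h⟩
  rcases mul_eq_zero.1 h with h | h
  · exact ⟨2, by rw [Complex.I_sq]; exact eq_neg_of_add_eq_zero_left h⟩
  rcases mul_eq_zero.1 h with h | h
  · exact ⟨1, by rw [pow_one]; exact sub_eq_zero.1 h⟩
  · exact ⟨3, by rw [Complex.I_pow_three]; exact eq_neg_of_add_eq_zero_left h⟩

end Helmholtz

/-! ### Classification of the operators -/

section Classification

variable {m : ℕ} {ι : ℕ → Type*} {M : ∀ k, Module.Basis (ι k) ℂ (monogenics m k)}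

theorem comp_apply_of_isExp (hm : 1 ≤ m) {a b c d : ℕ} {P Q : CSchwartz m →ₗ[ℂ] CSchwartz m}
    (hP : IsExpCasimir M a b c d P) (hQ : IsExpOscillator M Q) (j k : ℕ) (v : CSchwartz m)
    (hv : v ∈ hermiteSpace m j k) :
    (P ∘ₗ Q) v = Complex.I ^ (casimirValue m a b c d k + k + j) • v := by
  rw [LinearMap.comp_apply, ((isExpOscillator_iff hm Q).1 hQ).2 j k v hv, map_smul,
    ((isExpCasimir_iff hm a b c d P).1 hP).2 j k v hv, smul_smul, ← pow_add]
  congr 2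
  ring

theorem gaussMulCl_basis_ne_zero (k : ℕ) (l : ι k) : gaussMulCl m (M k l : CPoly m) ≠ 0 := by
  intro h
  have h1 := gaussMulCl_injective m (h.trans (map_zero _).symm)
  exact (M k).ne_zero l (Subtype.ext h1)

/-- The products of the two exponentials have the three properties. -/
theorem properties_of_isExp (hm : 1 ≤ m) {a b c d : ℕ} {P Q : CSchwartz m →ₗ[ℂ] CSchwartz m}
    (hP : IsExpCasimir M a b c d P) (hQ : IsExpOscillator M Q) {T : CSchwartz m →ₗ[ℂ] CSchwartz m}
    (hT : T = P ∘ₗ Q) :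
    CliffordHelmholtz T ∧ DiagonalPeriodic M T ∧ T ∘ₗ T ∘ₗ T ∘ₗ T = LinearMap.id := by
  have hc : Continuous T := by
    rw [hT]
    exact hP.continuous.comp hQ.continuous
  have hv : ∀ j k, ∀ v ∈ hermiteSpace m j k,
      T v = Complex.I ^ (casimirValue m a b c d k + k + j) • v := by
    rw [hT]
    exact comp_apply_of_isExp hm hP hQ
  refine ⟨cliffordHelmholtz_of_hermiteSpace hm hc hv,
    ⟨fun j k => Complex.I ^ (casimirValue m a b c d k + k + j),
      fun j k l => hv j k _ (psi_mem_hermiteSpace hm j k _), fun j k => ?_⟩, ?_⟩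
  · refine I_pow_eq_of_natCast_eq ?_
    push_cast
    rw [natCast_casimirValue_add_four, show (4 : ZMod 4) = 0 from rfl, add_zero]
  · refine eq_of_eqOn_hermiteSpace hm (hc.comp (hc.comp (hc.comp hc))) continuous_id
      fun j k v hvm => ?_
    simp only [LinearMap.comp_apply, LinearMap.id_apply, hv j k v hvm, map_smul, smul_smul]
    generalize casimirValue m a b c d k + k + j = e
    rw [show ∀ z : ℂ, z * z * z * z = z ^ 4 from fun z => by ring, ← pow_mul, mul_comm e,
      pow_mul, Complex.I_pow_four, one_pow, one_smul]

theorem apply_hermiteSpace_of_ladder {T : CSchwartz m →ₗ[ℂ] CSchwartz m}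
    (h : ∀ F, T (bPlus m F) = Complex.I • bPlus m (T F)) (j : ℕ) (F : CSchwartz m) :
    T ((bPlus m ^ j) F) = Complex.I ^ j • (bPlus m ^ j) (T F) := by
  induction j with
  | zero => simp
  | succ j ih => rw [bPlus_pow_succ, h, ih, map_smul, smul_smul, bPlus_pow_succ, pow_succ']

/-- The eigenvalues on the functions `ψ_{0,k,ℓ}` are powers of `i` that depend on `k` modulo `4`
only. -/
theorem exists_eigenvalue_exponent (hm : 1 ≤ m) {T : CSchwartz m →ₗ[ℂ] CSchwartz m}
    {μ : ℕ → ℕ → ℂ} (hμ : ∀ (j k : ℕ) (l : ι k), T (psi m j k (M k l)) = μ j k • psi m j k (M k l))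
    (hper : ∀ j k : ℕ, μ j (k + 4) = μ j k) (h4 : T ∘ₗ T ∘ₗ T ∘ₗ T = LinearMap.id) (s : ℕ) :
    ∃ ν : ZMod 4 → ZMod 4, ∀ k, Nonempty (ι k) → ∀ n : ℕ,
      (n : ZMod 4) = ν ((k + s : ℕ) : ZMod 4) → μ 0 k = Complex.I ^ (n + k) := by
  have hroot : ∀ k, Nonempty (ι k) → μ 0 k ^ 4 = 1 := by
    rintro k ⟨l⟩
    have h1 := LinearMap.congr_fun h4 (psi m 0 k (M k l))
    simp only [LinearMap.comp_apply, LinearMap.id_apply, hμ, map_smul, smul_smul] at h1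
    have hne : psi m 0 k (M k l) ≠ 0 := by
      rw [psi_eq hm 0 k (M k l).2]
      exact gaussMulCl_basis_ne_zero k l
    have h2 := smul_left_injective ℂ hne (h1.trans (one_smul ℂ _).symm)
    rw [← h2]
    ring
  have hmod : ∀ k, μ 0 k = μ 0 (k % 4) := fun k => by
    have : ∀ q r, μ 0 (r + 4 * q) = μ 0 r := fun q r => by
      induction q with
      | zero => rfl
      | succ q ih => rw [mul_add, ← add_assoc, mul_one, hper, ih]
    conv_lhs => rw [← Nat.mod_add_div k 4]
    exact this _ _
  -- Residues with no nonzero monogenics must be allowed: for `m = 1` all spaces of degree `k ≥ 1`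
  -- vanish and the eigenvalues there are unconstrained.
  have hex : ∀ r : ZMod 4, ∃ e : ZMod 4, ∀ k, Nonempty (ι k) → ((k + s : ℕ) : ZMod 4) = r →
      ∀ n : ℕ, (n : ZMod 4) = e → μ 0 k = Complex.I ^ (n + k) := by
    intro r
    by_cases hr : ∃ k, Nonempty (ι k) ∧ ((k + s : ℕ) : ZMod 4) = r
    · obtain ⟨k₀, hk₀, hr₀⟩ := hr
      obtain ⟨n₀, hn₀⟩ := exists_eq_I_pow (hroot k₀ hk₀)
      -- The oscillator exponential already supplies `i^k`, so it is divided out of the eigenvalue.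
      refine ⟨(n₀ : ZMod 4) - k₀, fun k _ hk n hn => ?_⟩
      have h1 : (k : ZMod 4) = k₀ := by
        rw [← hr₀] at hk
        push_cast at hk
        exact add_right_cancel hk
      rw [hmod, (ZMod.natCast_eq_natCast_iff' k k₀ 4).1 h1, ← hmod, hn₀]
      refine I_pow_eq_of_natCast_eq ?_
      push_cast
      rw [hn, h1, sub_add_cancel]
    · exact ⟨0, fun k hk hkr => (hr ⟨k, hk, hkr⟩).elim⟩
  choose ν hν using hex
  exact ⟨ν, fun k hk => hν _ k hk rfl⟩

/-- An operator with the three properties is a product of the two exponentials. -/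
theorem exists_isExp_of_properties (hm : 1 ≤ m) {T : CSchwartz m →ₗ[ℂ] CSchwartz m}
    (hT : CliffordHelmholtz T) (hd : DiagonalPeriodic M T)
    (h4 : T ∘ₗ T ∘ₗ T ∘ₗ T = LinearMap.id)
    (hP : ∀ a b c d : Fin 4, ∃ P : CSchwartz m →ₗ[ℂ] CSchwartz m, IsExpCasimir M a b c d P)
    (hQ : ∃ Q : CSchwartz m →ₗ[ℂ] CSchwartz m, IsExpOscillator M Q) :
    ∃ (a b c d : Fin 4) (P Q : CSchwartz m →ₗ[ℂ] CSchwartz m),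
      IsExpCasimir M a b c d P ∧ IsExpOscillator M Q ∧ T = P ∘ₗ Q := by
  obtain ⟨μ, hμ, hper⟩ := hd
  obtain ⟨ν, hν⟩ := exists_eigenvalue_exponent hm hμ hper h4 ((m - 1) / 2)
  obtain ⟨a, b, c, d, habcd⟩ := exists_casimirValue m ν
  obtain ⟨P, hP⟩ := hP a b c d
  obtain ⟨Q, hQ⟩ := hQ
  refine ⟨a, b, c, d, P, Q, hP, hQ, ?_⟩
  have hPQ := comp_apply_of_isExp hm hP hQ
  obtain ⟨hS, -, -⟩ := properties_of_isExp hm hP hQ rfl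
  rw [cliffordHelmholtz_iff] at hT hS
  -- `T` may be discontinuous, so agreement on the Hermite functions does not suffice by density.
  -- Both operators satisfy the ladder relations and hence commute with `h`, which makes
  -- `eq_zero_of_commute_hOp` applicable to the difference.
  rw [← sub_eq_zero]
  refine LinearMap.ext fun F => eq_zero_of_commute_hOp hm (fun F => ?_) (fun j k v hv => ?_) F
  · simp only [LinearMap.sub_apply, map_hOp_of_ladder hT.1 hT.2, map_hOp_of_ladder hS.1 hS.2,
      map_sub]
  · rw [LinearMap.sub_apply, sub_eq_zero, hPQ j k v hv]
    refine eqOn_hermiteSpace (M := M) (T := Complex.I ^ (casimirValue m a b c d k + k + j) •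
      LinearMap.id) hm (fun l => ?_) hv
    have h0 : T (gaussMulCl m (M k l)) = μ 0 k • gaussMulCl m (M k l) := by
      have h := hμ 0 k l
      rwa [psi_eq hm 0 k (M k l).2] at h
    rw [psi_eq hm j k (M k l).2, apply_hermiteSpace_of_ladder hT.1, h0,
      hν k ⟨l⟩ _ (habcd k), map_smul, smul_smul, ← pow_add, add_comm j]
    rfl

end Classification

end CliffordFourier

end

theorem theorem3p5 (m : ℕ) (hm : 1 ≤ m) {ι : ℕ → Type*}
    (M : ∀ k : ℕ, Module.Basis (ι k) ℂ (CliffordFourier.monogenics m k)) :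
    (∀ a b c d : Fin 4, ∃! P : CliffordFourier.CSchwartz m →ₗ[ℂ] CliffordFourier.CSchwartz m,
      CliffordFourier.IsExpCasimir M a b c d P) ∧
    (∃! Q : CliffordFourier.CSchwartz m →ₗ[ℂ] CliffordFourier.CSchwartz m,
      CliffordFourier.IsExpOscillator M Q) ∧
    (∀ T : CliffordFourier.CSchwartz m →ₗ[ℂ] CliffordFourier.CSchwartz m,
      (CliffordFourier.CliffordHelmholtz T ∧ CliffordFourier.DiagonalPeriodic M T ∧
        T ∘ₗ T ∘ₗ T ∘ₗ T = LinearMap.id) ↔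
      ∃ (a b c d : Fin 4) (P Q : CliffordFourier.CSchwartz m →ₗ[ℂ] CliffordFourier.CSchwartz m),
        CliffordFourier.IsExpCasimir M a b c d P ∧ CliffordFourier.IsExpOscillator M Q ∧
        T = P ∘ₗ Q) := by
  have hP : ∀ a b c d : Fin 4, ∃! P : CliffordFourier.CSchwartz m →ₗ[ℂ] CliffordFourier.CSchwartz m,
      CliffordFourier.IsExpCasimir M a b c d P := fun a b c d => by
    simp only [CliffordFourier.isExpCasimir_iff hm]
    exact CliffordFourier.existsUnique_multiplier hm fun _ k =>
      CliffordFourier.casimirValue m a b c d k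
  have hQ : ∃! Q : CliffordFourier.CSchwartz m →ₗ[ℂ] CliffordFourier.CSchwartz m,
      CliffordFourier.IsExpOscillator M Q := by
    simp only [CliffordFourier.isExpOscillator_iff hm]
    exact CliffordFourier.existsUnique_multiplier hm fun j k => j + k
  refine ⟨hP, hQ, fun T => ⟨fun ⟨h1, h2, h3⟩ => ?_, ?_⟩⟩
  · exact CliffordFourier.exists_isExp_of_properties hm h1 h2 h3
      (fun a b c d => (hP a b c d).exists) hQ.exists
  · rintro ⟨a, b, c, d, P, Q, hP, hQ, hT⟩
    exact CliffordFourier.properties_of_isExp hm hP hQ hT
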